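/- **Setting.** Let $x^a$ be local coordinates, $n$ even and $m$ odd, on a manifold or supermanifold $M$ of dimension $n|m$; $\tilde a\in\{0,1\}$ is the parity of $x^a$, momenta have the parity of the corresponding positions, derivatives are left derivatives, and $d$ is odd. Functions on superdomains are smooth functions of the even coordinates with values in the Grassmann algebra generated by the odd coordinates. Identities between functions, and trajectories, are understood at $\Lambda_N$-points for every $N$, where $\Lambda_N$ is the real Grassmann algebra with $N$ generators (for $m=0$ this includes ordinary real points, $N=0$). A thick morphism $M\to M$ is given by an even generating function $S(x,q)$, to which corresponds the canonical relation $p_a=\partial S/\partial x^a(x,q)$, $y^a=(-1)^{\tilde a}\,\partial S/\partial q_a(x,q)$ between $(x,p)$ and $(y,q)$. The composition $\Phi_{32}\circ\Phi_{21}$ has the generating function $S_{31}(x,r)=S_{32}(y,r)+S_{21}(x,q)-y^aq_a$, where $y,q$ are uniquely determined by $q_a=\partial S_{32}/\partial y^a(y,r)$ and $y^a=(-1)^{\tilde a}\partial S_{21}/\partial q_a(x,q)$. Let $\Phi_t$ be a (possibly local) one-parameter group of thick diffeomorphisms with Hamiltonian $H$. That is, the generating functions $S_t(x,q)$ are even and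 smooth in $(t,x,q)$ on an open set $D$ (with $D_t$ the set of $(x,q)$ such that $(t,x,q)\in D$), $S_0(x,q)=x^aq_a$, $\Phi_{t+s}=\Phi_t\circ\Phi_s$ for all $t,s$ with $ts\ge 0$, where $\Phi_{t}$ is defined by $S_t$ on $D_t$, and $\partial S_t/\partial t|_{t=0}=H$ on $D_0$. Consider the Hamiltonian system $\dot y^a=(-1)^{\tilde a}\,\partial H/\partial q_a$, $\dot q_a=-\partial H/\partial y^a$ on $D_0$, where $y$ is the position and $q$ the momentum. Trajectories starting at $x$ are considered as long as $(\tau,x,q(\tau))\in D$. **Proposition.** The generating function $S_t(x,q)$ is the Legendre transform ($y\to q$) of the classical action $W_t$ of the Hamiltonian system. Precisely: 1. For every $(x,q)\in D_t$ there is a trajectory $(y(\tau),q(\tau))$ between the times $0$ and $t$ with $y(0)=x$ and $q(t)=q$. For every such trajectory, $y^a(t)=(-1)^{\tilde a}\partial S_t/\partial q_a(x,q)$, $q_a(0)=\partial S_t/\partial x^a(x,q)$, and $$S_t(x,q)=y^a(t)\,q_a-W_t,\qquad W_t=\int_0^t\bigl(q_a\,dy^a-H\,d\tau\bigr)=\int_0^t\bigl(\dot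 y^a q_a-H\bigr)\,d\tau ,$$ $$S_t(x,q)=x^a\,q_a(0)+\int_0^t\bigl((-1)^{\tilde a}\,y^a\,dq_a+H(y(\tau),q(\tau))\,d\tau\bigr),$$ where the integrals are taken along the trajectory, and $(-1)^{\tilde a}y^a\,dq_a=d\tau\;y^a\dot q_a$ because $d\tau$ is odd. 2. Let $W_t(x,y)$ be (a smooth branch of) the action as a function of the initial and final positions on an open set $O$: for every $(x,y)$ in $O$, $W_t(x,y)$ is the action of a trajectory from $x$ at time $0$ to $y$ at time $t$ which depends smoothly on $(x,y)$. Then the equations $q_a=\partial W_t/\partial y^a(x,y)$ define for each $(x,y)\in O$ a momentum $q$ with $(x,q)\in D_t$, they determine $y\in O$ from $x$ and $q$, and $S_t(x,q)=y^aq_a-W_t(x,y)$. -/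

import Mathlib

open scoped ContDiff

noncomputable section

namespace ThickMorphism

/-- The real Grassmann algebra with one odd generator for each element of `κ`. -/
abbrev Grassmann (κ : Type) : Type := ExteriorAlgebra ℝ (κ → ℝ)

/-- The coordinates of an element of the (finite-dimensional) Grassmann algebra with respect to
a basis. They serve only to fix a norm, hence the usual topology, on the algebra. -/
def grassmannCoords (κ : Type) [Fintype κ] :
    Grassmann κ ≃ₗ[ℝ] (Finset (Fin (Module.finrank ℝ (κ → ℝ))) → ℝ) :=
  (Module.Basis.ExteriorAlgebra (Module.finBasis ℝ (κ → ℝ))).equivFun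

instance instNormedAddCommGroupGrassmann (κ : Type) [Fintype κ] :
    NormedAddCommGroup (Grassmann κ) :=
  NormedAddCommGroup.induced (Grassmann κ) (Finset (Fin (Module.finrank ℝ (κ → ℝ))) → ℝ)
    (grassmannCoords κ).toLinearMap (grassmannCoords κ).injective

instance instNormedSpaceGrassmann (κ : Type) [Fintype κ] : NormedSpace ℝ (Grassmann κ) :=
  NormedSpace.induced ℝ (Grassmann κ) (Finset (Fin (Module.finrank ℝ (κ → ℝ))) → ℝ)
    (grassmannCoords κ).toLinearMap

/-- The even part of a Grassmann algebra. -/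
abbrev evenPart (κ : Type) : Submodule ℝ (Grassmann κ) :=
  CliffordAlgebra.evenOdd (0 : QuadraticForm ℝ (κ → ℝ)) 0

/-- The odd part of a Grassmann algebra. -/
abbrev oddPart (κ : Type) : Submodule ℝ (Grassmann κ) :=
  CliffordAlgebra.evenOdd (0 : QuadraticForm ℝ (κ → ℝ)) 1

/-- The body (real part) of an element of a Grassmann algebra: all generators are sent to zero. -/
def gbody {κ : Type} (a : Grassmann κ) : ℝ := ExteriorAlgebra.algebraMapInv a

/-- The soul (nilpotent part) of an element of a Grassmann algebra. -/
def gsoul {κ : Type} (a : Grassmann κ) : Grassmann κ := a - algebraMap ℝ (Grassmann κ) (gbody a)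

/-- The Grassmann algebra `Λ_N` with `N` generators, from which points take their coordinates. -/
abbrev Lam (N : ℕ) : Type := Grassmann (Fin N)

theorem iota_mul_odd {κ : Type} (v : κ → ℝ) (b : Grassmann κ) (hb : b ∈ oddPart κ) :
    ExteriorAlgebra.ι ℝ v * b = -(b * ExteriorAlgebra.ι ℝ v) := by
  have swap : ∀ u w : κ → ℝ, ExteriorAlgebra.ι ℝ u * ExteriorAlgebra.ι ℝ w
      = -(ExteriorAlgebra.ι ℝ w * ExteriorAlgebra.ι ℝ u) := fun u w =>
    eq_neg_of_add_eq_zero_left (ExteriorAlgebra.ι_add_mul_swap u w)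
  refine CliffordAlgebra.odd_induction (0 : QuadraticForm ℝ (κ → ℝ))
    (P := fun x _ => ExteriorAlgebra.ι ℝ v * x = -(x * ExteriorAlgebra.ι ℝ v)) ?_ ?_ ?_ b hb
  · intro w
    exact swap v w
  · intro x y _ _ h1 h2
    rw [mul_add, add_mul, h1, h2, neg_add]
  · intro m₁ m₂ x _ h
    change ExteriorAlgebra.ι ℝ v * (ExteriorAlgebra.ι ℝ m₁ * ExteriorAlgebra.ι ℝ m₂ * x)
      = -(ExteriorAlgebra.ι ℝ m₁ * ExteriorAlgebra.ι ℝ m₂ * x * ExteriorAlgebra.ι ℝ v)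
    rw [mul_assoc _ x, ← neg_eq_iff_eq_neg.mpr h, ← mul_assoc, ← mul_assoc, swap v m₁,
      neg_mul, mul_assoc (ExteriorAlgebra.ι ℝ m₁), swap v m₂]
    simp [mul_assoc]

theorem odd_mul_odd {κ : Type} (a b : Grassmann κ) (ha : a ∈ oddPart κ) (hb : b ∈ oddPart κ) :
    a * b = -(b * a) := by
  refine CliffordAlgebra.odd_induction (0 : QuadraticForm ℝ (κ → ℝ))
    (P := fun x _ => x * b = -(b * x)) ?_ ?_ ?_ a ha
  · intro v
    exact iota_mul_odd v b hb
  · intro x y _ _ h1 h2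
    rw [mul_add, add_mul, h1, h2, neg_add]
  · intro m₁ m₂ x _ h
    change ExteriorAlgebra.ι ℝ m₁ * ExteriorAlgebra.ι ℝ m₂ * x * b
      = -(b * (ExteriorAlgebra.ι ℝ m₁ * ExteriorAlgebra.ι ℝ m₂ * x))
    have e1 := iota_mul_odd m₁ b hb
    have e2 := iota_mul_odd m₂ b hb
    rw [mul_assoc, h, mul_neg, ← mul_assoc, mul_assoc (ExteriorAlgebra.ι ℝ m₁), e2, mul_neg,
      ← mul_assoc, e1]
    simp [mul_assoc]

theorem odd_sq {κ : Type} (a : Grassmann κ) (ha : a ∈ oddPart κ) : a * a = 0 := by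
  have h : (2 : ℝ) • (a * a) = 0 := by
    rw [two_smul]
    exact eq_neg_iff_add_eq_zero.mp (odd_mul_odd a a ha ha)
  exact (smul_eq_zero.mp h).resolve_left two_ne_zero

/-- A `Λ_N`-point of the superspace with even coordinates indexed by `ι` and odd coordinates
indexed by `κ`. -/
structure SuperPoint (N : ℕ) (ι κ : Type) where
  /-- the even coordinates -/
  ev : ι → evenPart (Fin N)
  /-- the odd coordinates -/
  od : κ → oddPart (Fin N)

/-- The real point underlying a `Λ_N`-point. -/
def SuperPoint.body {N : ℕ} {ι κ : Type} (z : SuperPoint N ι κ) : ι → ℝ :=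
  fun i => gbody (z.ev i : Lam N)

/-- The point of the doubled superspace with components `x` and `q`. -/
def SuperPoint.pair {N : ℕ} {ι κ : Type} (x q : SuperPoint N ι κ) :
    SuperPoint N (ι ⊕ ι) (κ ⊕ κ) :=
  ⟨Sum.elim x.ev q.ev, Sum.elim x.od q.od⟩

/-- The contraction `x^a q_a`, over all even and odd coordinates. -/
def contract {N : ℕ} {ι κ : Type} [Fintype ι] [Fintype κ] (x q : SuperPoint N ι κ) : Lam N :=
  (∑ i, (x.ev i : Lam N) * (q.ev i : Lam N)) + ∑ α, (x.od α : Lam N) * (q.od α : Lam N)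

/-- Functions of the even coordinates `x` and the odd coordinates `ξ`: maps from real points to
the Grassmann algebra generated by the `ξ`. Smoothness, on an open set, is required where such
functions are used; this gives the algebra `C^∞(U) ⊗ Λ(ξ)` of functions on a superdomain. -/
abbrev SuperFun (ι κ : Type) : Type := (ι → ℝ) → Grassmann κ

section

variable {ι κ : Type} [Fintype ι] [DecidableEq ι] [Fintype κ] [DecidableEq κ]

/-- The partial derivative in an even coordinate. -/
def dEven (f : SuperFun ι κ) (i : ι) : SuperFun ι κ :=
  fun b => fderiv ℝ f b (Pi.single i 1)

/-- The left partial derivative in an odd coordinate: the antiderivation of the Grassmann algebra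
with `ξ^β ↦ δ^β_α`. -/
def dOdd (f : SuperFun ι κ) (α : κ) : SuperFun ι κ :=
  fun b => CliffordAlgebra.contractLeft (Q := (0 : QuadraticForm ℝ (κ → ℝ)))
    (LinearMap.proj α : (κ → ℝ) →ₗ[ℝ] ℝ) (f b)

/-- Substitution of odd elements of `Λ_N` for the odd coordinates. -/
def substOdd {N : ℕ} (θ : κ → oddPart (Fin N)) : Grassmann κ →ₐ[ℝ] Lam N :=
  ExteriorAlgebra.lift ℝ
    ⟨∑ α, (LinearMap.proj α : (κ → ℝ) →ₗ[ℝ] ℝ).smulRight (θ α : Lam N), fun v => by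
      apply odd_sq
      simp only [LinearMap.sum_apply, LinearMap.smulRight_apply]
      exact Submodule.sum_mem _ fun α _ => Submodule.smul_mem _ _ (θ α).2⟩

/-- The value of a superfunction at a `Λ_N`-point: odd coordinates are substituted, even
coordinates enter through the Taylor expansion at the body in powers of the soul. The expansion is
finite, since products of more than `N` souls vanish. -/
def eval {N : ℕ} (f : SuperFun ι κ) (z : SuperPoint N ι κ) : Lam N :=
  ∑ k ∈ Finset.range (N + 1), (1 / (k.factorial : ℝ)) •
    ∑ i : Fin k → ι, (List.ofFn fun j => gsoul (z.ev (i j) : Lam N)).prod *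
      substOdd z.od (iteratedFDeriv ℝ k f z.body fun j => Pi.single (i j) 1)

/-- A superfunction is even on a set. -/
def IsEvenOn (f : SuperFun ι κ) (U : Set (ι → ℝ)) : Prop := ∀ b ∈ U, f b ∈ evenPart κ

end

section

variable {n m : ℕ}

/-- Even coordinates of a cotangent bundle or of a product: two copies of the `n` even ones. -/
abbrev Ev (n : ℕ) : Type := Fin n ⊕ Fin n

/-- Odd coordinates of a cotangent bundle or of a product: two copies of the `m` odd ones. -/
abbrev Od (m : ℕ) : Type := Fin m ⊕ Fin m

/-- The `Λ_N`-points of `ℝ^{n|m}`; also used for momenta. -/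
abbrev Pt (N n m : ℕ) : Type := SuperPoint N (Fin n) (Fin m)

/-- `p_a = ∂S/∂x^a (x,q)` for all `a`. -/
def MomentumEq {N : ℕ} (S : SuperFun (Ev n) (Od m)) (x q p : Pt N n m) : Prop :=
  (∀ i, (p.ev i : Lam N) = eval (dEven S (Sum.inl i)) (x.pair q)) ∧
  (∀ α, (p.od α : Lam N) = eval (dOdd S (Sum.inl α)) (x.pair q))

/-- `y^a = (-1)^{ã} ∂S/∂q_a (x,q)` for all `a`. -/
def PositionEq {N : ℕ} (S : SuperFun (Ev n) (Od m)) (x q y : Pt N n m) : Prop :=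
  (∀ i, (y.ev i : Lam N) = eval (dEven S (Sum.inr i)) (x.pair q)) ∧
  (∀ α, (y.od α : Lam N) = -eval (dOdd S (Sum.inr α)) (x.pair q))

/-- `y` and `q` satisfy the equations `q_a = ∂S₃₂/∂y^a (y,r)`, `y^a = (-1)^{ã} ∂S₂₁/∂q_a (x,q)`
of the composition of thick morphisms. -/
def IsIntermediate {N : ℕ} (D₃₂ : Set (Ev n → ℝ)) (S₃₂ : SuperFun (Ev n) (Od m))
    (D₂₁ : Set (Ev n → ℝ)) (S₂₁ : SuperFun (Ev n) (Od m)) (x r y q : Pt N n m) : Prop :=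
  (x.pair q).body ∈ D₂₁ ∧ (y.pair r).body ∈ D₃₂ ∧
    MomentumEq S₃₂ y r q ∧ PositionEq S₂₁ x q y

/-- The thick morphism with generating function `S₃₁`, defined on `D₃₁`, is the composition
`Φ₃₂ ∘ Φ₂₁`: at every point the intermediate `y`, `q` are determined by their equations, and
`S₃₁(x,r) = S₃₂(y,r) + S₂₁(x,q) - y^a q_a`. -/
def IsComposition (D₃₂ : Set (Ev n → ℝ)) (S₃₂ : SuperFun (Ev n) (Od m))
    (D₂₁ : Set (Ev n → ℝ)) (S₂₁ : SuperFun (Ev n) (Od m))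
    (D₃₁ : Set (Ev n → ℝ)) (S₃₁ : SuperFun (Ev n) (Od m)) : Prop :=
  ∀ (N : ℕ) (x r : Pt N n m), (x.pair r).body ∈ D₃₁ →
    (∃! yq : Pt N n m × Pt N n m, IsIntermediate D₃₂ S₃₂ D₂₁ S₂₁ x r yq.1 yq.2) ∧
    ∀ y q : Pt N n m, IsIntermediate D₃₂ S₃₂ D₂₁ S₂₁ x r y q →
      eval S₃₁ (x.pair r) = eval S₃₂ (y.pair r) + eval S₂₁ (x.pair q) - contract y q

/-- The generating function `x^a q_a` of the identity. -/
def idGen (n m : ℕ) : SuperFun (Ev n) (Od m) := fun b =>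
  algebraMap ℝ (Grassmann (Od m)) (∑ i, b (Sum.inl i) * b (Sum.inr i)) +
    ∑ α : Fin m, ExteriorAlgebra.ι ℝ (Pi.single (Sum.inl α) (1 : ℝ) : Od m → ℝ) *
      ExteriorAlgebra.ι ℝ (Pi.single (Sum.inr α) (1 : ℝ) : Od m → ℝ)

/-- The set of `(x,q)` where the generating function at time `t` is defined. -/
def slice (D : Set (ℝ × (Ev n → ℝ))) (t : ℝ) : Set (Ev n → ℝ) := {z | (t, z) ∈ D}

/-- `S t` are the generating functions, in one coordinate system, of a one-parameter group of
thick diffeomorphisms `Φ_t` with Hamiltonian `H`. As usual for flows the group may be local: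
`S t (x,q)` is defined for `(t,(x,q))` in an open set `D`. The group law is required for `t`, `s`
of the same sign, since for opposite signs a point of `Φ_{t+s}` need not factor locally; a global
group has it for all `t` and `s`. -/
structure IsThickGroup (D : Set (ℝ × (Ev n → ℝ))) (S : ℝ → SuperFun (Ev n) (Od m))
    (H : SuperFun (Ev n) (Od m)) : Prop where
  isOpen : IsOpen D
  smooth : ContDiffOn ℝ ∞ (fun w : ℝ × (Ev n → ℝ) => S w.1 w.2) D
  even : ∀ t, IsEvenOn (S t) (slice D t)
  /-- `Φ_0` is the identity. -/
  zero : ∀ z ∈ slice D 0, S 0 z = idGen n m z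
  /-- `Φ_{t+s} = Φ_t ∘ Φ_s`. -/
  add : ∀ t s : ℝ, 0 ≤ t * s →
    IsComposition (slice D t) (S t) (slice D s) (S s) (slice D (t + s)) (S (t + s))
  /-- `S_ε(x,q) = x^a q_a + ε H(x,q)` to first order in `ε`. -/
  generator : ∀ z ∈ slice D 0, HasDerivAt (fun t => S t z) (H z) 0

/-- `(y,q)` solves Hamilton's equations `dy^a/dτ = (-1)^{ã} ∂H/∂q_a`, `dq_a/dτ = -∂H/∂y^a`
on the interval between `0` and `t`, in the open set `U`. -/
structure IsTrajectory {N : ℕ} (H : SuperFun (Ev n) (Od m)) (U : Set (Ev n → ℝ)) (t : ℝ)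
    (y q : ℝ → Pt N n m) : Prop where
  mem : ∀ τ ∈ Set.uIcc 0 t, ((y τ).pair (q τ)).body ∈ U
  pos_even : ∀ τ ∈ Set.uIcc 0 t, ∀ i, HasDerivWithinAt (fun u => ((y u).ev i : Lam N))
    (eval (dEven H (Sum.inr i)) ((y τ).pair (q τ))) (Set.uIcc 0 t) τ
  pos_odd : ∀ τ ∈ Set.uIcc 0 t, ∀ α, HasDerivWithinAt (fun u => ((y u).od α : Lam N))
    (-eval (dOdd H (Sum.inr α)) ((y τ).pair (q τ))) (Set.uIcc 0 t) τ
  mom_even : ∀ τ ∈ Set.uIcc 0 t, ∀ i, HasDerivWithinAt (fun u => ((q u).ev i : Lam N))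
    (-eval (dEven H (Sum.inl i)) ((y τ).pair (q τ))) (Set.uIcc 0 t) τ
  mom_odd : ∀ τ ∈ Set.uIcc 0 t, ∀ α, HasDerivWithinAt (fun u => ((q u).od α : Lam N))
    (-eval (dOdd H (Sum.inl α)) ((y τ).pair (q τ))) (Set.uIcc 0 t) τ

/-- A trajectory in phase space, where `H` is defined (`slice D 0`), that starts at the position
`x` and along which `S τ (x, q τ)` stays defined. -/
structure IsTrajectoryFrom {N : ℕ} (D : Set (ℝ × (Ev n → ℝ))) (H : SuperFun (Ev n) (Od m))
    (t : ℝ) (x : Pt N n m) (y q : ℝ → Pt N n m) : Prop where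
  traj : IsTrajectory H (slice D 0) t y q
  start : y 0 = x
  mem_domain : ∀ τ ∈ Set.uIcc 0 t, (x.pair (q τ)).body ∈ slice D τ

/-- `∫_0^t (dy^a q_a - H dτ)`, where `dy^a q_a = q_a dy^a = dτ (dy^a/dτ) q_a`
(the differential is odd): the classical action of a trajectory. -/
def action {N : ℕ} (H : SuperFun (Ev n) (Od m)) (t : ℝ) (y q : ℝ → Pt N n m) : Lam N :=
  ∫ τ in (0 : ℝ)..t,
    ((∑ i, derivWithin (fun u => ((y u).ev i : Lam N)) (Set.uIcc 0 t) τ * ((q τ).ev i : Lam N)) +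
      (∑ α, derivWithin (fun u => ((y u).od α : Lam N)) (Set.uIcc 0 t) τ * ((q τ).od α : Lam N)) -
      eval H ((y τ).pair (q τ)))

/-- `∫_0^t ((-1)^{ã} y^a dq_a + H dτ)`. The differential is odd, so that moving `dτ` to the left
of `y^a` gives `(-1)^{ã} y^a dq_a = (-1)^{ã} y^a dτ (dq_a/dτ) = dτ y^a (dq_a/dτ)`. -/
def dualAction {N : ℕ} (H : SuperFun (Ev n) (Od m)) (t : ℝ) (y q : ℝ → Pt N n m) : Lam N :=
  ∫ τ in (0 : ℝ)..t,
    ((∑ i, ((y τ).ev i : Lam N) * derivWithin (fun u => ((q u).ev i : Lam N)) (Set.uIcc 0 t) τ) +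
      (∑ α, ((y τ).od α : Lam N) * derivWithin (fun u => ((q u).od α : Lam N)) (Set.uIcc 0 t) τ) +
      eval H ((y τ).pair (q τ)))

/-- `W` is (a smooth branch of) the classical action as a function `W_t(x,y)` of the initial and
final positions, on the open set `O`: there is a smooth family of trajectories, one for each
`(x,y)`, from `x` at time `0` to `y` at time `t`, whose actions are the values of `W`. The
smooth dependence on `(x,y)` is expressed through the final momenta, which determine the
trajectories. -/
structure IsActionFunction (D : Set (ℝ × (Ev n → ℝ))) (H : SuperFun (Ev n) (Od m)) (t : ℝ)
    (O : Set (Ev n → ℝ)) (W : SuperFun (Ev n) (Od m)) : Prop where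
  isOpen : IsOpen O
  smooth : ContDiffOn ℝ ∞ W O
  even : IsEvenOn W O
  family : ∃ (Qev : Fin n → SuperFun (Ev n) (Od m)) (Qod : Fin m → SuperFun (Ev n) (Od m)),
    (∀ i, ContDiffOn ℝ ∞ (Qev i) O) ∧ (∀ α, ContDiffOn ℝ ∞ (Qod α) O) ∧
    ∀ (N : ℕ) (x y : Pt N n m), (x.pair y).body ∈ O → ∃ Y Q : ℝ → Pt N n m,
      IsTrajectoryFrom D H t x Y Q ∧ Y t = y ∧
      (∀ i, ((Q t).ev i : Lam N) = eval (Qev i) (x.pair y)) ∧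
      (∀ α, ((Q t).od α : Lam N) = eval (Qod α) (x.pair y)) ∧
      eval W (x.pair y) = action H t Y Q

/-- `q_a = ∂W/∂y^a (x,y)` for all `a`. -/
def LegendreMomentum {N : ℕ} (W : SuperFun (Ev n) (Od m)) (x y q : Pt N n m) : Prop :=
  (∀ i, (q.ev i : Lam N) = eval (dEven W (Sum.inr i)) (x.pair y)) ∧
  (∀ α, (q.od α : Lam N) = eval (dOdd W (Sum.inr α)) (x.pair y))

/-- `S(x,q)`, defined on `V`, is the Legendre transform `y → q` of `W(x,y)`, defined on `O`, with
`x` as a parameter: the equation `q_a = ∂W/∂y^a` gives for every `(x,y)` in `O` a `q` with `(x,q)`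
in `V`, it determines `y` from `x` and `q`, and `S(x,q) = y^a q_a - W(x,y)`. -/
def IsLegendreTransform (O : Set (Ev n → ℝ)) (W : SuperFun (Ev n) (Od m))
    (V : Set (Ev n → ℝ)) (S : SuperFun (Ev n) (Od m)) : Prop :=
  (∀ (N : ℕ) (x y : Pt N n m), (x.pair y).body ∈ O → ∃ q, LegendreMomentum W x y q) ∧
  (∀ (N : ℕ) (x y q : Pt N n m), (x.pair y).body ∈ O → LegendreMomentum W x y q →
    (x.pair q).body ∈ V ∧ eval S (x.pair q) = contract y q - eval W (x.pair y)) ∧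
  (∀ (N : ℕ) (x y y' q : Pt N n m), (x.pair y).body ∈ O → (x.pair y').body ∈ O →
    LegendreMomentum W x y q → LegendreMomentum W x y' q → y = y')

end

end ThickMorphism

end

noncomputable section

namespace ThickMorphism

open scoped Topology

set_option linter.unusedSectionVars false

/-! Fix `(t, x, r)` and factor `Φ_t = Φ_{t-s} ∘ Φ_s` for every `s` between `0` and `t`. The
intermediate points `(y_s, q_s)` satisfy `y_0 = x` and `q_t = r`, and they turn out to be the
required trajectory. The composition formula for `S_t(x,r)` is stationary in `y` and `q`, because
stationarity is exactly the pair of equations that defines the intermediate point. Differentiating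
it in `s` therefore leaves only the time derivatives of `S_{t-s}(y_s,r)` and `S_s(x,q_s)`, which
must agree (`IsThickGroup.timeVal_eq`). At the two ends of the interval this is the Hamilton–Jacobi
equation, once in the momenta and once in the positions (`hamiltonJacobi_pos`,
`hamiltonJacobi_mom`).

Differentiating these equations in `x` and `q` and using the symmetry of second derivatives gives
transport equations for `∂S/∂x` and `∂S/∂q` (`transport_pos`, `transport_mom`). With them, the
derivative in `s` of the equations for `(y_s, q_s)` says that the defects in Hamilton's equations
solve the homogeneous linearised intermediate equations. These have only the zero solution, so the
path is a trajectory.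

Nondegeneracy of the linearised equations is not assumed. It follows from uniqueness of intermediate
points over larger Grassmann algebras (`nondegenerate`): if `ε` is a product of two new generators,
then `ε² = 0`, and a solution `(a, b)` of the linearised equations gives a second intermediate point
`(y + εa, q + εb)`. The same fact lets the implicit function theorem prove that the path is
differentiable.

Conversely, along any trajectory from `x`, the difference between `y_τ` and the position assigned by
`S_τ(x,q_τ)` vanishes at `τ = 0` and has velocity bounded by its own size near its zeros, by the
transport equation. Grönwall's inequality makes it vanish (`trajectory_pos`), and then `∂S_τ/∂x` is
constant in time (`trajectory_mom`). Hence `dS_τ(x,q_τ) = (-1)^{ã} y^a dq_a + H dτ`. Integration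
gives the second formula for `S_t`, and the product rule for `y^a q_a` gives the first. For the
Legendre transform, `W = y^a Q_a - S_t(x,Q)` with `Q(x,y)` the final momentum. The variation of `Q`
drops out, so `∂W/∂y = Q`.

Points over `Λ_N` form a finite-dimensional real vector space, on which values of superfunctions
obey an ordinary chain rule (`exists_hasStrictFDerivAt_eval`). An identity contracted with arbitrary
odd increments can be stripped of them only when an unused odd generator is available. Hence such
identities are first included in `Λ_{N+1}`. -/

instance instFiniteDimensionalGrassmann (κ : Type) [Fintype κ] :
    FiniteDimensional ℝ (Grassmann κ) :=
  LinearEquiv.finiteDimensional (grassmannCoords κ).symm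

/-! ### Parity and nilpotency in Grassmann algebras. -/

section Algebra

variable {κ κ' : Type}

theorem gbody_add (a b : Grassmann κ) : gbody (a + b) = gbody a + gbody b := map_add _ a b

theorem gbody_smul (r : ℝ) (a : Grassmann κ) : gbody (r • a) = r * gbody a := map_smul _ r a

theorem gbody_mul (a b : Grassmann κ) : gbody (a * b) = gbody a * gbody b := map_mul _ a b

theorem gbody_iota (v : κ → ℝ) : gbody (ExteriorAlgebra.ι ℝ v) = 0 := by
  simp [gbody, ExteriorAlgebra.algebraMapInv]

theorem gbody_algebraMap (r : ℝ) : gbody (algebraMap ℝ (Grassmann κ) r) = r :=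
  ExteriorAlgebra.algebraMap_leftInverse (κ → ℝ) r

theorem gbody_gsoul (a : Grassmann κ) : gbody (gsoul a) = 0 := by
  have : gbody (a - algebraMap ℝ (Grassmann κ) (gbody a))
      = gbody a - gbody (algebraMap ℝ (Grassmann κ) (gbody a)) := map_sub _ _ _
  rw [gsoul, this, gbody_algebraMap, sub_self]

theorem gsoul_add (a b : Grassmann κ) : gsoul (a + b) = gsoul a + gsoul b := by
  simp only [gsoul, gbody_add, map_add]; abel

theorem gsoul_smul (r : ℝ) (a : Grassmann κ) : gsoul (r • a) = r • gsoul a := by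
  rw [gsoul, gsoul, gbody_smul, map_mul, smul_sub, Algebra.smul_def, Algebra.smul_def r (algebraMap ℝ _ _)]

theorem gbody_smul_add_gsoul_mul (a b : Grassmann κ) : gbody a • b + gsoul a * b = a * b := by
  rw [gsoul, sub_mul, Algebra.smul_def]; abel

theorem algebraMap_mem_even (r : ℝ) : algebraMap ℝ (Grassmann κ) r ∈ evenPart κ := by
  rw [Algebra.algebraMap_eq_smul_one]
  exact Submodule.smul_mem _ _ (CliffordAlgebra.one_le_evenOdd_zero _ (Submodule.one_le.mp le_rfl))

theorem gsoul_mem_even {a : Grassmann κ} (ha : a ∈ evenPart κ) : gsoul a ∈ evenPart κ :=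
  Submodule.sub_mem _ ha (algebraMap_mem_even _)

theorem iota_mem_odd (v : κ → ℝ) : ExteriorAlgebra.ι ℝ v ∈ oddPart κ :=
  CliffordAlgebra.ι_mem_evenOdd_one _ v

theorem even_mul_even {a b : Grassmann κ} (ha : a ∈ evenPart κ) (hb : b ∈ evenPart κ) :
    a * b ∈ evenPart κ := by
  have h := CliffordAlgebra.evenOdd_mul_le (0 : QuadraticForm ℝ (κ → ℝ)) 0 0
    (Submodule.mul_mem_mul ha hb)
  simpa using h

theorem even_mul_odd {a b : Grassmann κ} (ha : a ∈ evenPart κ) (hb : b ∈ oddPart κ) :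
    a * b ∈ oddPart κ := by
  have h := CliffordAlgebra.evenOdd_mul_le (0 : QuadraticForm ℝ (κ → ℝ)) 0 1
    (Submodule.mul_mem_mul ha hb)
  simpa using h

theorem odd_mul_odd_mem {a b : Grassmann κ} (ha : a ∈ oddPart κ) (hb : b ∈ oddPart κ) :
    a * b ∈ evenPart κ := by
  have h := CliffordAlgebra.evenOdd_mul_le (0 : QuadraticForm ℝ (κ → ℝ)) 1 1
    (Submodule.mul_mem_mul ha hb)
  exact h

/-- A generator passes a product of two generators with two sign changes, so even elements commute
with generators, and these generate the algebra. -/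
theorem even_mul_comm {a : Grassmann κ} (ha : a ∈ evenPart κ) (b : Grassmann κ) :
    a * b = b * a := by
  have key : ∀ v : κ → ℝ, ExteriorAlgebra.ι ℝ v * a = a * ExteriorAlgebra.ι ℝ v := by
    intro v
    refine CliffordAlgebra.even_induction (0 : QuadraticForm ℝ (κ → ℝ))
      (motive := fun x _ => ExteriorAlgebra.ι ℝ v * x = x * ExteriorAlgebra.ι ℝ v) ?_ ?_ ?_ a ha
    · intro r
      exact (Algebra.commutes r _).symm
    · intro x y _ _ h1 h2
      rw [mul_add, add_mul, h1, h2]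
    · intro m₁ m₂ x _ h
      change ExteriorAlgebra.ι ℝ v * (ExteriorAlgebra.ι ℝ m₁ * ExteriorAlgebra.ι ℝ m₂ * x)
        = ExteriorAlgebra.ι ℝ m₁ * ExteriorAlgebra.ι ℝ m₂ * x * ExteriorAlgebra.ι ℝ v
      rw [mul_assoc _ x, ← h]
      simp only [← mul_assoc]
      rw [iota_mul_odd v _ (iota_mem_odd m₁), neg_mul, mul_assoc _ _ (ExteriorAlgebra.ι ℝ m₂),
        iota_mul_odd v _ (iota_mem_odd m₂), mul_neg, neg_neg, ← mul_assoc]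
  refine CliffordAlgebra.left_induction (0 : QuadraticForm ℝ (κ → ℝ))
    (P := fun b => a * b = b * a) ?_ ?_ ?_ b
  · intro r
    exact (Algebra.commutes r _).symm
  · intro x y h1 h2
    rw [mul_add, add_mul, h1, h2]
  · intro x v h
    change a * (ExteriorAlgebra.ι ℝ v * x) = ExteriorAlgebra.ι ℝ v * x * a
    rw [mul_assoc, ← h, ← mul_assoc, ← mul_assoc, key]

/-- An algebra homomorphism that maps generators to odd elements preserves even elements. -/
theorem map_mem_even (φ : Grassmann κ →ₐ[ℝ] Grassmann κ')
    (hφ : ∀ v, φ (ExteriorAlgebra.ι ℝ v) ∈ oddPart κ') {a : Grassmann κ} (ha : a ∈ evenPart κ) :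
    φ a ∈ evenPart κ' := by
  refine CliffordAlgebra.even_induction (0 : QuadraticForm ℝ (κ → ℝ))
    (motive := fun x _ => φ x ∈ evenPart κ') ?_ ?_ ?_ a ha
  · intro r
    have : φ (algebraMap ℝ _ r) = algebraMap ℝ _ r := φ.commutes r
    exact this ▸ algebraMap_mem_even r
  · intro x y _ _ h1 h2
    rw [map_add]
    exact Submodule.add_mem _ h1 h2
  · intro m₁ m₂ x _ h
    rw [map_mul, map_mul]
    exact even_mul_even (odd_mul_odd_mem (hφ m₁) (hφ m₂)) h

/-- An algebra homomorphism that maps generators to odd elements preserves odd elements. -/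
theorem map_mem_odd (φ : Grassmann κ →ₐ[ℝ] Grassmann κ')
    (hφ : ∀ v, φ (ExteriorAlgebra.ι ℝ v) ∈ oddPart κ') {a : Grassmann κ} (ha : a ∈ oddPart κ) :
    φ a ∈ oddPart κ' := by
  refine CliffordAlgebra.odd_induction (0 : QuadraticForm ℝ (κ → ℝ))
    (P := fun x _ => φ x ∈ oddPart κ') ?_ ?_ ?_ a ha
  · exact hφ
  · intro x y _ _ h1 h2
    rw [map_add]
    exact Submodule.add_mem _ h1 h2
  · intro m₁ m₂ x _ h
    rw [map_mul, map_mul]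
    exact even_mul_odd (odd_mul_odd_mem (hφ m₁) (hφ m₂)) h

theorem contractLeft_even_mem (d : Module.Dual ℝ (κ → ℝ)) {a : Grassmann κ}
    (ha : a ∈ evenPart κ) :
    CliffordAlgebra.contractLeft (Q := (0 : QuadraticForm ℝ (κ → ℝ))) d a ∈ oddPart κ := by
  refine CliffordAlgebra.even_induction (0 : QuadraticForm ℝ (κ → ℝ))
    (motive := fun x _ => CliffordAlgebra.contractLeft (Q := (0 : QuadraticForm ℝ (κ → ℝ))) d x
      ∈ oddPart κ) ?_ ?_ ?_ a ha
  · intro r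
    rw [CliffordAlgebra.contractLeft_algebraMap]
    exact Submodule.zero_mem _
  · intro x y _ _ h1 h2
    rw [map_add]
    exact Submodule.add_mem _ h1 h2
  · intro m₁ m₂ x hx h
    rw [mul_assoc, CliffordAlgebra.contractLeft_ι_mul, CliffordAlgebra.contractLeft_ι_mul, mul_sub,
      ← mul_assoc]
    refine Submodule.sub_mem _ (Submodule.smul_mem _ _ ?_) (Submodule.sub_mem _ ?_ ?_)
    · rw [← even_mul_comm hx]
      exact even_mul_odd hx (iota_mem_odd m₂)
    · rw [mul_smul_comm]
      refine Submodule.smul_mem _ _ ?_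
      rw [← even_mul_comm hx]
      exact even_mul_odd hx (iota_mem_odd m₁)
    · exact even_mul_odd (odd_mul_odd_mem (iota_mem_odd m₁) (iota_mem_odd m₂)) h

theorem gsoul_mem_range_mul_top (a : Grassmann κ) :
    gsoul a ∈ LinearMap.range (ExteriorAlgebra.ι ℝ : (κ → ℝ) →ₗ[ℝ] Grassmann κ) * ⊤ := by
  refine CliffordAlgebra.left_induction (0 : QuadraticForm ℝ (κ → ℝ)) (P := fun a => gsoul a ∈
    LinearMap.range (ExteriorAlgebra.ι ℝ : (κ → ℝ) →ₗ[ℝ] Grassmann κ) * ⊤) ?_ ?_ ?_ a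
  · intro r
    have : gsoul (algebraMap ℝ (Grassmann κ) r) = 0 := by rw [gsoul, gbody_algebraMap, sub_self]
    exact this ▸ Submodule.zero_mem _
  · intro x y h1 h2
    rw [gsoul_add]
    exact Submodule.add_mem _ h1 h2
  · intro x v _
    have : gsoul (ExteriorAlgebra.ι ℝ v * x) = ExteriorAlgebra.ι ℝ v * x := by
      rw [gsoul, gbody_mul, gbody_iota, zero_mul, map_zero, sub_zero]
    refine (congrArg (· ∈ _) this).mpr ?_
    exact Submodule.mul_mem_mul (LinearMap.mem_range_self _ v) Submodule.mem_top

theorem mem_range_mul_top {a : Grassmann κ} (ha : gbody a = 0) :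
    a ∈ LinearMap.range (ExteriorAlgebra.ι ℝ : (κ → ℝ) →ₗ[ℝ] Grassmann κ) * ⊤ := by
  have := gsoul_mem_range_mul_top a
  rwa [gsoul, ha, map_zero, sub_zero] at this

theorem top_mul_range_le : ⊤ * LinearMap.range (ExteriorAlgebra.ι ℝ : (κ → ℝ) →ₗ[ℝ] Grassmann κ) ≤
    LinearMap.range (ExteriorAlgebra.ι ℝ : (κ → ℝ) →ₗ[ℝ] Grassmann κ) * ⊤ := by
  rw [Submodule.mul_le]
  rintro x - _ ⟨v, rfl⟩
  exact mem_range_mul_top (by rw [gbody_mul, gbody_iota, mul_zero])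

/-- Each factor with zero body has the form generator times anything. All generators can be
collected on the left because `⊤ * R ≤ R * ⊤` for the space `R` of generators. -/
theorem prod_mem_range_pow (l : List (Grassmann κ)) (hl : ∀ a ∈ l, gbody a = 0) :
    l.prod ∈ LinearMap.range (ExteriorAlgebra.ι ℝ : (κ → ℝ) →ₗ[ℝ] Grassmann κ) ^ l.length * ⊤ := by
  induction l with
  | nil => simp
  | cons a l ih =>
    set R := LinearMap.range (ExteriorAlgebra.ι ℝ : (κ → ℝ) →ₗ[ℝ] Grassmann κ)
    have h1 := mem_range_mul_top (hl a (by simp))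
    have h2 := ih fun b hb => hl b (by simp [hb])
    have hpow : ∀ k : ℕ, ⊤ * R ^ k ≤ R ^ k * ⊤ := by
      intro k
      induction k with
      | zero => simp
      | succ k ihk =>
        calc ⊤ * R ^ (k + 1) = (⊤ * R ^ k) * R := by rw [pow_succ, mul_assoc]
          _ ≤ (R ^ k * ⊤) * R := mul_le_mul_left ihk _
          _ = R ^ k * (⊤ * R) := by rw [mul_assoc]
          _ ≤ R ^ k * (R * ⊤) := mul_le_mul_right top_mul_range_le _
          _ = R ^ (k + 1) * ⊤ := by rw [pow_succ, mul_assoc]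
    have hle : (R * ⊤) * (R ^ l.length * ⊤) ≤ R ^ (l.length + 1) * ⊤ := by
      calc (R * ⊤) * (R ^ l.length * ⊤) = R * (⊤ * R ^ l.length) * ⊤ := by simp only [mul_assoc]
        _ ≤ R * (R ^ l.length * ⊤) * ⊤ :=
          mul_le_mul_left (mul_le_mul_right (hpow _) _) _
        _ = R ^ (l.length + 1) * (⊤ * ⊤) := by rw [pow_succ']; simp only [mul_assoc]
        _ ≤ R ^ (l.length + 1) * ⊤ := mul_le_mul_right le_top _
    rw [List.prod_cons, List.length_cons]
    exact hle (Submodule.mul_mem_mul h1 h2)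

/-- In `Λ_N` a product of more than `N` elements with zero body vanishes. -/
theorem prod_eq_zero {N : ℕ} (l : List (Lam N)) (hl : ∀ a ∈ l, gbody a = 0)
    (hN : N < l.length) : l.prod = 0 := by
  have hbot : (⋀[ℝ]^l.length (Fin N → ℝ)) = ⊥ := by
    rw [← ExteriorAlgebra.ιMulti_span_fixedDegree, Submodule.span_eq_bot]
    rintro _ ⟨v, rfl⟩
    -- More than `N` vectors of `ℝ^N` are dependent, so the exterior power of this degree is zero.
    refine AlternatingMap.map_linearDependent _ v fun h => ?_
    have := h.fintype_card_le_finrank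
    simp only [Fintype.card_fin, Module.finrank_fintype_fun_eq_card] at this
    omega
  have h := prod_mem_range_pow l hl
  rw [show LinearMap.range (ExteriorAlgebra.ι ℝ : (Fin N → ℝ) →ₗ[ℝ] Lam N) ^ l.length = ⊥ from hbot,
    Submodule.bot_mul] at h
  exact h

end Algebra

/-! ### Adjoining an odd generator. -/

section Inclusion

/-- The inclusion of generators `ℝ^N → ℝ^{N+1}` that leaves out the generator with index `0`. -/
def genIncl (N : ℕ) : (Fin N → ℝ) →ₗ[ℝ] (Fin (N + 1) → ℝ) :=
  LinearMap.pi (Fin.cons 0 fun i => LinearMap.proj i)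

/-- The inclusion `Λ_N → Λ_{N+1}` that leaves out the generator with index `0`. -/
def lamIncl (N : ℕ) : Lam N →ₐ[ℝ] Lam (N + 1) := ExteriorAlgebra.map (genIncl N)

/-- The generator of `Λ_{N+1}` that is not in the image of `Λ_N`. -/
def newGen (N : ℕ) : Lam (N + 1) := ExteriorAlgebra.ι ℝ (Pi.single 0 1)

theorem newGen_mem_odd (N : ℕ) : newGen N ∈ oddPart (Fin (N + 1)) := iota_mem_odd _

theorem lamIncl_iota {N : ℕ} (v : Fin N → ℝ) :
    lamIncl N (ExteriorAlgebra.ι ℝ v) = ExteriorAlgebra.ι ℝ (genIncl N v) :=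
  ExteriorAlgebra.map_apply_ι _ v

theorem lamIncl_injective (N : ℕ) : Function.Injective (lamIncl N) := by
  refine ExteriorAlgebra.map_injective (f := genIncl N) ⟨LinearMap.funLeft ℝ ℝ Fin.succ, ?_⟩
  ext v i
  simp [genIncl, LinearMap.funLeft]

theorem lamIncl_mem_even {N : ℕ} {a : Lam N} (ha : a ∈ evenPart (Fin N)) :
    lamIncl N a ∈ evenPart (Fin (N + 1)) :=
  map_mem_even _ (fun v => by rw [lamIncl_iota]; exact iota_mem_odd _) ha

theorem lamIncl_mem_odd {N : ℕ} {a : Lam N} (ha : a ∈ oddPart (Fin N)) :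
    lamIncl N a ∈ oddPart (Fin (N + 1)) :=
  map_mem_odd _ (fun v => by rw [lamIncl_iota]; exact iota_mem_odd _) ha

theorem gbody_lamIncl {N : ℕ} (a : Lam N) : gbody (lamIncl N a) = gbody a := by
  have : ExteriorAlgebra.algebraMapInv.comp (lamIncl N) = ExteriorAlgebra.algebraMapInv := by
    ext v
    simp [lamIncl, ExteriorAlgebra.algebraMapInv]
  exact DFunLike.congr_fun this a

theorem gsoul_lamIncl {N : ℕ} (a : Lam N) : gsoul (lamIncl N a) = lamIncl N (gsoul a) := by
  rw [gsoul, gsoul, gbody_lamIncl, map_sub, AlgHom.commutes]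

/-- Contraction with the coordinate dual to the new generator annihilates the image of `Λ_N`, so it
undoes multiplication by `newGen` on that image. -/
theorem eq_zero_of_newGen_mul {N : ℕ} {a : Lam N} (h : newGen N * lamIncl N a = 0) : a = 0 := by
  set d : Module.Dual ℝ (Fin (N + 1) → ℝ) := LinearMap.proj 0
  have hd : ∀ b : Lam N, CliffordAlgebra.contractLeft
      (Q := (0 : QuadraticForm ℝ (Fin (N + 1) → ℝ))) d (lamIncl N b) = 0 := by
    intro b
    refine CliffordAlgebra.left_induction (0 : QuadraticForm ℝ (Fin N → ℝ))
      (P := fun b => CliffordAlgebra.contractLeft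
        (Q := (0 : QuadraticForm ℝ (Fin (N + 1) → ℝ))) d (lamIncl N b) = 0) ?_ ?_ ?_ b
    · intro r
      have : lamIncl N (algebraMap ℝ _ r) = algebraMap ℝ _ r := (lamIncl N).commutes r
      refine (congrArg _ this).trans (CliffordAlgebra.contractLeft_algebraMap _ _ _)
    · intro x y h1 h2
      rw [map_add, map_add, h1, h2, add_zero]
    · intro x v h
      have e : lamIncl N (CliffordAlgebra.ι 0 v * x) =
          CliffordAlgebra.ι (0 : QuadraticForm ℝ (Fin (N + 1) → ℝ)) (genIncl N v) * lamIncl N x := by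
        rw [map_mul]
        exact congrArg (· * _) (lamIncl_iota v)
      rw [e, CliffordAlgebra.contractLeft_ι_mul, h, mul_zero, sub_zero]
      have : d (genIncl N v) = 0 := by simp [d, genIncl]
      rw [this, zero_smul]
  have h1 : CliffordAlgebra.contractLeft (Q := (0 : QuadraticForm ℝ (Fin (N + 1) → ℝ))) d
      (CliffordAlgebra.ι 0 (Pi.single 0 1) * lamIncl N a) = 0 :=
    (congrArg _ h).trans (map_zero _)
  rw [CliffordAlgebra.contractLeft_ι_mul, hd, mul_zero, sub_zero] at h1
  have : d (Pi.single 0 1) = 1 := by simp [d]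
  rw [this, one_smul] at h1
  exact lamIncl_injective N (h1.trans (map_zero _).symm)

end Inclusion

/-! ### Taylor terms and their dependence on the point. -/

section Multiplication

/-- Multiplication of a Grassmann algebra as a continuous bilinear map. -/
def mulCLM (κ : Type) [Fintype κ] : Grassmann κ →L[ℝ] Grassmann κ →L[ℝ] Grassmann κ :=
  LinearMap.toContinuousBilinearMap (LinearMap.mul ℝ (Grassmann κ))

theorem mulCLM_apply {κ : Type} [Fintype κ] (a b : Grassmann κ) : mulCLM κ a b = a * b := rfl

theorem exists_hasStrictFDerivAt_mul {κ : Type} [Fintype κ] {E : Type*} [NormedAddCommGroup E]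
    [NormedSpace ℝ E] {f g : E → Grassmann κ} {f' g' : E →L[ℝ] Grassmann κ} {x : E}
    (hf : HasStrictFDerivAt f f' x) (hg : HasStrictFDerivAt g g' x) :
    ∃ L : E →L[ℝ] Grassmann κ, HasStrictFDerivAt (fun y => f y * g y) L x ∧
      ∀ v, L v = f x * g' v + f' v * g x :=
  ⟨_, (mulCLM κ).hasStrictFDerivAt_of_bilinear hf hg, fun _ => rfl⟩

end Multiplication

section Taylor

variable {N : ℕ} {ι κ : Type}

/-- The vector space of `Λ_N`-points of the superspace with even coordinates indexed by `ι` and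
odd coordinates indexed by `κ`. -/
abbrev PointSpace (N : ℕ) (ι κ : Type) : Type := (ι → evenPart (Fin N)) × (κ → oddPart (Fin N))

/-- The `Λ_N`-point with given vector of coordinates. -/
def toPoint (v : PointSpace N ι κ) : SuperPoint N ι κ := ⟨v.1, v.2⟩

theorem substOdd_iota [Fintype κ] (θ : κ → oddPart (Fin N)) (v : κ → ℝ) :
    substOdd θ (ExteriorAlgebra.ι ℝ v) = ∑ α, v α • (θ α : Lam N) := by
  simp [substOdd]

theorem substOdd_iota_mem_odd [Fintype κ] (θ : κ → oddPart (Fin N)) (v : κ → ℝ) :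
    substOdd θ (ExteriorAlgebra.ι ℝ v) ∈ oddPart (Fin N) := by
  rw [substOdd_iota]
  exact Submodule.sum_mem _ fun α _ => Submodule.smul_mem _ _ (θ α).2

variable [Fintype ι] [Fintype κ]

/-- The underlying real point, as a continuous linear map. -/
def bodyCLM (N : ℕ) (ι κ : Type) [Fintype ι] [Fintype κ] : PointSpace N ι κ →L[ℝ] (ι → ℝ) :=
  LinearMap.toContinuousLinearMap
    { toFun := fun v i => gbody (v.1 i : Lam N)
      map_add' := fun v w => by ext i; exact gbody_add _ _
      map_smul' := fun r v => by ext i; exact gbody_smul _ _ }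

theorem bodyCLM_apply (v : PointSpace N ι κ) : bodyCLM N ι κ v = (toPoint v).body := rfl

variable [DecidableEq ι]

/-- The term of degree `k` in the Taylor expansion of a superfunction, without the factor
`1 / k!`. -/
def taylorTerm (k : ℕ) (f : SuperFun ι κ) (z : SuperPoint N ι κ) : Lam N :=
  ∑ i : Fin k → ι, (List.ofFn fun j => gsoul (z.ev (i j) : Lam N)).prod *
    substOdd z.od (iteratedFDeriv ℝ k f z.body fun j => Pi.single (i j) 1)

theorem eval_eq_sum_taylorTerm (f : SuperFun ι κ) (z : SuperPoint N ι κ) :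
    eval f z = ∑ k ∈ Finset.range (N + 1), (1 / (k.factorial : ℝ)) • taylorTerm k f z := rfl

theorem taylorTerm_congr {k : ℕ} {f g : SuperFun ι κ} {z : SuperPoint N ι κ}
    (h : f =ᶠ[𝓝 z.body] g) : taylorTerm k f z = taylorTerm k g z := by
  simp only [taylorTerm, (h.iteratedFDeriv ℝ k).eq_of_nhds]

theorem eval_congr {f g : SuperFun ι κ} {z : SuperPoint N ι κ} (h : f =ᶠ[𝓝 z.body] g) :
    eval f z = eval g z := by
  simp only [eval_eq_sum_taylorTerm, taylorTerm_congr h]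

theorem eval_congr_of_eqOn {f g : SuperFun ι κ} {z : SuperPoint N ι κ} {U : Set (ι → ℝ)}
    (hU : IsOpen U) (hz : z.body ∈ U) (h : Set.EqOn f g U) : eval f z = eval g z :=
  eval_congr (Filter.eventuallyEq_of_mem (hU.mem_nhds hz) h)

theorem taylorTerm_zero (f : SuperFun ι κ) (z : SuperPoint N ι κ) :
    taylorTerm 0 f z = substOdd z.od (f z.body) := by
  simp [taylorTerm]

/-- Splitting off the last of the `k + 1` directions turns a Taylor term into lower terms of first
derivatives. This recursion drives every induction on the Taylor degree; the split soul can be moved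
to the front because it is even. -/
theorem taylorTerm_succ {k : ℕ} {f : SuperFun ι κ} {z : SuperPoint N ι κ}
    (hf : ContDiffAt ℝ ∞ f z.body) :
    taylorTerm (k + 1) f z = ∑ i, gsoul (z.ev i : Lam N) * taylorTerm k (dEven f i) z := by
  have hd : ContDiffAt ℝ ∞ (fderiv ℝ f) z.body := hf.fderiv_right (by simp)
  have key : ∀ (i : ι) (m : Fin k → ι → ℝ),
      iteratedFDeriv ℝ (k + 1) f z.body (Fin.snoc (α := fun _ => ι → ℝ) m (Pi.single i 1)) =
      iteratedFDeriv ℝ k (dEven f i) z.body m := by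
    intro i m
    rw [iteratedFDeriv_succ_apply_right, Fin.init_snoc, Fin.snoc_last]
    have := (ContinuousLinearMap.apply ℝ (Grassmann κ) (Pi.single i (1 : ℝ) : ι → ℝ)).iteratedFDeriv_comp_left
      hd (i := k) (by exact_mod_cast le_top)
    exact (DFunLike.congr_fun this m).symm
  rw [taylorTerm, ← (Fin.snocEquiv fun _ : Fin (k + 1) => ι).sum_comp, Fintype.sum_prod_type]
  refine Finset.sum_congr rfl fun i _ => ?_
  rw [taylorTerm, Finset.mul_sum]
  refine Finset.sum_congr rfl fun m _ => ?_
  have e1 : (fun j => Pi.single ((Fin.snocEquiv fun _ : Fin (k + 1) => ι) (i, m) j) (1 : ℝ)) =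
      Fin.snoc (α := fun _ => ι → ℝ) (fun j => Pi.single (m j) 1) (Pi.single i 1) := by
    ext j
    refine Fin.lastCases ?_ (fun j => ?_) j <;> simp [Fin.snocEquiv]
  rw [e1, key, List.ofFn_succ', List.concat_eq_append, List.prod_append]
  simp only [Fin.snocEquiv, Equiv.coe_fn_mk, Fin.snoc_castSucc, Fin.snoc_last, List.prod_singleton]
  rw [← even_mul_comm (gsoul_mem_even (z.ev i).2), mul_assoc]

/-- The product contains `N + 1` souls. This makes truncation of the Taylor sum after degree `N`
compatible with the chain rule. -/
theorem gsoul_mul_taylorTerm (a : Lam N) (f : SuperFun ι κ) (z : SuperPoint N ι κ) :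
    gsoul a * taylorTerm N f z = 0 := by
  rw [taylorTerm, Finset.mul_sum]
  refine Finset.sum_eq_zero fun i _ => ?_
  have := prod_eq_zero (gsoul a :: List.ofFn fun j => gsoul (z.ev (i j) : Lam N))
    (by
      intro b hb
      rcases List.mem_cons.mp hb with rfl | hb
      · exact gbody_gsoul a
      · obtain ⟨j, rfl⟩ := List.mem_ofFn' _ _ |>.mp hb
        exact gbody_gsoul _) (by simp)
  rw [← mul_assoc, ← List.prod_cons, this, zero_mul]

/-- Induction on products of generators. In the product rule the increment `w α` has to be moved to
the left past an odd factor, and the resulting sign is the one in the antiderivation rule for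
`contractLeft`. -/
theorem exists_hasStrictFDerivAt_substOdd [DecidableEq κ] (θ : κ → oddPart (Fin N))
    (a : Grassmann κ) :
    ∃ L : (κ → oddPart (Fin N)) →L[ℝ] Lam N, HasStrictFDerivAt (fun u => substOdd u a) L θ ∧
      ∀ w, L w = ∑ α, (w α : Lam N) * substOdd θ (CliffordAlgebra.contractLeft
        (Q := (0 : QuadraticForm ℝ (κ → ℝ))) (LinearMap.proj α : (κ → ℝ) →ₗ[ℝ] ℝ) a) := by
  refine CliffordAlgebra.left_induction (0 : QuadraticForm ℝ (κ → ℝ))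
    (P := fun a => ∃ L : (κ → oddPart (Fin N)) →L[ℝ] Lam N,
      HasStrictFDerivAt (fun u => substOdd u a) L θ ∧
      ∀ w, L w = ∑ α, (w α : Lam N) * substOdd θ (CliffordAlgebra.contractLeft
        (Q := (0 : QuadraticForm ℝ (κ → ℝ))) (LinearMap.proj α : (κ → ℝ) →ₗ[ℝ] ℝ) a)) ?_ ?_ ?_ a
  · intro r
    refine ⟨0, ?_, ?_⟩
    · have : (fun u : κ → oddPart (Fin N) => substOdd u (algebraMap ℝ _ r)) =
          fun _ => algebraMap ℝ (Lam N) r := funext fun u => (substOdd u).commutes r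
      exact this ▸ hasStrictFDerivAt_const _ _
    · intro w
      simp only [CliffordAlgebra.contractLeft_algebraMap, map_zero, mul_zero,
        Finset.sum_const_zero, zero_apply]
  · rintro x y ⟨L, hL, hL'⟩ ⟨M, hM, hM'⟩
    refine ⟨L + M, ?_, fun w => ?_⟩
    · exact (hL.add hM).congr_of_eventuallyEq (.of_forall fun u => (map_add _ _ _).symm)
    · simp only [add_apply, hL', hM', map_add, mul_add, Finset.sum_add_distrib]
  · rintro x v ⟨L, hL, hL'⟩
    let I : (κ → oddPart (Fin N)) →L[ℝ] Lam N := LinearMap.toContinuousLinearMap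
      (∑ α, v α • ((oddPart (Fin N)).subtype ∘ₗ LinearMap.proj α))
    have hI : ∀ u, I u = substOdd u (ExteriorAlgebra.ι ℝ v) := fun u => by
      rw [substOdd_iota]
      simp [I]
    obtain ⟨M, hM, hM'⟩ := exists_hasStrictFDerivAt_mul (I.hasStrictFDerivAt (x := θ)) hL
    refine ⟨M, ?_, fun w => ?_⟩
    · have : (fun u : κ → oddPart (Fin N) => substOdd u (CliffordAlgebra.ι 0 v * x)) =
          fun u => I u * substOdd u x := funext fun u => by
        rw [hI]
        exact map_mul (substOdd u) _ _
      exact this ▸ hM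
    · rw [hM', hL', hI, hI, substOdd_iota w, Finset.mul_sum, Finset.sum_mul, ← Finset.sum_add_distrib]
      refine Finset.sum_congr rfl fun α _ => ?_
      rw [CliffordAlgebra.contractLeft_ι_mul, map_sub, mul_sub, map_smul]
      have e : substOdd θ (CliffordAlgebra.ι 0 v * CliffordAlgebra.contractLeft
          (LinearMap.proj α : (κ → ℝ) →ₗ[ℝ] ℝ) x) = substOdd θ (ExteriorAlgebra.ι ℝ v) *
          substOdd θ (CliffordAlgebra.contractLeft (LinearMap.proj α : (κ → ℝ) →ₗ[ℝ] ℝ) x) :=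
        map_mul (substOdd θ) _ _
      rw [e, ← mul_assoc, ← mul_assoc, odd_mul_odd _ _ (w α).2 (substOdd_iota_mem_odd θ v),
        neg_mul, sub_neg_eq_add, LinearMap.proj_apply, mul_smul_comm,
        smul_mul_assoc, add_comm]

end Taylor

/-! ### Chain rule for smooth families of superfunctions. -/

section Families

variable {ι κ : Type} [Fintype ι] [DecidableEq ι] [Fintype κ] [DecidableEq κ]

/-- A one-parameter family of superfunctions is smooth on a set. -/
def SmoothFam (D : Set (ℝ × (ι → ℝ))) (f : ℝ → SuperFun ι κ) : Prop :=
  ContDiffOn ℝ ∞ (fun w : ℝ × (ι → ℝ) => f w.1 w.2) D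

/-- The derivative of a family of superfunctions in the parameter. -/
def dTime (f : ℝ → SuperFun ι κ) : ℝ → SuperFun ι κ :=
  fun t b => fderiv ℝ (fun w : ℝ × (ι → ℝ) => f w.1 w.2) (t, b) (1, 0)

/-- The left partial derivative in an odd coordinate as a continuous linear map. -/
def contractCLM (α : κ) : Grassmann κ →L[ℝ] Grassmann κ :=
  LinearMap.toContinuousLinearMap (CliffordAlgebra.contractLeft
    (Q := (0 : QuadraticForm ℝ (κ → ℝ))) (LinearMap.proj α : (κ → ℝ) →ₗ[ℝ] ℝ))

theorem dOdd_apply (f : SuperFun ι κ) (α : κ) (b : ι → ℝ) : dOdd f α b = contractCLM α (f b) := rfl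

variable {D : Set (ℝ × (ι → ℝ))} {f : ℝ → SuperFun ι κ}

theorem SmoothFam.contDiffAt (hf : SmoothFam D f) (hD : IsOpen D) {w : ℝ × (ι → ℝ)}
    (hw : w ∈ D) : ContDiffAt ℝ ∞ (fun w : ℝ × (ι → ℝ) => f w.1 w.2) w :=
  ContDiffOn.contDiffAt hf (hD.mem_nhds hw)

theorem SmoothFam.contDiffAt_slice (hf : SmoothFam D f) (hD : IsOpen D) {t : ℝ} {b : ι → ℝ}
    (hw : (t, b) ∈ D) : ContDiffAt ℝ ∞ (f t) b :=
  ContDiffAt.comp (g := fun w : ℝ × (ι → ℝ) => f w.1 w.2) (f := fun b => (t, b)) b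
    (hf.contDiffAt hD hw) (contDiffAt_const.prodMk contDiffAt_id)

/-- A partial derivative at fixed time is a directional derivative of the joint function of time and
position. Smoothness and commutation of partial derivatives are thereby reduced to one function on
`D`. -/
theorem SmoothFam.dEven_eq (hf : SmoothFam D f) (hD : IsOpen D) (i : ι) {t : ℝ} {b : ι → ℝ}
    (hw : (t, b) ∈ D) : dEven (f t) i b =
      fderiv ℝ (fun w : ℝ × (ι → ℝ) => f w.1 w.2) (t, b) (0, Pi.single i 1) := by
  have h1 : HasFDerivAt (fun w : ℝ × (ι → ℝ) => f w.1 w.2) _ (t, b) :=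
    ((hf.contDiffAt hD hw).differentiableAt (by simp)).hasFDerivAt
  have h2 := h1.comp b (f := fun b => (t, b)) ((hasFDerivAt_const t b).prodMk (hasFDerivAt_id b))
  have h3 : fderiv ℝ (f t) b = _ := h2.fderiv
  rw [dEven, h3]
  rfl

theorem SmoothFam.fderiv_apply (hf : SmoothFam D f) (hD : IsOpen D) (u : ℝ × (ι → ℝ)) :
    ContDiffOn ℝ ∞ (fun w => fderiv ℝ (fun w : ℝ × (ι → ℝ) => f w.1 w.2) w u) D :=
  (ContDiffOn.fderiv_of_isOpen hf hD (by simp)).clm_apply contDiffOn_const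

theorem SmoothFam.dTime (hf : SmoothFam D f) (hD : IsOpen D) : SmoothFam D (dTime f) :=
  hf.fderiv_apply hD _

theorem SmoothFam.dEven (hf : SmoothFam D f) (hD : IsOpen D) (i : ι) :
    SmoothFam D (fun t => dEven (f t) i) :=
  (hf.fderiv_apply hD (0, Pi.single i 1)).congr fun _ hw => hf.dEven_eq hD i hw

theorem SmoothFam.dOdd (hf : SmoothFam D f) (α : κ) :
    SmoothFam D (fun t => dOdd (f t) α) :=
  (contractCLM α).contDiff.comp_contDiffOn hf

theorem SmoothFam.fderiv_comm (hf : SmoothFam D f) (hD : IsOpen D) {w : ℝ × (ι → ℝ)} (hw : w ∈ D)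
    (u v : ℝ × (ι → ℝ)) :
    fderiv ℝ (fun w => fderiv ℝ (fun w : ℝ × (ι → ℝ) => f w.1 w.2) w u) w v =
      fderiv ℝ (fun w => fderiv ℝ (fun w : ℝ × (ι → ℝ) => f w.1 w.2) w v) w u := by
  have hc := hf.contDiffAt hD hw
  have hs := hc.isSymmSndFDerivAt (by
    rw [minSmoothness_of_isRCLikeNormedField]
    exact WithTop.coe_le_coe.2 (le_top (a := (2 : ℕ∞))))
  have hd : DifferentiableAt ℝ (fderiv ℝ fun w : ℝ × (ι → ℝ) => f w.1 w.2) w :=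
    (hc.fderiv_right (m := ∞) (by simp)).differentiableAt (by simp)
  have key : ∀ u v, fderiv ℝ (fun w => fderiv ℝ (fun w : ℝ × (ι → ℝ) => f w.1 w.2) w u) w v =
      fderiv ℝ (fderiv ℝ fun w : ℝ × (ι → ℝ) => f w.1 w.2) w v u := by
    intro u v
    rw [fderiv_clm_apply hd (differentiableAt_const u)]
    simp
  rw [key, key]
  exact hs.eq v u

theorem fderiv_congr_of_eqOn {E F : Type*} [NormedAddCommGroup E] [NormedSpace ℝ E]
    [NormedAddCommGroup F] [NormedSpace ℝ F] {g h : E → F} {U : Set E} (hU : IsOpen U) {w : E}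
    (hw : w ∈ U) (hgh : Set.EqOn g h U) : fderiv ℝ g w = fderiv ℝ h w :=
  Filter.EventuallyEq.fderiv_eq (Filter.eventuallyEq_of_mem (hU.mem_nhds hw) hgh)

theorem SmoothFam.dEven_dTime (hf : SmoothFam D f) (hD : IsOpen D) (i : ι) {t : ℝ} {b : ι → ℝ}
    (hw : (t, b) ∈ D) :
    ThickMorphism.dTime (fun t => ThickMorphism.dEven (f t) i) t b =
      ThickMorphism.dEven (ThickMorphism.dTime f t) i b := by
  rw [(hf.dTime hD).dEven_eq hD i hw, ThickMorphism.dTime,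
    fderiv_congr_of_eqOn hD hw fun w hw => hf.dEven_eq hD i hw]
  exact hf.fderiv_comm hD hw _ _

theorem SmoothFam.dEven_dEven (hf : SmoothFam D f) (hD : IsOpen D) (i j : ι) {t : ℝ} {b : ι → ℝ}
    (hw : (t, b) ∈ D) :
    ThickMorphism.dEven (ThickMorphism.dEven (f t) i) j b =
      ThickMorphism.dEven (ThickMorphism.dEven (f t) j) i b := by
  rw [(hf.dEven hD i).dEven_eq hD j hw, (hf.dEven hD j).dEven_eq hD i hw,
    fderiv_congr_of_eqOn hD hw fun w hw => hf.dEven_eq hD i hw,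
    fderiv_congr_of_eqOn hD hw fun w hw => hf.dEven_eq hD j hw]
  exact hf.fderiv_comm hD hw _ _

theorem SmoothFam.dEven_dOdd (hf : SmoothFam D f) (hD : IsOpen D) (i : ι) (α : κ) {t : ℝ}
    {b : ι → ℝ} (hw : (t, b) ∈ D) :
    ThickMorphism.dOdd (ThickMorphism.dEven (f t) i) α b =
      ThickMorphism.dEven (ThickMorphism.dOdd (f t) α) i b := by
  have h : HasFDerivAt (ThickMorphism.dOdd (f t) α) ((contractCLM α).comp (fderiv ℝ (f t) b)) b :=
    (contractCLM α).hasFDerivAt.comp b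
      ((hf.contDiffAt_slice hD hw).differentiableAt (by simp)).hasFDerivAt
  rw [ThickMorphism.dEven, h.fderiv]
  rfl

variable {N : ℕ}

theorem isOpen_sliceSet (hD : IsOpen D) (t : ℝ) : IsOpen {b | (t, b) ∈ D} :=
  hD.preimage (Continuous.prodMk_right t)

theorem taylorTerm_congr_of_eqOn {k : ℕ} {g h : SuperFun ι κ} {z : SuperPoint N ι κ}
    {U : Set (ι → ℝ)} (hU : IsOpen U) (hz : z.body ∈ U) (H : Set.EqOn g h U) :
    taylorTerm k g z = taylorTerm k h z :=
  taylorTerm_congr (Filter.eventuallyEq_of_mem (hU.mem_nhds hz) H)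

/-- Expansion in a basis `e` of the Grassmann algebra separates the variables: real coefficients
depend on time and body, while the substituted basis elements depend on the odd coordinates only. -/
theorem exists_hasStrictFDerivAt_taylorTerm_zero (hf : SmoothFam D f) (hD : IsOpen D) {t : ℝ}
    {z : PointSpace N ι κ} (hz : (t, (toPoint z).body) ∈ D) :
    ∃ L : ℝ × PointSpace N ι κ →L[ℝ] Lam N,
      HasStrictFDerivAt (fun w : ℝ × PointSpace N ι κ => taylorTerm 0 (f w.1) (toPoint w.2))
        L (t, z) ∧
      ∀ dt dz, L (dt, dz) = dt • taylorTerm 0 (dTime f t) (toPoint z) +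
        (∑ i, gbody (dz.1 i : Lam N) • taylorTerm 0 (dEven (f t) i) (toPoint z)) +
        ∑ α, (dz.2 α : Lam N) * taylorTerm 0 (dOdd (f t) α) (toPoint z) := by
  set e := Module.finBasis ℝ (Grassmann κ)
  have h1 := (hf.contDiffAt hD hz).hasStrictFDerivAt (by simp)
  let A : ℝ × PointSpace N ι κ →L[ℝ] ℝ × (ι → ℝ) :=
    (ContinuousLinearMap.id ℝ ℝ).prodMap (bodyCLM N ι κ)
  have h2 := h1.comp (t, z) (f := fun w => A w) A.hasStrictFDerivAt
  choose M hM hM' using fun I => exists_hasStrictFDerivAt_substOdd z.2 (e I)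
  have h3 : ∀ I, HasStrictFDerivAt (fun w : ℝ × PointSpace N ι κ => substOdd w.2.2 (e I))
      ((M I).comp ((ContinuousLinearMap.snd ℝ _ _).comp (ContinuousLinearMap.snd ℝ _ _))) (t, z) :=
    fun I => (hM I).comp (t, z) ((ContinuousLinearMap.snd ℝ _ _).comp
      (ContinuousLinearMap.snd ℝ _ _)).hasStrictFDerivAt
  let c : ∀ I, Grassmann κ →L[ℝ] ℝ := fun I => LinearMap.toContinuousLinearMap (e.coord I)
  have h4 := fun I => ((c I).hasStrictFDerivAt.comp (t, z) h2).smul (h3 I)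
  refine ⟨_, (HasStrictFDerivAt.fun_sum (u := Finset.univ) fun I _ => h4 I).congr_of_eventuallyEq
    (.of_forall fun w => ?_), ?_⟩
  · beta_reduce
    rw [taylorTerm_zero]
    have := e.sum_repr (f w.1 (toPoint w.2).body)
    conv_rhs => rw [← this, map_sum]
    refine Finset.sum_congr rfl fun I _ => ?_
    rw [map_smul]
    rfl
  · intro dt dz
    have hlin : fderiv ℝ (fun w : ℝ × (ι → ℝ) => f w.1 w.2) (t, (toPoint z).body)
        (dt, (toPoint dz).body) = dt • dTime f t (toPoint z).body +
          ∑ i, gbody (dz.1 i : Lam N) • dEven (f t) i (toPoint z).body := by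
      have e1 : (dt, (toPoint dz).body) = dt • ((1, 0) : ℝ × (ι → ℝ)) +
          ∑ i, gbody (dz.1 i : Lam N) • ((0, Pi.single i 1) : ℝ × (ι → ℝ)) := by
        ext j
        · simp [Prod.fst_sum]
        · simp [toPoint, SuperPoint.body, Prod.snd_sum, Finset.sum_apply, Pi.single_apply]
      rw [e1, map_add, map_sum, map_smul]
      congr 1
      refine Finset.sum_congr rfl fun i _ => ?_
      rw [map_smul, hf.dEven_eq hD i hz]
    have hsub : ∀ a : Grassmann κ, ∑ I, c I a • substOdd z.2 (e I) = substOdd z.2 a := by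
      intro a
      conv_rhs => rw [← e.sum_repr a, map_sum]
      exact Finset.sum_congr rfl fun I _ => (map_smul _ _ _).symm
    have hodd : ∑ I, c I (f t (toPoint z).body) • M I dz.2 =
        ∑ α, (dz.2 α : Lam N) * substOdd z.2 (dOdd (f t) α (toPoint z).body) := by
      simp only [hM', Finset.smul_sum]
      rw [Finset.sum_comm]
      refine Finset.sum_congr rfl fun α _ => ?_
      simp only [← mul_smul_comm, ← Finset.mul_sum]
      congr 1
      rw [dOdd_apply]
      conv_rhs => rw [← e.sum_repr (f t (toPoint z).body), map_sum, map_sum]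
      refine Finset.sum_congr rfl fun I _ => ?_
      rw [map_smul, map_smul]
      rfl
    simp only [taylorTerm_zero]
    have e2 : substOdd z.2 (fderiv ℝ (fun w : ℝ × (ι → ℝ) => f w.1 w.2) (t, (toPoint z).body)
        (dt, (toPoint dz).body)) = dt • substOdd z.2 (dTime f t (toPoint z).body) +
          ∑ i, gbody (dz.1 i : Lam N) • substOdd z.2 (dEven (f t) i (toPoint z).body) := by
      rw [hlin, map_add, map_smul, map_sum]
      simp only [map_smul]
    have e3 := congrArg₂ (· + ·) e2 hodd
    refine Eq.trans ?_ e3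
    simp only [← hsub (fderiv ℝ _ _ _)]
    rw [← Finset.sum_add_distrib, _root_.sum_apply]
    refine Finset.sum_congr rfl fun I _ => ?_
    rw [add_comm]
    rfl

/-- Induction through `taylorTerm_succ` and the product rule. Even increments are split into body
and soul: the body moves the expansion point, while the soul replaces one of the `k` soul factors.
For `k = 0` the truncated index `k - 1` is harmless because of the factor `k`. -/
theorem exists_hasStrictFDerivAt_taylorTerm (hD : IsOpen D) {t : ℝ}
    {z : PointSpace N ι κ} (hz : (t, (toPoint z).body) ∈ D) (k : ℕ) :
    ∀ f : ℝ → SuperFun ι κ, SmoothFam D f → ∃ L : ℝ × PointSpace N ι κ →L[ℝ] Lam N,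
      HasStrictFDerivAt (fun w : ℝ × PointSpace N ι κ => taylorTerm k (f w.1) (toPoint w.2))
        L (t, z) ∧
      ∀ dt dz, L (dt, dz) = dt • taylorTerm k (dTime f t) (toPoint z) +
        (∑ i, (gbody (dz.1 i : Lam N) • taylorTerm k (dEven (f t) i) (toPoint z) +
          (k : ℝ) • (gsoul (dz.1 i : Lam N) * taylorTerm (k - 1) (dEven (f t) i) (toPoint z)))) +
        ∑ α, (dz.2 α : Lam N) * taylorTerm k (dOdd (f t) α) (toPoint z) := by
  induction k with
  | zero =>
    intro f hf
    obtain ⟨L, hL, hL'⟩ := exists_hasStrictFDerivAt_taylorTerm_zero hf hD hz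
    exact ⟨L, hL, by simpa using hL'⟩
  | succ k ih =>
    intro f hf
    choose M hM hM' using fun i => ih _ (hf.dEven hD i)
    have hU := isOpen_sliceSet hD t
    have hz' : (toPoint z).body ∈ {b | (t, b) ∈ D} := hz
    have hsucc : ∀ {k : ℕ} {g : ℝ → SuperFun ι κ}, SmoothFam D g →
        taylorTerm (k + 1) (g t) (toPoint z) =
          ∑ i, gsoul (z.1 i : Lam N) * taylorTerm k (dEven (g t) i) (toPoint z) :=
      fun hg => taylorTerm_succ (hg.contDiffAt_slice hD hz)
    let s : ι → ℝ × PointSpace N ι κ →L[ℝ] Lam N := fun i => LinearMap.toContinuousLinearMap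
      { toFun := fun w => gsoul (w.2.1 i : Lam N)
        map_add' := fun v w => gsoul_add _ _
        map_smul' := fun r v => gsoul_smul _ _ }
    choose P hP hP' using fun i =>
      exists_hasStrictFDerivAt_mul ((s i).hasStrictFDerivAt (x := (t, z))) (hM i)
    refine ⟨∑ i, P i, (HasStrictFDerivAt.fun_sum (u := Finset.univ)
      fun i _ => hP i).congr_of_eventuallyEq ?_, ?_⟩
    · have hopen : IsOpen {w : ℝ × PointSpace N ι κ | (w.1, (toPoint w.2).body) ∈ D} :=
        hD.preimage (continuous_fst.prodMk ((bodyCLM N ι κ).continuous.comp continuous_snd))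
      filter_upwards [hopen.mem_nhds hz] with w hw
      exact (taylorTerm_succ (hf.contDiffAt_slice hD hw)).symm
    · intro dt dz
      have hs : ∀ i, s i (dt, dz) = gsoul (dz.1 i : Lam N) := fun i => rfl
      have hs' : ∀ i, s i (t, z) = gsoul (z.1 i : Lam N) := fun i => rfl
      have hT : taylorTerm (k + 1) (dTime f t) (toPoint z) = ∑ i, gsoul (z.1 i : Lam N) *
          taylorTerm k (dTime (fun t => dEven (f t) i) t) (toPoint z) := by
        rw [hsucc (hf.dTime hD)]
        refine Finset.sum_congr rfl fun i _ => congrArg _ ?_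
        exact taylorTerm_congr_of_eqOn hU hz' fun b hb => (hf.dEven_dTime hD i hb).symm
      have hE : ∀ (k : ℕ) (j : ι), taylorTerm (k + 1) (dEven (f t) j) (toPoint z) =
          ∑ i, gsoul (z.1 i : Lam N) * taylorTerm k (dEven (dEven (f t) i) j) (toPoint z) := by
        intro k j
        rw [hsucc (hf.dEven hD j)]
        refine Finset.sum_congr rfl fun i _ => congrArg _ ?_
        exact taylorTerm_congr_of_eqOn hU hz' fun b hb => hf.dEven_dEven hD j i hb
      have hO : ∀ α : κ, taylorTerm (k + 1) (dOdd (f t) α) (toPoint z) =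
          ∑ i, gsoul (z.1 i : Lam N) * taylorTerm k (dOdd (dEven (f t) i) α) (toPoint z) := by
        intro α
        rw [hsucc (hf.dOdd α)]
        refine Finset.sum_congr rfl fun i _ => congrArg _ ?_
        exact taylorTerm_congr_of_eqOn hU hz' fun b hb => (hf.dEven_dOdd hD i α hb).symm
      have hsc : ∀ (i : ι) (a b : Lam N), gsoul (z.1 i : Lam N) * (a * b) =
          a * (gsoul (z.1 i : Lam N) * b) := by
        intro i a b
        rw [← mul_assoc, even_mul_comm (gsoul_mem_even (z.1 i).2), mul_assoc]
      -- The soul terms of the induction hypothesis recombine into `k` copies of one term of degree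
      -- `k`; the product rule supplies one more, which makes `k + 1`.
      have hK : ∀ j : ι, ((k : ℝ) • ∑ i, gsoul (z.1 i : Lam N) *
          taylorTerm (k - 1) (dEven (dEven (f t) i) j) (toPoint z)) =
          (k : ℝ) • taylorTerm k (dEven (f t) j) (toPoint z) := by
        intro j
        cases k with
        | zero => simp
        | succ k => rw [Nat.add_sub_cancel, hE]
      rw [_root_.sum_apply]
      have h1 : ∑ i, gsoul (z.1 i : Lam N) * (dt • taylorTerm k (dTime (fun t => dEven (f t) i) t)
          (toPoint z)) = dt • taylorTerm (k + 1) (dTime f t) (toPoint z) := by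
        rw [hT, Finset.smul_sum]
        simp only [mul_smul_comm]
      have h2 : ∑ i, gsoul (z.1 i : Lam N) * ∑ j, gbody (dz.1 j : Lam N) •
          taylorTerm k (dEven (dEven (f t) i) j) (toPoint z) =
          ∑ j, gbody (dz.1 j : Lam N) • taylorTerm (k + 1) (dEven (f t) j) (toPoint z) := by
        simp only [hE, Finset.mul_sum, Finset.smul_sum, mul_smul_comm]
        exact Finset.sum_comm
      have h3 : ∑ i, gsoul (z.1 i : Lam N) * ∑ j, (k : ℝ) • (gsoul (dz.1 j : Lam N) *
          taylorTerm (k - 1) (dEven (dEven (f t) i) j) (toPoint z)) =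
          ∑ j, (k : ℝ) • (gsoul (dz.1 j : Lam N) * taylorTerm k (dEven (f t) j) (toPoint z)) := by
        simp only [← mul_smul_comm (k : ℝ) (gsoul (dz.1 _ : Lam N)), ← hK, Finset.smul_sum,
          Finset.mul_sum, hsc]
        rw [Finset.sum_comm]
        simp only [mul_smul_comm]
      have h4 : ∑ i, gsoul (z.1 i : Lam N) * ∑ α, (dz.2 α : Lam N) *
          taylorTerm k (dOdd (dEven (f t) i) α) (toPoint z) =
          ∑ α, (dz.2 α : Lam N) * taylorTerm (k + 1) (dOdd (f t) α) (toPoint z) := by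
        simp only [hO, Finset.mul_sum, hsc]
        exact Finset.sum_comm
      simp only [hP', hM', hs, hs', mul_add, Finset.sum_add_distrib, h1, h2, h3, h4,
        Nat.add_sub_cancel, Nat.cast_add, Nat.cast_one, add_smul, one_smul]
      abel

/-- The chain rule: the value of a smooth family of superfunctions at a `Λ_N`-point is strictly
differentiable in the parameter and the point, and its derivative is given by the left partial
derivatives. -/
theorem exists_hasStrictFDerivAt_eval (hf : SmoothFam D f) (hD : IsOpen D) {t : ℝ}
    {z : PointSpace N ι κ} (hz : (t, (toPoint z).body) ∈ D) :
    ∃ L : ℝ × PointSpace N ι κ →L[ℝ] Lam N,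
      HasStrictFDerivAt (fun w : ℝ × PointSpace N ι κ => eval (f w.1) (toPoint w.2)) L (t, z) ∧
      ∀ dt dz, L (dt, dz) = dt • eval (dTime f t) (toPoint z) +
        (∑ i, (dz.1 i : Lam N) * eval (dEven (f t) i) (toPoint z)) +
        ∑ α, (dz.2 α : Lam N) * eval (dOdd (f t) α) (toPoint z) := by
  choose L hL hL' using fun k => exists_hasStrictFDerivAt_taylorTerm hD hz k f hf
  refine ⟨∑ k ∈ Finset.range (N + 1), (1 / (k.factorial : ℝ)) • L k,
    HasStrictFDerivAt.fun_sum fun k _ => (hL k).fun_const_smul _, fun dt dz => ?_⟩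
  have heven : ∀ i, (dz.1 i : Lam N) * eval (dEven (f t) i) (toPoint z) =
      ∑ k ∈ Finset.range (N + 1), (1 / (k.factorial : ℝ)) •
        (gbody (dz.1 i : Lam N) • taylorTerm k (dEven (f t) i) (toPoint z) +
          (k : ℝ) • (gsoul (dz.1 i : Lam N) *
            taylorTerm (k - 1) (dEven (f t) i) (toPoint z))) := by
    intro i
    -- Since `k / k! = 1 / (k-1)!`, shifting the index matches the two sums. The unmatched top term
    -- is a product of `N + 1` souls and vanishes.
    have e1 : gsoul (dz.1 i : Lam N) * eval (dEven (f t) i) (toPoint z) =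
        ∑ k ∈ Finset.range (N + 1), (1 / (k.factorial : ℝ)) • (k : ℝ) •
          (gsoul (dz.1 i : Lam N) * taylorTerm (k - 1) (dEven (f t) i) (toPoint z)) := by
      rw [Finset.sum_range_succ', eval_eq_sum_taylorTerm, Finset.mul_sum, Finset.sum_range_succ,
        mul_smul_comm, gsoul_mul_taylorTerm]
      simp only [Nat.cast_zero, zero_smul, smul_zero]
      congr 1
      refine Finset.sum_congr rfl fun k _ => ?_
      rw [smul_smul, mul_smul_comm, Nat.factorial_succ, Nat.add_sub_cancel]
      congr 1
      push_cast
      have := Nat.cast_add_one_ne_zero (R := ℝ) k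
      field_simp
    rw [← gbody_smul_add_gsoul_mul, e1, eval_eq_sum_taylorTerm, Finset.smul_sum,
      ← Finset.sum_add_distrib]
    refine Finset.sum_congr rfl fun k _ => ?_
    rw [smul_add, smul_comm]
  simp only [heven]
  rw [_root_.sum_apply, Finset.sum_comm]
  simp only [eval_eq_sum_taylorTerm, Finset.smul_sum, Finset.mul_sum]
  rw [Finset.sum_comm (s := Finset.univ) (t := Finset.range (N + 1)), ← Finset.sum_add_distrib,
    ← Finset.sum_add_distrib]
  refine Finset.sum_congr rfl fun k _ => ?_
  rw [_root_.smul_apply, hL', smul_add, smul_add, smul_comm, Finset.smul_sum, Finset.smul_sum]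
  simp only [mul_smul_comm]

end Families

/-! ### Naturality and parity of values. -/

section Values

variable {ι κ : Type} [Fintype ι] [DecidableEq ι] [Fintype κ] [DecidableEq κ]
variable {D : Set (ℝ × (ι → ℝ))} {f : ℝ → SuperFun ι κ} {N : ℕ}

/-- The inclusion of `Λ_N`-points into `Λ_{N+1}`-points. -/
def inclPt (N : ℕ) (ι κ : Type) [Fintype ι] [Fintype κ] :
    PointSpace N ι κ →L[ℝ] PointSpace (N + 1) ι κ :=
  LinearMap.toContinuousLinearMap
    { toFun := fun v => (fun i => ⟨lamIncl N (v.1 i), lamIncl_mem_even (v.1 i).2⟩,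
        fun α => ⟨lamIncl N (v.2 α), lamIncl_mem_odd (v.2 α).2⟩)
      map_add' := fun v w => by
        ext i <;> exact map_add (lamIncl N) _ _
      map_smul' := fun r v => by
        ext i <;> exact map_smul (lamIncl N) _ _ }

theorem inclPt_fst (v : PointSpace N ι κ) (i : ι) :
    ((inclPt N ι κ v).1 i : Lam (N + 1)) = lamIncl N (v.1 i) := rfl

theorem inclPt_snd (v : PointSpace N ι κ) (α : κ) :
    ((inclPt N ι κ v).2 α : Lam (N + 1)) = lamIncl N (v.2 α) := rfl

theorem body_inclPt (v : PointSpace N ι κ) :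
    (toPoint (inclPt N ι κ v)).body = (toPoint v).body :=
  funext fun _ => gbody_lamIncl _

theorem taylorTerm_inclPt (k : ℕ) (g : SuperFun ι κ) (v : PointSpace N ι κ) :
    taylorTerm k g (toPoint (inclPt N ι κ v)) = lamIncl N (taylorTerm k g (toPoint v)) := by
  have hsub : substOdd (inclPt N ι κ v).2 = (lamIncl N).comp (substOdd v.2) := by
    ext w
    simp [substOdd_iota, inclPt_snd]
  rw [taylorTerm, taylorTerm, map_sum, body_inclPt]
  refine Finset.sum_congr rfl fun i _ => ?_
  rw [map_mul, map_list_prod, List.map_ofFn]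
  congr 1
  · congr 1
    refine congrArg List.ofFn (funext fun j => ?_)
    exact gsoul_lamIncl _
  · exact DFunLike.congr_fun hsub _

/-- Values of superfunctions are natural in the Grassmann algebra. -/
theorem eval_inclPt (g : SuperFun ι κ) (v : PointSpace N ι κ) :
    eval g (toPoint (inclPt N ι κ v)) = lamIncl N (eval g (toPoint v)) := by
  -- Over `Λ_{N+1}` the expansion has one more term, but its `N + 1` souls come from `Λ_N`.
  have h0 : taylorTerm (N + 1) g (toPoint (inclPt N ι κ v)) = 0 := by
    rw [taylorTerm_inclPt, taylorTerm]
    rw [Finset.sum_eq_zero, map_zero]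
    intro i _
    rw [prod_eq_zero, zero_mul]
    · intro b hb
      obtain ⟨j, rfl⟩ := List.mem_ofFn' _ _ |>.mp hb
      exact gbody_gsoul _
    · simp
  rw [eval_eq_sum_taylorTerm, Finset.sum_range_succ, h0, smul_zero, add_zero,
    eval_eq_sum_taylorTerm, map_sum]
  refine Finset.sum_congr rfl fun k _ => ?_
  rw [map_smul, taylorTerm_inclPt]

/-- Composition with a linear projection onto `A` does not change `g` on `U`, so the derivative
takes values in the range of the projection. -/
theorem fderiv_apply_mem {E F : Type*} [NormedAddCommGroup E] [NormedSpace ℝ E]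
    [NormedAddCommGroup F] [NormedSpace ℝ F] [FiniteDimensional ℝ F] (A : Submodule ℝ F)
    {g : E → F} {U : Set E} (hU : IsOpen U) (hg : ∀ b ∈ U, g b ∈ A) {b : E} (hb : b ∈ U)
    (hd : DifferentiableAt ℝ g b) (u : E) : fderiv ℝ g b u ∈ A := by
  obtain ⟨p, hp⟩ := A.subtype.exists_leftInverse_of_injective A.ker_subtype
  let P : F →L[ℝ] F := LinearMap.toContinuousLinearMap (A.subtype ∘ₗ p)
  have h1 : Set.EqOn g (P ∘ g) U := fun c hc =>
    (congrArg Subtype.val (DFunLike.congr_fun hp ⟨g c, hg c hc⟩)).symm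
  rw [fderiv_congr_of_eqOn hU hb h1, (P.hasFDerivAt.comp b hd.hasFDerivAt).fderiv]
  exact (p (fderiv ℝ g b u)).2

/-- Raising the Taylor degree multiplies by an even soul and replaces the function by an even
derivative. The former preserves `B`, and the latter keeps values in `A`. -/
theorem eval_mem {A : Submodule ℝ (Grassmann κ)} {B : Submodule ℝ (Lam N)}
    (hA : ∀ (θ : κ → oddPart (Fin N)), ∀ a ∈ A, substOdd θ a ∈ B)
    (hB : ∀ a ∈ evenPart (Fin N), ∀ b ∈ B, a * b ∈ B) (hf : SmoothFam D f) (hD : IsOpen D)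
    (hfA : ∀ w ∈ D, f w.1 w.2 ∈ A) {t : ℝ} {z : SuperPoint N ι κ} (hz : (t, z.body) ∈ D) :
    eval (f t) z ∈ B := by
  have key : ∀ (k : ℕ) (f : ℝ → SuperFun ι κ), SmoothFam D f → (∀ w ∈ D, f w.1 w.2 ∈ A) →
      taylorTerm k (f t) z ∈ B := by
    intro k
    induction k with
    | zero =>
      intro f _ h
      rw [taylorTerm_zero]
      exact hA _ _ (h _ hz)
    | succ k ih =>
      intro f hf h
      rw [taylorTerm_succ (hf.contDiffAt_slice hD hz)]
      refine Submodule.sum_mem _ fun i _ => hB _ (gsoul_mem_even (z.ev i).2) _ ?_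
      refine ih (fun t => dEven (f t) i) (hf.dEven hD i) fun w hw => ?_
      rw [hf.dEven_eq hD i hw]
      exact fderiv_apply_mem (g := fun w : ℝ × (ι → ℝ) => f w.1 w.2) A hD h hw ((hf.contDiffAt hD hw).differentiableAt (by simp)) _
  rw [eval_eq_sum_taylorTerm]
  exact Submodule.sum_mem _ fun k _ => Submodule.smul_mem _ _ (key k f hf hfA)

theorem eval_mem_even (hf : SmoothFam D f) (hD : IsOpen D)
    (he : ∀ w ∈ D, f w.1 w.2 ∈ evenPart κ) {t : ℝ} {z : SuperPoint N ι κ}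
    (hz : (t, z.body) ∈ D) : eval (f t) z ∈ evenPart (Fin N) :=
  eval_mem (fun θ _ ha => map_mem_even _ (substOdd_iota_mem_odd θ) ha)
    (fun _ ha _ hb => even_mul_even ha hb) hf hD he hz

theorem eval_mem_odd (hf : SmoothFam D f) (hD : IsOpen D)
    (he : ∀ w ∈ D, f w.1 w.2 ∈ oddPart κ) {t : ℝ} {z : SuperPoint N ι κ}
    (hz : (t, z.body) ∈ D) : eval (f t) z ∈ oddPart (Fin N) :=
  eval_mem (fun θ _ ha => map_mem_odd _ (substOdd_iota_mem_odd θ) ha)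
    (fun _ ha _ hb => even_mul_odd ha hb) hf hD he hz

theorem eval_dEven_mem_even (hf : SmoothFam D f) (hD : IsOpen D)
    (he : ∀ w ∈ D, f w.1 w.2 ∈ evenPart κ) (i : ι) {t : ℝ} {z : SuperPoint N ι κ}
    (hz : (t, z.body) ∈ D) : eval (dEven (f t) i) z ∈ evenPart (Fin N) :=
  eval_mem_even (hf.dEven hD i) hD (fun w hw => by
    rw [hf.dEven_eq hD i hw]
    exact fderiv_apply_mem (g := fun w : ℝ × (ι → ℝ) => f w.1 w.2) _ hD he hw ((hf.contDiffAt hD hw).differentiableAt (by simp)) _) hz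

theorem eval_dOdd_mem_odd (hf : SmoothFam D f) (hD : IsOpen D)
    (he : ∀ w ∈ D, f w.1 w.2 ∈ evenPart κ) (α : κ) {t : ℝ} {z : SuperPoint N ι κ}
    (hz : (t, z.body) ∈ D) : eval (dOdd (f t) α) z ∈ oddPart (Fin N) :=
  eval_mem_odd (hf.dOdd α) hD (fun w hw => contractLeft_even_mem _ (he w hw)) hz

/-- A projection onto the even part. -/
def evenProj (N : ℕ) : Lam N →L[ℝ] evenPart (Fin N) := LinearMap.toContinuousLinearMap
  ((evenPart (Fin N)).subtype.exists_leftInverse_of_injective (Submodule.ker_subtype _)).choose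

theorem evenProj_apply {a : Lam N} (ha : a ∈ evenPart (Fin N)) : (evenProj N a : Lam N) = a :=
  congrArg Subtype.val (DFunLike.congr_fun ((evenPart
    (Fin N)).subtype.exists_leftInverse_of_injective (Submodule.ker_subtype _)).choose_spec ⟨a, ha⟩)

/-- A projection onto the odd part. -/
def oddProj (N : ℕ) : Lam N →L[ℝ] oddPart (Fin N) := LinearMap.toContinuousLinearMap
  ((oddPart (Fin N)).subtype.exists_leftInverse_of_injective (Submodule.ker_subtype _)).choose

theorem oddProj_apply {a : Lam N} (ha : a ∈ oddPart (Fin N)) : (oddProj N a : Lam N) = a :=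
  congrArg Subtype.val (DFunLike.congr_fun ((oddPart
    (Fin N)).subtype.exists_leftInverse_of_injective (Submodule.ker_subtype _)).choose_spec ⟨a, ha⟩)

end Values

/-! ### The differential of a generating function on phase space. -/

/-- Symmetry of the second differential of a function with differential
`dF = T dt + ⟨dx, P⟩ + ⟨Y, dq⟩`. -/
theorem second_symm_of_pairing {V G : Type*} [NormedAddCommGroup V] [NormedSpace ℝ V]
    [NormedAddCommGroup G] [NormedSpace ℝ G] (B : V →L[ℝ] V →L[ℝ] G) {F T : ℝ × V × V → G}
    {P Y : ℝ × V × V → V} {w : ℝ × V × V} {T' : ℝ × V × V →L[ℝ] G} {P' Y' : ℝ × V × V →L[ℝ] V}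
    (hF : ∀ᶠ w' in 𝓝 w, ∃ L : ℝ × V × V →L[ℝ] G, HasFDerivAt F L w' ∧
      ∀ dw, L dw = dw.1 • T w' + B dw.2.1 (P w') + B (Y w') dw.2.2)
    (hT : HasFDerivAt T T' w) (hP : HasFDerivAt P P' w) (hY : HasFDerivAt Y Y' w)
    (u v : ℝ × V × V) :
    v.1 • T' u + B v.2.1 (P' u) + B (Y' u) v.2.2 =
      u.1 • T' v + B u.2.1 (P' v) + B (Y' v) u.2.2 := by
  let p1 : ℝ × V × V →L[ℝ] ℝ := ContinuousLinearMap.fst ℝ _ _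
  let p2 : ℝ × V × V →L[ℝ] V := (ContinuousLinearMap.fst ℝ _ _).comp (ContinuousLinearMap.snd ℝ _ _)
  let p3 : ℝ × V × V →L[ℝ] V := (ContinuousLinearMap.snd ℝ _ _).comp (ContinuousLinearMap.snd ℝ _ _)
  let A : G →L[ℝ] ℝ × V × V →L[ℝ] G := ContinuousLinearMap.smulRightL ℝ _ G p1
  let B2 : V →L[ℝ] ℝ × V × V →L[ℝ] G :=
    ((ContinuousLinearMap.compL ℝ (ℝ × V × V) V G).flip p2).comp B.flip
  let B3 : V →L[ℝ] ℝ × V × V →L[ℝ] G :=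
    ((ContinuousLinearMap.compL ℝ (ℝ × V × V) V G).flip p3).comp B
  -- The differential depends on the point only through `T`, `P` and `Y`, and linearly on them, so
  -- their derivatives give the second derivative of `F`.
  have hd : ∀ᶠ w' in 𝓝 w, HasFDerivAt F (A (T w') + B2 (P w') + B3 (Y w')) w' := by
    filter_upwards [hF] with w' ⟨L, hL, hL'⟩
    convert hL using 1
    refine ContinuousLinearMap.ext fun dw => ?_
    rw [hL']
    rfl
  have hd2 := ((A.hasFDerivAt.comp w hT).add (B2.hasFDerivAt.comp w hP)).add
    (B3.hasFDerivAt.comp w hY)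
  exact second_derivative_symmetric_of_eventually hd hd2 u v

section PhaseSpace

variable {N n m : ℕ}

/-- The vector space of `Λ_N`-points of `ℝ^{n|m}`. -/
abbrev Vec (N n m : ℕ) : Type := PointSpace N (Fin n) (Fin m)

/-- Pairs of points as points of the doubled superspace. -/
def pairCLM (N n m : ℕ) : Vec N n m × Vec N n m →L[ℝ] PointSpace N (Ev n) (Od m) :=
  LinearMap.toContinuousLinearMap
    { toFun := fun v => (Sum.elim v.1.1 v.2.1, Sum.elim v.1.2 v.2.2)
      map_add' := fun v w => by
        ext i <;> rcases i with i | i <;> rfl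
      map_smul' := fun r v => by
        ext i <;> rcases i with i | i <;> rfl }

theorem contract_add_left (x x' q : Vec N n m) :
    contract (toPoint (x + x')) (toPoint q) =
      contract (toPoint x) (toPoint q) + contract (toPoint x') (toPoint q) := by
  simp only [contract, toPoint, Prod.fst_add, Prod.snd_add, Pi.add_apply, Submodule.coe_add,
    add_mul, Finset.sum_add_distrib]
  abel

theorem contract_add_right (x q q' : Vec N n m) :
    contract (toPoint x) (toPoint (q + q')) =
      contract (toPoint x) (toPoint q) + contract (toPoint x) (toPoint q') := by
  simp only [contract, toPoint, Prod.fst_add, Prod.snd_add, Pi.add_apply, Submodule.coe_add,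
    mul_add, Finset.sum_add_distrib]
  abel

theorem contract_smul_left (r : ℝ) (x q : Vec N n m) :
    contract (toPoint (r • x)) (toPoint q) = r • contract (toPoint x) (toPoint q) := by
  simp only [contract, toPoint, Prod.smul_fst, Prod.smul_snd, Pi.smul_apply, Submodule.coe_smul,
    smul_mul_assoc, smul_add, Finset.smul_sum]

theorem contract_smul_right (r : ℝ) (x q : Vec N n m) :
    contract (toPoint x) (toPoint (r • q)) = r • contract (toPoint x) (toPoint q) := by
  simp only [contract, toPoint, Prod.smul_fst, Prod.smul_snd, Pi.smul_apply, Submodule.coe_smul,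
    mul_smul_comm, smul_add, Finset.smul_sum]

/-- The contraction `x^a q_a` as a continuous bilinear map. -/
def pairing (N n m : ℕ) : Vec N n m →L[ℝ] Vec N n m →L[ℝ] Lam N :=
  LinearMap.toContinuousBilinearMap (LinearMap.mk₂ ℝ
    (fun x q : Vec N n m => contract (toPoint x) (toPoint q))
    contract_add_left contract_smul_left contract_add_right contract_smul_right)

theorem pairing_apply (x q : Vec N n m) :
    pairing N n m x q = contract (toPoint x) (toPoint q) := rfl

/-- The domain of `Λ_N`-points `(t, x, q)` of a set of real points. -/
def pointDomain (N : ℕ) (D : Set (ℝ × (Ev n → ℝ))) : Set (ℝ × Vec N n m × Vec N n m) :=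
  {w | (w.1, ((toPoint w.2.1).pair (toPoint w.2.2)).body) ∈ D}

/-- The real point under a `Λ_N`-point `(t, x, q)`. -/
def timeBodyCLM (N n m : ℕ) : ℝ × Vec N n m × Vec N n m →L[ℝ] ℝ × PointSpace N (Ev n) (Od m) :=
  (ContinuousLinearMap.id ℝ ℝ).prodMap (pairCLM N n m)

theorem isOpen_pointDomain {D : Set (ℝ × (Ev n → ℝ))} (hD : IsOpen D) :
    IsOpen (pointDomain (m := m) N D) :=
  hD.preimage (((ContinuousLinearMap.id ℝ ℝ).prodMap
    ((bodyCLM N (Ev n) (Od m)).comp (pairCLM N n m))).continuous)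

/-- An even smooth family of superfunctions of `(x, q)`. -/
structure EvenFam (D : Set (ℝ × (Ev n → ℝ))) (f : ℝ → SuperFun (Ev n) (Od m)) : Prop where
  isOpen : IsOpen D
  smooth : SmoothFam D f
  even : ∀ w ∈ D, f w.1 w.2 ∈ evenPart (Od m)

/-- The value of `f_t(x,q)`. -/
def genVal (f : ℝ → SuperFun (Ev n) (Od m)) (w : ℝ × Vec N n m × Vec N n m) : Lam N :=
  eval (f w.1) ((toPoint w.2.1).pair (toPoint w.2.2))

/-- The value of `∂f_t/∂t (x,q)`. -/
def timeVal (f : ℝ → SuperFun (Ev n) (Od m)) (w : ℝ × Vec N n m × Vec N n m) : Lam N :=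
  eval (dTime f w.1) ((toPoint w.2.1).pair (toPoint w.2.2))

/-- The value of `∂f_t/∂x^a (x,q)`. -/
def momVal (f : ℝ → SuperFun (Ev n) (Od m)) (w : ℝ × Vec N n m × Vec N n m) : Vec N n m :=
  (fun i => evenProj N (eval (dEven (f w.1) (Sum.inl i)) ((toPoint w.2.1).pair (toPoint w.2.2))),
    fun α => oddProj N (eval (dOdd (f w.1) (Sum.inl α)) ((toPoint w.2.1).pair (toPoint w.2.2))))

/-- The value of `(-1)^{ã} ∂f_t/∂q_a (x,q)`. -/
def posVal (f : ℝ → SuperFun (Ev n) (Od m)) (w : ℝ × Vec N n m × Vec N n m) : Vec N n m :=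
  (fun i => evenProj N (eval (dEven (f w.1) (Sum.inr i)) ((toPoint w.2.1).pair (toPoint w.2.2))),
    fun α => -oddProj N (eval (dOdd (f w.1) (Sum.inr α)) ((toPoint w.2.1).pair (toPoint w.2.2))))

variable {D : Set (ℝ × (Ev n → ℝ))} {f : ℝ → SuperFun (Ev n) (Od m)}

theorem EvenFam.momVal_fst (hf : EvenFam D f) {w : ℝ × Vec N n m × Vec N n m}
    (hw : w ∈ pointDomain N D) (i : Fin n) : ((momVal f w).1 i : Lam N) =
      eval (dEven (f w.1) (Sum.inl i)) ((toPoint w.2.1).pair (toPoint w.2.2)) :=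
  evenProj_apply (eval_dEven_mem_even hf.smooth hf.isOpen hf.even _ hw)

theorem EvenFam.momVal_snd (hf : EvenFam D f) {w : ℝ × Vec N n m × Vec N n m}
    (hw : w ∈ pointDomain N D) (α : Fin m) : ((momVal f w).2 α : Lam N) =
      eval (dOdd (f w.1) (Sum.inl α)) ((toPoint w.2.1).pair (toPoint w.2.2)) :=
  oddProj_apply (eval_dOdd_mem_odd hf.smooth hf.isOpen hf.even _ hw)

theorem EvenFam.posVal_fst (hf : EvenFam D f) {w : ℝ × Vec N n m × Vec N n m}
    (hw : w ∈ pointDomain N D) (i : Fin n) : ((posVal f w).1 i : Lam N) =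
      eval (dEven (f w.1) (Sum.inr i)) ((toPoint w.2.1).pair (toPoint w.2.2)) :=
  evenProj_apply (eval_dEven_mem_even hf.smooth hf.isOpen hf.even _ hw)

theorem EvenFam.posVal_snd (hf : EvenFam D f) {w : ℝ × Vec N n m × Vec N n m}
    (hw : w ∈ pointDomain N D) (α : Fin m) : ((posVal f w).2 α : Lam N) =
      -eval (dOdd (f w.1) (Sum.inr α)) ((toPoint w.2.1).pair (toPoint w.2.2)) :=
  congrArg Neg.neg (oddProj_apply (eval_dOdd_mem_odd hf.smooth hf.isOpen hf.even _ hw))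

theorem vec_ext {v w : Vec N n m} (h1 : ∀ i, (v.1 i : Lam N) = w.1 i)
    (h2 : ∀ α, (v.2 α : Lam N) = w.2 α) : v = w :=
  Prod.ext (funext fun i => Subtype.ext (h1 i)) (funext fun α => Subtype.ext (h2 α))

theorem EvenFam.momentumEq_iff (hf : EvenFam D f) {t : ℝ} {x q p : Vec N n m}
    (hw : (t, x, q) ∈ pointDomain N D) :
    MomentumEq (f t) (toPoint x) (toPoint q) (toPoint p) ↔ p = momVal f (t, x, q) := by
  constructor
  · rintro ⟨h1, h2⟩
    exact vec_ext (fun i => (h1 i).trans (hf.momVal_fst hw i).symm)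
      (fun α => (h2 α).trans (hf.momVal_snd hw α).symm)
  · rintro rfl
    exact ⟨fun i => hf.momVal_fst hw i, fun α => hf.momVal_snd hw α⟩

theorem EvenFam.positionEq_iff (hf : EvenFam D f) {t : ℝ} {x q y : Vec N n m}
    (hw : (t, x, q) ∈ pointDomain N D) :
    PositionEq (f t) (toPoint x) (toPoint q) (toPoint y) ↔ y = posVal f (t, x, q) := by
  constructor
  · rintro ⟨h1, h2⟩
    exact vec_ext (fun i => (h1 i).trans (hf.posVal_fst hw i).symm)
      (fun α => (h2 α).trans (hf.posVal_snd hw α).symm)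
  · rintro rfl
    exact ⟨fun i => hf.posVal_fst hw i, fun α => hf.posVal_snd hw α⟩

theorem exists_hasStrictFDerivAt_pair {g : ℝ → SuperFun (Ev n) (Od m)} (hD : IsOpen D)
    (hg : SmoothFam D g) {w : ℝ × Vec N n m × Vec N n m} (hw : w ∈ pointDomain N D) :
    ∃ L : ℝ × Vec N n m × Vec N n m →L[ℝ] Lam N, HasStrictFDerivAt (genVal g) L w ∧
      ∀ dw, L dw = dw.1 • timeVal g w +
        (∑ i, ((pairCLM N n m dw.2).1 i : Lam N) *
          eval (dEven (g w.1) i) ((toPoint w.2.1).pair (toPoint w.2.2))) +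
        ∑ α, ((pairCLM N n m dw.2).2 α : Lam N) *
          eval (dOdd (g w.1) α) ((toPoint w.2.1).pair (toPoint w.2.2)) := by
  obtain ⟨L, hL, hL'⟩ := exists_hasStrictFDerivAt_eval (N := N) (z := pairCLM N n m w.2) hg hD hw
  exact ⟨L.comp (timeBodyCLM N n m), hL.comp w (timeBodyCLM N n m).hasStrictFDerivAt,
    fun dw => hL' dw.1 (pairCLM N n m dw.2)⟩

/-- The differential of `f`: `df = dt ∂f/∂t + dx^a p_a + y^a dq_a`. -/
theorem EvenFam.exists_genVal (hf : EvenFam D f) {w : ℝ × Vec N n m × Vec N n m}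
    (hw : w ∈ pointDomain N D) :
    ∃ L : ℝ × Vec N n m × Vec N n m →L[ℝ] Lam N, HasStrictFDerivAt (genVal f) L w ∧
      ∀ dw, L dw = dw.1 • timeVal f w + pairing N n m dw.2.1 (momVal f w) +
        pairing N n m (posVal f w) dw.2.2 := by
  obtain ⟨L, hL, hL'⟩ := exists_hasStrictFDerivAt_pair hf.isOpen hf.smooth hw
  refine ⟨L, hL, fun dw => ?_⟩
  have e1 : ∀ i, ((posVal f w).1 i : Lam N) * (dw.2.2.1 i : Lam N) = (dw.2.2.1 i : Lam N) *
      eval (dEven (f w.1) (Sum.inr i)) ((toPoint w.2.1).pair (toPoint w.2.2)) := by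
    intro i
    rw [← hf.posVal_fst hw, even_mul_comm ((posVal f w).1 i).2]
  have e2 : ∀ α, ((posVal f w).2 α : Lam N) * (dw.2.2.2 α : Lam N) = (dw.2.2.2 α : Lam N) *
      eval (dOdd (f w.1) (Sum.inr α)) ((toPoint w.2.1).pair (toPoint w.2.2)) := by
    intro α
    -- The sign `(-1)^{ã}` in `posVal` cancels the sign from interchanging two odd factors. This is
    -- why the differential contains `y^a dq_a` with no sign.
    rw [odd_mul_odd _ _ ((posVal f w).2 α).2 (dw.2.2.2 α).2, hf.posVal_snd hw, mul_neg, neg_neg]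
  rw [hL', Fintype.sum_sum_type, Fintype.sum_sum_type]
  simp only [pairing_apply, contract, toPoint] at e1 e2 ⊢
  simp only [e1, e2, hf.momVal_fst hw, hf.momVal_snd hw]
  change _ • _ + ((∑ i, (dw.2.1.1 i : Lam N) * _) + ∑ i, (dw.2.2.1 i : Lam N) * _) +
    ((∑ i, (dw.2.1.2 i : Lam N) * _) + ∑ i, (dw.2.2.2 i : Lam N) * _) = _
  simp only [toPoint]
  abel

theorem EvenFam.exists_timeVal (hf : EvenFam D f) {w : ℝ × Vec N n m × Vec N n m}
    (hw : w ∈ pointDomain N D) :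
    ∃ L : ℝ × Vec N n m × Vec N n m →L[ℝ] Lam N, HasStrictFDerivAt (timeVal f) L w := by
  obtain ⟨L, hL, -⟩ := exists_hasStrictFDerivAt_pair hf.isOpen (hf.smooth.dTime hf.isOpen) hw
  exact ⟨L, hL⟩

theorem EvenFam.exists_momVal (hf : EvenFam D f) {w : ℝ × Vec N n m × Vec N n m}
    (hw : w ∈ pointDomain N D) :
    ∃ L : ℝ × Vec N n m × Vec N n m →L[ℝ] Vec N n m, HasStrictFDerivAt (momVal f) L w := by
  choose L hL _ using fun i : Fin n => exists_hasStrictFDerivAt_pair hf.isOpen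
    (hf.smooth.dEven hf.isOpen (Sum.inl i)) hw
  choose M hM _ using fun α : Fin m => exists_hasStrictFDerivAt_pair hf.isOpen
    (hf.smooth.dOdd (Sum.inl α)) hw
  exact ⟨_, (hasStrictFDerivAt_pi.2 fun i =>
    (evenProj N).hasStrictFDerivAt.comp w (hL i)).prodMk (hasStrictFDerivAt_pi.2 fun α =>
    (oddProj N).hasStrictFDerivAt.comp w (hM α))⟩

theorem EvenFam.exists_posVal (hf : EvenFam D f) {w : ℝ × Vec N n m × Vec N n m}
    (hw : w ∈ pointDomain N D) :
    ∃ L : ℝ × Vec N n m × Vec N n m →L[ℝ] Vec N n m, HasStrictFDerivAt (posVal f) L w := by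
  choose L hL _ using fun i : Fin n => exists_hasStrictFDerivAt_pair hf.isOpen
    (hf.smooth.dEven hf.isOpen (Sum.inr i)) hw
  choose M hM _ using fun α : Fin m => exists_hasStrictFDerivAt_pair hf.isOpen
    (hf.smooth.dOdd (Sum.inr α)) hw
  exact ⟨_, (hasStrictFDerivAt_pi.2 fun i =>
    (evenProj N).hasStrictFDerivAt.comp w (hL i)).prodMk (hasStrictFDerivAt_pi.2 fun α =>
    ((oddProj N).hasStrictFDerivAt.comp w (hM α)).neg)⟩

theorem EvenFam.hasFDerivAt_momVal (hf : EvenFam D f) {w : ℝ × Vec N n m × Vec N n m}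
    (hw : w ∈ pointDomain N D) : HasFDerivAt (momVal f) (fderiv ℝ (momVal f) w) w := by
  obtain ⟨L, hL⟩ := hf.exists_momVal hw
  exact hL.hasFDerivAt.differentiableAt.hasFDerivAt

theorem EvenFam.hasFDerivAt_posVal (hf : EvenFam D f) {w : ℝ × Vec N n m × Vec N n m}
    (hw : w ∈ pointDomain N D) : HasFDerivAt (posVal f) (fderiv ℝ (posVal f) w) w := by
  obtain ⟨L, hL⟩ := hf.exists_posVal hw
  exact hL.hasFDerivAt.differentiableAt.hasFDerivAt

theorem EvenFam.hasFDerivAt_timeVal (hf : EvenFam D f) {w : ℝ × Vec N n m × Vec N n m}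
    (hw : w ∈ pointDomain N D) : HasFDerivAt (timeVal f) (fderiv ℝ (timeVal f) w) w := by
  obtain ⟨L, hL⟩ := hf.exists_timeVal hw
  exact hL.hasFDerivAt.differentiableAt.hasFDerivAt

/-- Symmetry of the second differential of `f`. -/
theorem EvenFam.second_symm (hf : EvenFam D f) {w : ℝ × Vec N n m × Vec N n m}
    (hw : w ∈ pointDomain N D) (u v : ℝ × Vec N n m × Vec N n m) :
    v.1 • fderiv ℝ (timeVal f) w u + pairing N n m v.2.1 (fderiv ℝ (momVal f) w u) +
      pairing N n m (fderiv ℝ (posVal f) w u) v.2.2 =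
    u.1 • fderiv ℝ (timeVal f) w v + pairing N n m u.2.1 (fderiv ℝ (momVal f) w v) +
      pairing N n m (fderiv ℝ (posVal f) w v) u.2.2 := by
  refine second_symm_of_pairing (pairing N n m) (F := genVal f) ?_ (hf.hasFDerivAt_timeVal hw)
    (hf.hasFDerivAt_momVal hw) (hf.hasFDerivAt_posVal hw) u v
  filter_upwards [(isOpen_pointDomain hf.isOpen).mem_nhds hw] with w' hw'
  obtain ⟨L, hL, hL'⟩ := hf.exists_genVal hw'
  exact ⟨L, hL.hasFDerivAt, hL'⟩

end PhaseSpace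

/-! ### Naturality in `N` and nondegeneracy of the pairing. -/

section Naturality

variable {N n m : ℕ} {D : Set (ℝ × (Ev n → ℝ))} {f : ℝ → SuperFun (Ev n) (Od m)}

/-- The inclusion of `Λ_N`-points `(t, x, q)` into `Λ_{N+1}`-points. -/
def inclTriple (N n m : ℕ) :
    ℝ × Vec N n m × Vec N n m →L[ℝ] ℝ × Vec (N + 1) n m × Vec (N + 1) n m :=
  (ContinuousLinearMap.id ℝ ℝ).prodMap ((inclPt N (Fin n) (Fin m)).prodMap (inclPt N _ _))

theorem pair_inclPt (x q : Vec N n m) :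
    (toPoint (inclPt N _ _ x)).pair (toPoint (inclPt N _ _ q)) =
      toPoint (inclPt N _ _ (pairCLM N n m (x, q))) := by
  have : pairCLM (N + 1) n m (inclPt N _ _ x, inclPt N _ _ q) =
      inclPt N _ _ (pairCLM N n m (x, q)) := by
    ext i <;> rcases i with i | i <;> rfl
  rw [← this]
  rfl

theorem inclTriple_mem {w : ℝ × Vec N n m × Vec N n m} (hw : w ∈ pointDomain N D) :
    inclTriple N n m w ∈ pointDomain (N + 1) D := by
  change (w.1, ((toPoint (inclPt N _ _ w.2.1)).pair (toPoint (inclPt N _ _ w.2.2))).body) ∈ D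
  rw [pair_inclPt, body_inclPt]
  exact hw

theorem eval_pair_inclTriple (g : SuperFun (Ev n) (Od m)) (w : ℝ × Vec N n m × Vec N n m) :
    eval g ((toPoint (inclTriple N n m w).2.1).pair (toPoint (inclTriple N n m w).2.2)) =
      lamIncl N (eval g ((toPoint w.2.1).pair (toPoint w.2.2))) := by
  change eval g ((toPoint (inclPt N _ _ w.2.1)).pair (toPoint (inclPt N _ _ w.2.2))) = _
  rw [pair_inclPt, eval_inclPt]
  rfl

theorem EvenFam.momVal_incl (hf : EvenFam D f) {w : ℝ × Vec N n m × Vec N n m}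
    (hw : w ∈ pointDomain N D) :
    momVal f (inclTriple N n m w) = inclPt N _ _ (momVal f w) :=
  vec_ext (fun i => by
      rw [hf.momVal_fst (inclTriple_mem hw), eval_pair_inclTriple, inclPt_fst, hf.momVal_fst hw]
      rfl)
    (fun α => by
      rw [hf.momVal_snd (inclTriple_mem hw), eval_pair_inclTriple, inclPt_snd, hf.momVal_snd hw]
      rfl)

theorem EvenFam.posVal_incl (hf : EvenFam D f) {w : ℝ × Vec N n m × Vec N n m}
    (hw : w ∈ pointDomain N D) :
    posVal f (inclTriple N n m w) = inclPt N _ _ (posVal f w) :=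
  vec_ext (fun i => by
      rw [hf.posVal_fst (inclTriple_mem hw), eval_pair_inclTriple, inclPt_fst, hf.posVal_fst hw]
      rfl)
    (fun α => by
      rw [hf.posVal_snd (inclTriple_mem hw), eval_pair_inclTriple, inclPt_snd, hf.posVal_snd hw,
        map_neg]
      rfl)

/-- Both sides differentiate the same function `g' ∘ J = j ∘ g`. With `J` an inclusion of points
this moves derivatives from `Λ_N` to `Λ_{N+1}`; with `J` the identity it extracts coordinates. -/
theorem fderiv_natural {E E' F F' : Type*} [NormedAddCommGroup E] [NormedSpace ℝ E]
    [NormedAddCommGroup E'] [NormedSpace ℝ E'] [NormedAddCommGroup F] [NormedSpace ℝ F]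
    [NormedAddCommGroup F'] [NormedSpace ℝ F'] {J : E →L[ℝ] E'} {j : F →L[ℝ] F'} {g : E → F}
    {g' : E' → F'} {U : Set E} (hU : IsOpen U) (h : ∀ w ∈ U, g' (J w) = j (g w)) {w : E}
    (hw : w ∈ U) (hg : DifferentiableAt ℝ g w) (hg' : DifferentiableAt ℝ g' (J w)) (u : E) :
    fderiv ℝ g' (J w) (J u) = j (fderiv ℝ g w u) := by
  have h1 := hg'.hasFDerivAt.comp w J.hasFDerivAt
  have h2 := (j.hasFDerivAt.comp w hg.hasFDerivAt).congr_of_eventuallyEq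
    (Filter.eventuallyEq_of_mem (hU.mem_nhds hw) h)
  exact DFunLike.congr_fun (h1.unique h2) u

theorem EvenFam.fderiv_momVal_incl (hf : EvenFam D f) {w : ℝ × Vec N n m × Vec N n m}
    (hw : w ∈ pointDomain N D) (u : ℝ × Vec N n m × Vec N n m) :
    fderiv ℝ (momVal f) (inclTriple N n m w) (inclTriple N n m u) =
      inclPt N _ _ (fderiv ℝ (momVal f) w u) :=
  fderiv_natural (isOpen_pointDomain hf.isOpen) (fun _ => hf.momVal_incl) hw
    (hf.hasFDerivAt_momVal hw).differentiableAt
    (hf.hasFDerivAt_momVal (inclTriple_mem hw)).differentiableAt u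

theorem EvenFam.fderiv_posVal_incl (hf : EvenFam D f) {w : ℝ × Vec N n m × Vec N n m}
    (hw : w ∈ pointDomain N D) (u : ℝ × Vec N n m × Vec N n m) :
    fderiv ℝ (posVal f) (inclTriple N n m w) (inclTriple N n m u) =
      inclPt N _ _ (fderiv ℝ (posVal f) w u) :=
  fderiv_natural (isOpen_pointDomain hf.isOpen) (fun _ => hf.posVal_incl) hw
    (hf.hasFDerivAt_posVal hw).differentiableAt
    (hf.hasFDerivAt_posVal (inclTriple_mem hw)).differentiableAt u

/-- The vector with one even coordinate equal to `1`. -/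
def evenUnit (N : ℕ) (n m : ℕ) (i : Fin n) : Vec N n m :=
  (Pi.single i ⟨1, by simpa using algebraMap_mem_even (κ := Fin N) 1⟩, 0)

/-- The vector with one odd coordinate equal to a new generator. -/
def oddUnit (N : ℕ) (n m : ℕ) (α : Fin m) : Vec (N + 1) n m :=
  (0, Pi.single α ⟨newGen N, newGen_mem_odd N⟩)

theorem pairing_evenUnit_left (i : Fin n) (q : Vec N n m) :
    pairing N n m (evenUnit N n m i) q = q.1 i := by
  rw [pairing_apply, contract, Finset.sum_eq_single i]
  · simp [evenUnit, toPoint]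
  · intro j _ hj
    simp [evenUnit, toPoint, hj]
  · simp

theorem pairing_oddUnit_left (α : Fin m) (q : Vec (N + 1) n m) :
    pairing (N + 1) n m (oddUnit N n m α) q = newGen N * q.2 α := by
  rw [pairing_apply, contract, add_comm (∑ i, _), Finset.sum_eq_single α]
  · simp [oddUnit, toPoint]
  · intro j _ hj
    simp [oddUnit, toPoint, hj]
  · simp

theorem pairing_evenUnit_right (i : Fin n) (q : Vec N n m) :
    pairing N n m q (evenUnit N n m i) = q.1 i := by
  rw [pairing_apply, contract, Finset.sum_eq_single i]
  · simp [evenUnit, toPoint]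
  · intro j _ hj
    simp [evenUnit, toPoint, hj]
  · simp

theorem pairing_oddUnit_right (α : Fin m) (q : Vec (N + 1) n m) :
    pairing (N + 1) n m q (oddUnit N n m α) = -(newGen N * q.2 α) := by
  rw [pairing_apply, contract, add_comm (∑ i, _), Finset.sum_eq_single α]
  · simp [oddUnit, toPoint, odd_mul_odd _ _ (newGen_mem_odd N) (q.2 α).2]
  · intro j _ hj
    simp [oddUnit, toPoint, hj]
  · simp

/-- The pairing is nondegenerate if an additional odd generator is available. -/
theorem eq_zero_of_pairing_left {a : Vec N n m}
    (h : ∀ u, pairing (N + 1) n m u (inclPt N _ _ a) = 0) : a = 0 := by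
  refine vec_ext (fun i => ?_) (fun α => ?_)
  · have := h (evenUnit _ _ _ i)
    rw [pairing_evenUnit_left, inclPt_fst] at this
    exact lamIncl_injective N (this.trans (map_zero _).symm)
  · have := h (oddUnit _ _ _ α)
    rw [pairing_oddUnit_left, inclPt_snd] at this
    exact eq_zero_of_newGen_mul this

/-- The pairing is nondegenerate if an additional odd generator is available. -/
theorem eq_zero_of_pairing_right {a : Vec N n m}
    (h : ∀ u, pairing (N + 1) n m (inclPt N _ _ a) u = 0) : a = 0 := by
  refine vec_ext (fun i => ?_) (fun α => ?_)
  · have := h (evenUnit _ _ _ i)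
    rw [pairing_evenUnit_right, inclPt_fst] at this
    exact lamIncl_injective N (this.trans (map_zero _).symm)
  · have := h (oddUnit _ _ _ α)
    rw [pairing_oddUnit_right, inclPt_snd, neg_eq_zero] at this
    exact eq_zero_of_newGen_mul this

end Naturality

/-! ### Dual numbers inside `Λ_{N+2}`. -/

section DualNumbers

/-- An even element of square zero of `Λ_{N+2}`. -/
def eps (N : ℕ) : Lam (N + 1 + 1) := newGen (N + 1) * lamIncl (N + 1) (newGen N)

theorem eps_mem_even (N : ℕ) : eps N ∈ evenPart (Fin (N + 1 + 1)) :=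
  odd_mul_odd_mem (newGen_mem_odd _) (lamIncl_mem_odd (newGen_mem_odd N))

theorem newGen_sq (N : ℕ) : newGen N * newGen N = 0 := odd_sq _ (newGen_mem_odd N)

theorem eps_mul_eps (N : ℕ) (a b : Lam (N + 1 + 1)) : eps N * a * (eps N * b) = 0 := by
  have h : eps N * eps N = 0 := by
    rw [eps, mul_assoc, ← mul_assoc (lamIncl (N + 1) (newGen N)),
      odd_mul_odd _ _ (lamIncl_mem_odd (newGen_mem_odd N)) (newGen_mem_odd (N + 1)), neg_mul,
      mul_neg, ← mul_assoc, ← mul_assoc, newGen_sq, zero_mul, zero_mul, neg_zero]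
  rw [even_mul_comm (eps_mem_even N) a, mul_assoc, ← mul_assoc (eps N), h, zero_mul, mul_zero]

theorem gbody_eps_mul (N : ℕ) (a : Lam (N + 1 + 1)) : gbody (eps N * a) = 0 := by
  rw [eps, mul_assoc, gbody_mul, newGen, gbody_iota, zero_mul]

/-- The two new generators are removed one at a time. Two are needed because an increment `ε a` must
have the parity of `a`, so that `ε` itself has to be even. -/
theorem eq_zero_of_eps_mul {N : ℕ} {a : Lam N}
    (h : eps N * lamIncl (N + 1) (lamIncl N a) = 0) : a = 0 := by
  rw [eps, mul_assoc, ← map_mul] at h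
  exact eq_zero_of_newGen_mul (eq_zero_of_newGen_mul h)

variable {ι κ : Type} [Fintype ι] [DecidableEq ι] [Fintype κ] [DecidableEq κ] {N : ℕ}
variable {D : Set (ℝ × (ι → ℝ))} {f : ℝ → SuperFun ι κ}

theorem hasDerivAt_eval_line (hf : SmoothFam D f) (hD : IsOpen D) {t : ℝ}
    {z v : PointSpace N ι κ} {s : ℝ} (hz : (t, (toPoint (z + s • v)).body) ∈ D) :
    HasDerivAt (fun s : ℝ => eval (f t) (toPoint (z + s • v)))
      ((∑ i, (v.1 i : Lam N) * eval (dEven (f t) i) (toPoint (z + s • v))) +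
        ∑ α, (v.2 α : Lam N) * eval (dOdd (f t) α) (toPoint (z + s • v))) s := by
  obtain ⟨L, hL, hL'⟩ := exists_hasStrictFDerivAt_eval hf hD hz
  have h1 : HasDerivAt (fun s : ℝ => (t, z + s • v)) ((0 : ℝ), v) s := by
    have := ((hasDerivAt_id s).smul_const v).const_add z
    rw [one_smul] at this
    exact (hasDerivAt_const s t).prodMk this
  have h2 := hL.hasFDerivAt.comp_hasDerivAt s h1
  rw [hL', zero_smul, zero_add] at h2
  exact h2

/-- The first order Taylor formula is exact for increments whose products vanish. -/
theorem eval_add_of_mul_eq_zero (hf : SmoothFam D f) (hD : IsOpen D) {t : ℝ}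
    {z v : PointSpace N ι κ} (hz : (t, (toPoint z).body) ∈ D) (hv : (toPoint v).body = 0)
    (hee : ∀ i j, (v.1 i : Lam N) * (v.1 j : Lam N) = 0)
    (heo : ∀ i α, (v.1 i : Lam N) * (v.2 α : Lam N) = 0)
    (hoe : ∀ α i, (v.2 α : Lam N) * (v.1 i : Lam N) = 0)
    (hoo : ∀ α β, (v.2 α : Lam N) * (v.2 β : Lam N) = 0) :
    eval (f t) (toPoint (z + v)) = eval (f t) (toPoint z) +
      ((∑ i, (v.1 i : Lam N) * eval (dEven (f t) i) (toPoint z)) +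
        ∑ α, (v.2 α : Lam N) * eval (dOdd (f t) α) (toPoint z)) := by
  have hb : ∀ s : ℝ, (t, (toPoint (z + s • v)).body) ∈ D := by
    intro s
    have : (toPoint (z + s • v)).body = (toPoint z).body := by
      rw [← bodyCLM_apply, map_add, map_smul, bodyCLM_apply, bodyCLM_apply, hv, smul_zero, add_zero]
    rwa [this]
  -- A factor that annihilates the increment does not see the displacement: the product has zero
  -- derivative along the line by the chain rule. No expansion of the Taylor sum is required.
  have key : ∀ (a : Lam N), (∀ i, a * (v.1 i : Lam N) = 0) → (∀ α, a * (v.2 α : Lam N) = 0) →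
      ∀ g : ℝ → SuperFun ι κ, SmoothFam D g → ∀ s : ℝ,
      a * eval (g t) (toPoint (z + s • v)) = a * eval (g t) (toPoint z) := by
    intro a ha1 ha2 g hg s
    have hd : ∀ s : ℝ, HasDerivAt (fun s : ℝ => mulCLM _ a (eval (g t) (toPoint (z + s • v)))) 0 s := by
      intro s
      have := (mulCLM _ a).hasFDerivAt.comp_hasDerivAt s (hasDerivAt_eval_line hg hD (hb s))
      rw [mulCLM_apply, mul_add, Finset.mul_sum, Finset.mul_sum] at this
      simp only [← mul_assoc, ha1, ha2, zero_mul, Finset.sum_const_zero, add_zero] at this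
      exact this
    have := is_const_of_deriv_eq_zero (fun s => (hd s).differentiableAt) (fun s => (hd s).deriv) s 0
    simpa only [mulCLM_apply, zero_smul, add_zero] using this
  set c := (∑ i, (v.1 i : Lam N) * eval (dEven (f t) i) (toPoint z)) +
        ∑ α, (v.2 α : Lam N) * eval (dOdd (f t) α) (toPoint z) with hc
  -- By `key`, applied with the coordinates of `v` as factors, the velocity along the line is the
  -- constant `c`.
  have hd : ∀ s : ℝ, HasDerivAt (fun s : ℝ => eval (f t) (toPoint (z + s • v)) - s • c) 0 s := by
    intro s
    have h1 := (hasDerivAt_eval_line hf hD (hb s)).sub ((hasDerivAt_id s).smul_const c)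
    have h2 : ∀ i, (v.1 i : Lam N) * eval (dEven (f t) i) (toPoint (z + s • v)) =
        (v.1 i : Lam N) * eval (dEven (f t) i) (toPoint z) :=
      fun i => key _ (hee i) (heo i) (fun t => dEven (f t) i) (hf.dEven hD i) s
    have h3 : ∀ α, (v.2 α : Lam N) * eval (dOdd (f t) α) (toPoint (z + s • v)) =
        (v.2 α : Lam N) * eval (dOdd (f t) α) (toPoint z) :=
      fun α => key _ (hoe α) (hoo α) (fun t => dOdd (f t) α) (hf.dOdd α) s
    simp only [h2, h3, ← hc, one_smul, sub_self] at h1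
    exact h1
  have := is_const_of_deriv_eq_zero (fun s => (hd s).differentiableAt) (fun s => (hd s).deriv) 1 0
  simp only [one_smul, zero_smul, add_zero, sub_zero] at this
  rw [← this]
  abel

end DualNumbers

section DualPoints

variable {ι κ : Type} [Fintype ι] [DecidableEq ι] [Fintype κ] [DecidableEq κ] {N : ℕ}

/-- The inclusion of `Λ_N`-points into `Λ_{N+2}`-points. -/
def inclPt₂ (N : ℕ) (ι κ : Type) [Fintype ι] [Fintype κ] :
    PointSpace N ι κ →L[ℝ] PointSpace (N + 1 + 1) ι κ :=
  (inclPt (N + 1) ι κ).comp (inclPt N ι κ)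

/-- The inclusion `Λ_N → Λ_{N+2}`. -/
def lamIncl₂ (N : ℕ) : Lam N →ₐ[ℝ] Lam (N + 1 + 1) := (lamIncl (N + 1)).comp (lamIncl N)

/-- Multiplication of a vector of coordinates by `eps`. -/
def epsPt (v : PointSpace N ι κ) : PointSpace (N + 1 + 1) ι κ :=
  (fun i => ⟨eps N * lamIncl₂ N (v.1 i),
      even_mul_even (eps_mem_even N) (lamIncl_mem_even (lamIncl_mem_even (v.1 i).2))⟩,
    fun α => ⟨eps N * lamIncl₂ N (v.2 α),
      even_mul_odd (eps_mem_even N) (lamIncl_mem_odd (lamIncl_mem_odd (v.2 α).2))⟩)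

theorem eq_zero_of_epsPt {v : PointSpace N ι κ} (h : epsPt v = 0) : v = 0 := by
  ext i
  · exact eq_zero_of_eps_mul (congrArg (fun u => (u.1 i : Lam (N + 1 + 1))) h)
  · exact eq_zero_of_eps_mul (congrArg (fun u => (u.2 i : Lam (N + 1 + 1))) h)

theorem epsPt_zero : epsPt (0 : PointSpace N ι κ) = 0 := by
  ext i
  · exact (congrArg (eps N * ·) (map_zero (lamIncl₂ N))).trans (mul_zero _)
  · exact (congrArg (eps N * ·) (map_zero (lamIncl₂ N))).trans (mul_zero _)

theorem body_epsPt (v : PointSpace N ι κ) : (toPoint (epsPt v)).body = 0 :=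
  funext fun _ => gbody_eps_mul N _

theorem body_inclPt₂ (v : PointSpace N ι κ) :
    (toPoint (inclPt₂ N ι κ v)).body = (toPoint v).body :=
  (body_inclPt _).trans (body_inclPt _)

theorem body_add_epsPt (z v : PointSpace N ι κ) :
    (toPoint (inclPt₂ N ι κ z + epsPt v)).body = (toPoint z).body := by
  rw [← bodyCLM_apply, map_add, bodyCLM_apply, bodyCLM_apply, body_epsPt, body_inclPt₂, add_zero]

theorem eval_inclPt₂ (g : SuperFun ι κ) (z : PointSpace N ι κ) :
    eval g (toPoint (inclPt₂ N ι κ z)) = lamIncl₂ N (eval g (toPoint z)) :=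
  (eval_inclPt _ _).trans (congrArg _ (eval_inclPt _ _))

/-- All products of coordinates of `epsPt v` contain `ε²`, so first order is exact: the coefficient
of `ε` is the derivative. -/
theorem eval_add_epsPt {D : Set (ℝ × (ι → ℝ))} {f : ℝ → SuperFun ι κ} (hf : SmoothFam D f)
    (hD : IsOpen D) {t : ℝ} {z v : PointSpace N ι κ} (hz : (t, (toPoint z).body) ∈ D) :
    eval (f t) (toPoint (inclPt₂ N ι κ z + epsPt v)) = lamIncl₂ N (eval (f t) (toPoint z)) +
      eps N * lamIncl₂ N ((∑ i, (v.1 i : Lam N) * eval (dEven (f t) i) (toPoint z)) +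
        ∑ α, (v.2 α : Lam N) * eval (dOdd (f t) α) (toPoint z)) := by
  rw [eval_add_of_mul_eq_zero hf hD (by rwa [body_inclPt₂]) (body_epsPt v)
    (fun _ _ => eps_mul_eps N _ _) (fun _ _ => eps_mul_eps N _ _) (fun _ _ => eps_mul_eps N _ _)
    (fun _ _ => eps_mul_eps N _ _), eval_inclPt₂]
  simp only [eval_inclPt₂, epsPt, map_add, map_sum, map_mul, mul_add, Finset.mul_sum, mul_assoc]

end DualPoints

section DualPhaseSpace

variable {N n m : ℕ} {D : Set (ℝ × (Ev n → ℝ))} {f : ℝ → SuperFun (Ev n) (Od m)}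

theorem pair_add_epsPt (x q a b : Vec N n m) :
    (toPoint (inclPt₂ N _ _ x + epsPt a)).pair (toPoint (inclPt₂ N _ _ q + epsPt b)) =
      toPoint (inclPt₂ N _ _ (pairCLM N n m (x, q)) + epsPt (pairCLM N n m (a, b))) := by
  have : pairCLM (N + 1 + 1) n m (inclPt₂ N _ _ x + epsPt a, inclPt₂ N _ _ q + epsPt b) =
      inclPt₂ N _ _ (pairCLM N n m (x, q)) + epsPt (pairCLM N n m (a, b)) := by
    ext i <;> rcases i with i | i <;> rfl
  rw [← this]
  rfl

theorem add_epsPt_mem {t : ℝ} {x q : Vec N n m} (a b : Vec N n m)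
    (hw : (t, x, q) ∈ pointDomain N D) :
    (t, inclPt₂ N _ _ x + epsPt a, inclPt₂ N _ _ q + epsPt b) ∈ pointDomain (N + 1 + 1) D := by
  change (t, ((toPoint (inclPt₂ N _ _ x + epsPt a)).pair
    (toPoint (inclPt₂ N _ _ q + epsPt b))).body) ∈ D
  rw [pair_add_epsPt, body_add_epsPt]
  exact hw

theorem eval_pair_add_epsPt (hf : SmoothFam D f) (hD : IsOpen D) {t : ℝ} {x q : Vec N n m}
    (a b : Vec N n m) (hw : (t, x, q) ∈ pointDomain N D) :
    eval (f t) ((toPoint (inclPt₂ N _ _ x + epsPt a)).pair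
      (toPoint (inclPt₂ N _ _ q + epsPt b))) = lamIncl₂ N (genVal f (t, x, q)) +
      eps N * lamIncl₂ N (fderiv ℝ (genVal f) (t, x, q) (0, a, b)) := by
  obtain ⟨L, hL, hL'⟩ := exists_hasStrictFDerivAt_pair hD hf hw
  rw [pair_add_epsPt, eval_add_epsPt hf hD (z := pairCLM N n m (x, q)) hw,
    hL.hasFDerivAt.fderiv, hL', zero_smul, zero_add]
  rfl

theorem differentiableAt_genVal (hf : SmoothFam D f) (hD : IsOpen D)
    {w : ℝ × Vec N n m × Vec N n m} (hw : w ∈ pointDomain N D) :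
    DifferentiableAt ℝ (genVal f) w := by
  obtain ⟨L, hL, -⟩ := exists_hasStrictFDerivAt_pair hD hf hw
  exact hL.hasFDerivAt.differentiableAt

/-- The even coordinates of a vector, with values in `Λ_N`. -/
def evCoord (N : ℕ) {n : ℕ} (m : ℕ) (i : Fin n) : Vec N n m →L[ℝ] Lam N :=
  (evenPart (Fin N)).subtypeL.comp
    ((ContinuousLinearMap.proj i).comp (ContinuousLinearMap.fst ℝ _ _))

/-- The odd coordinates of a vector, with values in `Λ_N`. -/
def odCoord (N n : ℕ) {m : ℕ} (α : Fin m) : Vec N n m →L[ℝ] Lam N :=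
  (oddPart (Fin N)).subtypeL.comp
    ((ContinuousLinearMap.proj α).comp (ContinuousLinearMap.snd ℝ _ _))

theorem fderiv_coord {F : Type*} [NormedAddCommGroup F] [NormedSpace ℝ F] {c : F →L[ℝ] Lam N}
    {g : ℝ → SuperFun (Ev n) (Od m)} {P : ℝ × Vec N n m × Vec N n m → F} (hD : IsOpen D)
    (hg : SmoothFam D g) (h : ∀ w ∈ pointDomain N D, genVal g w = c (P w))
    {w : ℝ × Vec N n m × Vec N n m} (hw : w ∈ pointDomain N D) (hP : DifferentiableAt ℝ P w)
    (u : ℝ × Vec N n m × Vec N n m) : fderiv ℝ (genVal g) w u = c (fderiv ℝ P w u) :=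
  fderiv_natural (J := ContinuousLinearMap.id ℝ _) (isOpen_pointDomain hD) h hw hP
    (differentiableAt_genVal hg hD hw) u

/-- Together with its analogue for `posVal`, this turns a solution of the linearised canonical
relations over `Λ_N` into an exact solution of the relations over `Λ_{N+2}`. -/
theorem EvenFam.momVal_add_epsPt (hf : EvenFam D f) {t : ℝ} {x q : Vec N n m} (a b : Vec N n m)
    (hw : (t, x, q) ∈ pointDomain N D) :
    momVal f (t, inclPt₂ N _ _ x + epsPt a, inclPt₂ N _ _ q + epsPt b) =
      inclPt₂ N _ _ (momVal f (t, x, q)) + epsPt (fderiv ℝ (momVal f) (t, x, q) (0, a, b)) := by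
  have hd := (hf.hasFDerivAt_momVal hw).differentiableAt
  refine vec_ext (fun i => ?_) (fun α => ?_)
  · have hg := hf.smooth.dEven hf.isOpen (Sum.inl i)
    rw [hf.momVal_fst (add_epsPt_mem a b hw)]
    refine (eval_pair_add_epsPt hg hf.isOpen a b hw).trans ?_
    rw [fderiv_coord (P := momVal f) (c := evCoord N m i) hf.isOpen hg (fun w h => (hf.momVal_fst h i).symm) hw hd,
      show genVal (fun t => dEven (f t) (Sum.inl i)) (t, x, q) = _ from (hf.momVal_fst hw i).symm]
    rfl
  · have hg := hf.smooth.dOdd (Sum.inl α)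
    rw [hf.momVal_snd (add_epsPt_mem a b hw)]
    refine (eval_pair_add_epsPt hg hf.isOpen a b hw).trans ?_
    rw [fderiv_coord (P := momVal f) (c := odCoord N n α) hf.isOpen hg (fun w h => (hf.momVal_snd h α).symm) hw hd,
      show genVal (fun t => dOdd (f t) (Sum.inl α)) (t, x, q) = _ from (hf.momVal_snd hw α).symm]
    rfl

theorem EvenFam.posVal_add_epsPt (hf : EvenFam D f) {t : ℝ} {x q : Vec N n m} (a b : Vec N n m)
    (hw : (t, x, q) ∈ pointDomain N D) :
    posVal f (t, inclPt₂ N _ _ x + epsPt a, inclPt₂ N _ _ q + epsPt b) =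
      inclPt₂ N _ _ (posVal f (t, x, q)) + epsPt (fderiv ℝ (posVal f) (t, x, q) (0, a, b)) := by
  have hd := (hf.hasFDerivAt_posVal hw).differentiableAt
  refine vec_ext (fun i => ?_) (fun α => ?_)
  · have hg := hf.smooth.dEven hf.isOpen (Sum.inr i)
    rw [hf.posVal_fst (add_epsPt_mem a b hw)]
    refine (eval_pair_add_epsPt hg hf.isOpen a b hw).trans ?_
    rw [fderiv_coord (P := posVal f) (c := evCoord N m i) hf.isOpen hg (fun w h => (hf.posVal_fst h i).symm) hw hd,
      show genVal (fun t => dEven (f t) (Sum.inr i)) (t, x, q) = _ from (hf.posVal_fst hw i).symm]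
    rfl
  · have hg := hf.smooth.dOdd (Sum.inr α)
    have hneg : ∀ w ∈ pointDomain N D, genVal (fun t => dOdd (f t) (Sum.inr α)) w =
        (-odCoord N n α) (posVal f w) := fun w h => by
      change _ = -((posVal f w).2 α : Lam N)
      rw [hf.posVal_snd h, neg_neg]
      rfl
    rw [hf.posVal_snd (add_epsPt_mem a b hw)]
    refine (congrArg Neg.neg (eval_pair_add_epsPt hg hf.isOpen a b hw)).trans ?_
    rw [fderiv_coord (P := posVal f) (c := -odCoord N n α) hf.isOpen hg hneg hw hd, hneg _ hw]
    have e : ∀ v : Vec N n m, (-odCoord N n α) v = -(v.2 α : Lam N) := fun _ => rfl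
    rw [e, e, map_neg, map_neg, mul_neg, neg_add, neg_neg, neg_neg]
    rfl

end DualPhaseSpace

/-! ### Values of the generating function of the identity. -/

section Identity

variable {ι κ : Type} [Fintype ι] [DecidableEq ι] [Fintype κ] [DecidableEq κ] {N : ℕ}

theorem smoothFam_univ {g : SuperFun ι κ} (hg : ContDiff ℝ ∞ g) :
    SmoothFam (Set.univ : Set (ℝ × (ι → ℝ))) (fun _ => g) :=
  (hg.comp contDiff_snd).contDiffOn

theorem taylorTerm_succ_eq_zero (k : ℕ) {g : SuperFun ι κ} (hg : ContDiff ℝ ∞ g)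
    (z : SuperPoint N ι κ) (h : ∀ i, gsoul (z.ev i : Lam N) = 0 ∨ dEven g i = fun _ => 0) :
    taylorTerm (k + 1) g z = 0 := by
  have h0 : ∀ k, taylorTerm k (fun _ => 0 : SuperFun ι κ) z = 0 := by
    intro k
    simp [taylorTerm, iteratedFDeriv_fun_zero]
  rw [taylorTerm_succ hg.contDiffAt]
  refine Finset.sum_eq_zero fun i _ => ?_
  rcases h i with h | h
  · rw [h, zero_mul]
  · rw [h, h0, mul_zero]

theorem eval_eq_substOdd {g : SuperFun ι κ} (hg : ContDiff ℝ ∞ g)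
    (z : SuperPoint N ι κ) (h : ∀ i, gsoul (z.ev i : Lam N) = 0 ∨ dEven g i = fun _ => 0) :
    eval g z = substOdd z.od (g z.body) := by
  rw [eval_eq_sum_taylorTerm, Finset.sum_range_succ', Finset.sum_eq_zero, zero_add, taylorTerm_zero]
  · simp
  · intro k _
    rw [taylorTerm_succ_eq_zero k hg z h, smul_zero]

theorem eval_const (c : Grassmann κ) (z : SuperPoint N ι κ) :
    eval (fun _ => c : SuperFun ι κ) z = substOdd z.od c :=
  eval_eq_substOdd contDiff_const z fun i => Or.inr (by
    funext b
    simp [dEven])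

/-- A superfunction with known derivatives along the ray from the origin. -/
theorem eval_eq_of_hasDerivAt {g : SuperFun ι κ} (hg : ContDiff ℝ ∞ g) (z : PointSpace N ι κ)
    {φ : ℝ → Lam N} (h0 : φ 0 = substOdd (0 : κ → oddPart (Fin N)) (g 0))
    (hφ : ∀ s : ℝ, HasDerivAt φ ((∑ i, (z.1 i : Lam N) * eval (dEven g i) (toPoint (s • z))) +
        ∑ α, (z.2 α : Lam N) * eval (dOdd g α) (toPoint (s • z))) s) :
    eval g (toPoint z) = φ 1 := by
  -- Both functions have the velocity prescribed by the chain rule, and they agree at the origin,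
  -- where souls and odd coordinates vanish.
  have hd : ∀ s : ℝ, HasDerivAt (fun s : ℝ => eval g (toPoint (0 + s • z)) - φ s) 0 s := by
    intro s
    have h1 := hasDerivAt_eval_line (z := 0) (v := z) (t := 0) (s := s) (smoothFam_univ hg)
      isOpen_univ (Set.mem_univ _)
    have h2 := h1.sub (hφ s)
    rw [zero_add, sub_self] at h2
    exact h2
  have h3 := is_const_of_deriv_eq_zero (fun s => (hd s).differentiableAt)
    (fun s => (hd s).deriv) 1 0
  have hs : ∀ i, gsoul ((toPoint (0 : PointSpace N ι κ)).ev i : Lam N) = 0 := by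
    intro i
    simp [toPoint, gsoul, gbody]
  have h4 : eval g (toPoint (0 : PointSpace N ι κ)) = φ 0 := by
    rw [h0, eval_eq_substOdd hg _ fun i => Or.inl (hs i), ← bodyCLM_apply, map_zero]
    rfl
  simp only [one_smul, zero_smul, add_zero, zero_add, h4, sub_self] at h3
  exact sub_eq_zero.mp h3

theorem contDiff_coord (j : ι) :
    ContDiff ℝ ∞ (fun b : ι → ℝ => algebraMap ℝ (Grassmann κ) (b j)) :=
  ((LinearMap.toContinuousLinearMap (Algebra.linearMap ℝ (Grassmann κ))).comp
    (ContinuousLinearMap.proj j : (ι → ℝ) →L[ℝ] ℝ)).contDiff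

theorem eval_coord (j : ι) (z : PointSpace N ι κ) :
    eval (fun b => algebraMap ℝ (Grassmann κ) (b j)) (toPoint z) = z.1 j := by
  have hE : ∀ i, dEven (fun b : ι → ℝ => algebraMap ℝ (Grassmann κ) (b j)) i =
      fun _ => algebraMap ℝ (Grassmann κ) (if i = j then 1 else 0) := by
    intro i
    funext b
    have : HasFDerivAt (fun b : ι → ℝ => algebraMap ℝ (Grassmann κ) (b j)) _ b :=
      ((LinearMap.toContinuousLinearMap (Algebra.linearMap ℝ (Grassmann κ))).comp
        (ContinuousLinearMap.proj j : (ι → ℝ) →L[ℝ] ℝ)).hasFDerivAt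
    rw [dEven, this.fderiv]
    simp [Pi.single_apply, eq_comm]
  have hO : ∀ α, dOdd (fun b : ι → ℝ => algebraMap ℝ (Grassmann κ) (b j)) α = fun _ => 0 := by
    intro α
    funext b
    exact CliffordAlgebra.contractLeft_algebraMap _ _ _
  rw [eval_eq_of_hasDerivAt (contDiff_coord j) z (φ := fun s => s • (z.1 j : Lam N)), one_smul]
  · simp
  · intro s
    simp only [hE, hO, eval_const, AlgHom.commutes, map_zero, mul_zero, Finset.sum_const_zero,
      add_zero]
    have hd := (hasDerivAt_id s).smul_const (z.1 j : Lam N)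
    rw [one_smul] at hd
    refine hd.congr_deriv ?_
    rw [Finset.sum_eq_single j]
    · simp
    · intro i _ hi
      simp [hi]
    · simp

end Identity

section IdentityGenerator

variable {N n m : ℕ}

theorem hasFDerivAt_dot (b : Ev n → ℝ) :
    HasFDerivAt (fun b : Ev n → ℝ => ∑ i, b (Sum.inl i) * b (Sum.inr i))
      (∑ i, (b (Sum.inl i) • (ContinuousLinearMap.proj (Sum.inr i) : (Ev n → ℝ) →L[ℝ] ℝ) +
        b (Sum.inr i) • (ContinuousLinearMap.proj (Sum.inl i) : (Ev n → ℝ) →L[ℝ] ℝ))) b :=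
  HasFDerivAt.fun_sum fun i _ =>
    (ContinuousLinearMap.proj (R := ℝ) (φ := fun _ : Ev n => ℝ) (Sum.inl i)).hasFDerivAt.mul
      (ContinuousLinearMap.proj (R := ℝ) (φ := fun _ : Ev n => ℝ) (Sum.inr i)).hasFDerivAt

theorem hasFDerivAt_idGen (b : Ev n → ℝ) : HasFDerivAt (idGen n m)
    ((LinearMap.toContinuousLinearMap (Algebra.linearMap ℝ (Grassmann (Od m)))).comp
      (∑ i, (b (Sum.inl i) • (ContinuousLinearMap.proj (Sum.inr i) : (Ev n → ℝ) →L[ℝ] ℝ) +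
        b (Sum.inr i) • (ContinuousLinearMap.proj (Sum.inl i) : (Ev n → ℝ) →L[ℝ] ℝ)))) b :=
  ((LinearMap.toContinuousLinearMap (Algebra.linearMap ℝ (Grassmann (Od m)))).hasFDerivAt.comp b
    (hasFDerivAt_dot b)).add_const _

theorem contDiff_idGen : ContDiff ℝ ∞ (idGen n m) := by
  have h1 : ContDiff ℝ ∞ (fun b : Ev n → ℝ => ∑ i, b (Sum.inl i) * b (Sum.inr i)) :=
    ContDiff.sum fun i _ => (contDiff_apply ℝ ℝ _).mul (contDiff_apply ℝ ℝ _)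
  exact ((LinearMap.toContinuousLinearMap
    (Algebra.linearMap ℝ (Grassmann (Od m)))).contDiff.comp h1).add contDiff_const

theorem dEven_idGen_inl (i : Fin n) : dEven (idGen n m) (Sum.inl i) =
    fun b => algebraMap ℝ (Grassmann (Od m)) (b (Sum.inr i)) := by
  funext b
  rw [dEven, (hasFDerivAt_idGen b).fderiv]
  simp [Pi.single_apply]

theorem dEven_idGen_inr (i : Fin n) : dEven (idGen n m) (Sum.inr i) =
    fun b => algebraMap ℝ (Grassmann (Od m)) (b (Sum.inl i)) := by
  funext b
  rw [dEven, (hasFDerivAt_idGen b).fderiv]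
  simp [Pi.single_apply]

theorem contract_idGen (d : Module.Dual ℝ (Od m → ℝ)) (b : Ev n → ℝ) :
    CliffordAlgebra.contractLeft (Q := (0 : QuadraticForm ℝ (Od m → ℝ))) d (idGen n m b) =
      ∑ β : Fin m, (d (Pi.single (Sum.inl β) 1) •
          ExteriorAlgebra.ι ℝ (Pi.single (Sum.inr β) (1 : ℝ) : Od m → ℝ) -
        d (Pi.single (Sum.inr β) 1) •
          ExteriorAlgebra.ι ℝ (Pi.single (Sum.inl β) (1 : ℝ) : Od m → ℝ)) := by
  have h0 : CliffordAlgebra.contractLeft (Q := (0 : QuadraticForm ℝ (Od m → ℝ))) d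
      (algebraMap ℝ (Grassmann (Od m)) (∑ i, b (Sum.inl i) * b (Sum.inr i))) = 0 :=
    CliffordAlgebra.contractLeft_algebraMap _ _ _
  rw [idGen, map_add, h0, zero_add, map_sum]
  refine Finset.sum_congr rfl fun β _ => ?_
  refine (CliffordAlgebra.contractLeft_ι_mul _ _ _).trans ?_
  have h1 : CliffordAlgebra.contractLeft (Q := (0 : QuadraticForm ℝ (Od m → ℝ))) d
      (ExteriorAlgebra.ι ℝ (Pi.single (Sum.inr β) (1 : ℝ) : Od m → ℝ)) =
        algebraMap ℝ _ (d (Pi.single (Sum.inr β) 1)) := CliffordAlgebra.contractLeft_ι _ _ _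
  rw [h1, ← Algebra.commutes, ← Algebra.smul_def]

theorem dOdd_idGen_inl (α : Fin m) : dOdd (idGen n m) (Sum.inl α) =
    fun _ => ExteriorAlgebra.ι ℝ (Pi.single (Sum.inr α) (1 : ℝ) : Od m → ℝ) := by
  funext b
  rw [dOdd, contract_idGen, Finset.sum_eq_single α]
  · simp
  · intro β _ hβ
    simp [hβ.symm]
  · simp

theorem dOdd_idGen_inr (α : Fin m) : dOdd (idGen n m) (Sum.inr α) =
    fun _ => -ExteriorAlgebra.ι ℝ (Pi.single (Sum.inl α) (1 : ℝ) : Od m → ℝ) := by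
  funext b
  rw [dOdd, contract_idGen, Finset.sum_eq_single α]
  · simp
  · intro β _ hβ
    simp [hβ.symm]
  · simp

theorem substOdd_iota_single {κ : Type} [Fintype κ] [DecidableEq κ] (θ : κ → oddPart (Fin N))
    (α : κ) : substOdd θ (ExteriorAlgebra.ι ℝ (Pi.single α (1 : ℝ) : κ → ℝ)) = θ α := by
  rw [substOdd_iota, Finset.sum_eq_single α]
  · simp
  · intro β _ hβ
    simp [hβ]
  · simp

theorem eval_dEven_idGen_inl (v : PointSpace N (Ev n) (Od m)) (i : Fin n) :
    eval (dEven (idGen n m) (Sum.inl i)) (toPoint v) = v.1 (Sum.inr i) := by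
  rw [dEven_idGen_inl, eval_coord]

theorem eval_dEven_idGen_inr (v : PointSpace N (Ev n) (Od m)) (i : Fin n) :
    eval (dEven (idGen n m) (Sum.inr i)) (toPoint v) = v.1 (Sum.inl i) := by
  rw [dEven_idGen_inr, eval_coord]

theorem eval_dOdd_idGen_inl (v : PointSpace N (Ev n) (Od m)) (α : Fin m) :
    eval (dOdd (idGen n m) (Sum.inl α)) (toPoint v) = v.2 (Sum.inr α) := by
  rw [dOdd_idGen_inl, eval_const, substOdd_iota_single]
  rfl

theorem eval_dOdd_idGen_inr (v : PointSpace N (Ev n) (Od m)) (α : Fin m) :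
    eval (dOdd (idGen n m) (Sum.inr α)) (toPoint v) = -(v.2 (Sum.inl α) : Lam N) := by
  rw [dOdd_idGen_inr, eval_const, map_neg, substOdd_iota_single]
  rfl

theorem eval_idGen (x q : Vec N n m) :
    eval (idGen n m) (toPoint (pairCLM N n m (x, q))) = pairing N n m x q := by
  rw [eval_eq_of_hasDerivAt contDiff_idGen (pairCLM N n m (x, q))
    -- The contraction is quadratic in `(x, q)` jointly, so along the ray it scales by `s ^ 2`; the
    -- derivatives in `x` and in `q` each contribute half of the velocity.
    (φ := fun s => (s ^ 2) • pairing N n m x q)]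
  · simp
  · simp [idGen, substOdd_iota]
  · intro s
    have hd := ((hasDerivAt_id s).pow 2).smul_const (pairing N n m x q)
    refine hd.congr_deriv ?_
    rw [Fintype.sum_sum_type, Fintype.sum_sum_type]
    simp only [eval_dEven_idGen_inl, eval_dEven_idGen_inr, eval_dOdd_idGen_inl,
      eval_dOdd_idGen_inr]
    change _ = (∑ i, (x.1 i : Lam N) * (s • (q.1 i : Lam N)) +
      ∑ i, (q.1 i : Lam N) * (s • (x.1 i : Lam N))) +
      (∑ i, (x.2 i : Lam N) * (s • (q.2 i : Lam N)) +
      ∑ i, (q.2 i : Lam N) * -(s • (x.2 i : Lam N)))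
    have e1 : ∀ i, (q.1 i : Lam N) * (x.1 i : Lam N) = (x.1 i : Lam N) * (q.1 i : Lam N) :=
      fun i => even_mul_comm (q.1 i).2 _
    have e2 : ∀ i, (q.2 i : Lam N) * (x.2 i : Lam N) = -((x.2 i : Lam N) * (q.2 i : Lam N)) :=
      fun i => odd_mul_odd _ _ (q.2 i).2 (x.2 i).2
    simp only [mul_neg, mul_smul_comm, e1, e2, smul_neg, neg_neg, ← Finset.smul_sum]
    rw [pairing_apply, contract]
    simp only [toPoint, id, Nat.cast_ofNat, mul_one, Nat.add_one_sub_one, pow_one, two_mul,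
      add_smul, smul_add]

end IdentityGenerator

/-! ### Group law at `Λ_N`-points and nondegeneracy. -/

section Group

variable {N n m : ℕ} {D : Set (ℝ × (Ev n → ℝ))} {S : ℝ → SuperFun (Ev n) (Od m)}
  {H : SuperFun (Ev n) (Od m)}

theorem IsThickGroup.evenFam (hS : IsThickGroup D S H) : EvenFam D S :=
  ⟨hS.isOpen, hS.smooth, fun w hw => hS.even w.1 w.2 hw⟩

/-- The domain of the Hamiltonian as a constant family. -/
def hamDomain (D : Set (ℝ × (Ev n → ℝ))) : Set (ℝ × (Ev n → ℝ)) := {w | (0, w.2) ∈ D}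

theorem IsThickGroup.hamiltonian_eq (hS : IsThickGroup D S H) {z : Ev n → ℝ}
    (hz : z ∈ slice D 0) : H z = dTime S 0 z := by
  have h1 : HasFDerivAt (fun w : ℝ × (Ev n → ℝ) => S w.1 w.2) _ (0, z) :=
    ((SmoothFam.contDiffAt hS.smooth hS.isOpen hz).differentiableAt (by simp)).hasFDerivAt
  have h2 := h1.comp_hasDerivAt (0 : ℝ) (f := fun t : ℝ => (t, z))
    ((hasDerivAt_id (0 : ℝ)).prodMk (hasDerivAt_const (0 : ℝ) z))
  exact (hS.generator z hz).unique h2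

/-- On the slice at time `0` the Hamiltonian is the time derivative of `S`, from which it inherits
smoothness and evenness. -/
theorem IsThickGroup.hamFam (hS : IsThickGroup D S H) : EvenFam (hamDomain D) (fun _ => H) := by
  have hfam := hS.evenFam
  have heq : ∀ w ∈ hamDomain D, H w.2 = dTime S 0 w.2 := fun w hw => hS.hamiltonian_eq hw
  refine ⟨hS.isOpen.preimage (continuous_const.prodMk continuous_snd), ?_, ?_⟩
  · refine ContDiffOn.congr (f := fun w : ℝ × (Ev n → ℝ) => dTime S 0 w.2) ?_ heq
    exact (hfam.smooth.dTime hfam.isOpen).comp (f := fun w : ℝ × (Ev n → ℝ) => ((0 : ℝ), w.2))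
      (contDiff_const.prodMk contDiff_snd).contDiffOn fun w hw => hw
  · intro w hw
    rw [heq w hw]
    exact fderiv_apply_mem (g := fun w : ℝ × (Ev n → ℝ) => S w.1 w.2) _ hfam.isOpen hfam.even hw
      ((hfam.smooth.contDiffAt hfam.isOpen hw).differentiableAt (by simp)) _

theorem IsThickGroup.timeVal_zero (hS : IsThickGroup D S H) (s : ℝ) {x q : Vec N n m}
    (hw : (0, x, q) ∈ pointDomain N D) :
    timeVal S (0, x, q) = genVal (fun _ => H) (s, x, q) :=
  eval_congr_of_eqOn (isOpen_sliceSet hS.isOpen 0) hw fun _ hz => (hS.hamiltonian_eq hz).symm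

theorem dEven_eqOn {ι κ : Type} [Fintype ι] [DecidableEq ι] [Fintype κ] {f g : SuperFun ι κ}
    {U : Set (ι → ℝ)} (hU : IsOpen U) (h : Set.EqOn f g U) (i : ι) :
    Set.EqOn (dEven f i) (dEven g i) U := fun _ hb =>
  DFunLike.congr_fun (fderiv_congr_of_eqOn hU hb h) _

theorem dOdd_eqOn {ι κ : Type} [DecidableEq κ] {f g : SuperFun ι κ}
    {U : Set (ι → ℝ)} (h : Set.EqOn f g U) (α : κ) :
    Set.EqOn (dOdd f α) (dOdd g α) U := fun _ hb => congrArg _ (h hb)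

theorem IsThickGroup.genVal_zero (hS : IsThickGroup D S H) {x q : Vec N n m}
    (hw : (0, x, q) ∈ pointDomain N D) : genVal S (0, x, q) = pairing N n m x q :=
  (eval_congr_of_eqOn (isOpen_sliceSet hS.isOpen 0) hw hS.zero).trans (eval_idGen x q)

theorem IsThickGroup.momVal_zero (hS : IsThickGroup D S H) {x q : Vec N n m}
    (hw : (0, x, q) ∈ pointDomain N D) : momVal S (0, x, q) = q := by
  have hU := isOpen_sliceSet hS.isOpen 0
  refine vec_ext (fun i => ?_) (fun α => ?_)
  · rw [hS.evenFam.momVal_fst hw]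
    exact (eval_congr_of_eqOn hU hw (dEven_eqOn hU hS.zero _)).trans
      (eval_dEven_idGen_inl (pairCLM N n m (x, q)) i)
  · rw [hS.evenFam.momVal_snd hw]
    exact (eval_congr_of_eqOn hU hw (dOdd_eqOn hS.zero _)).trans
      (eval_dOdd_idGen_inl (pairCLM N n m (x, q)) α)

theorem IsThickGroup.posVal_zero (hS : IsThickGroup D S H) {x q : Vec N n m}
    (hw : (0, x, q) ∈ pointDomain N D) : posVal S (0, x, q) = x := by
  have hU := isOpen_sliceSet hS.isOpen 0
  refine vec_ext (fun i => ?_) (fun α => ?_)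
  · rw [hS.evenFam.posVal_fst hw]
    exact (eval_congr_of_eqOn hU hw (dEven_eqOn hU hS.zero _)).trans
      (eval_dEven_idGen_inr (pairCLM N n m (x, q)) i)
  · rw [hS.evenFam.posVal_snd hw]
    refine (congrArg Neg.neg ((eval_congr_of_eqOn hU hw (dOdd_eqOn hS.zero _)).trans
      (eval_dOdd_idGen_inr (pairCLM N n m (x, q)) α))).trans ?_
    rw [neg_neg]
    rfl

/-- The intermediate points of a composition, in terms of vectors of coordinates. -/
def Intermediate (D : Set (ℝ × (Ev n → ℝ))) (S : ℝ → SuperFun (Ev n) (Od m)) (t s : ℝ)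
    (x r y q : Vec N n m) : Prop :=
  (s, x, q) ∈ pointDomain N D ∧ (t, y, r) ∈ pointDomain N D ∧ q = momVal S (t, y, r) ∧
    y = posVal S (s, x, q)

theorem IsThickGroup.isIntermediate_iff (hS : IsThickGroup D S H) {t s : ℝ}
    {x r y q : Vec N n m} :
    IsIntermediate (slice D t) (S t) (slice D s) (S s) (toPoint x) (toPoint r) (toPoint y)
      (toPoint q) ↔ Intermediate D S t s x r y q := by
  constructor
  · rintro ⟨h1, h2, h3, h4⟩
    exact ⟨h1, h2, (hS.evenFam.momentumEq_iff h2).1 h3, (hS.evenFam.positionEq_iff h1).1 h4⟩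
  · rintro ⟨h1, h2, h3, h4⟩
    exact ⟨h1, h2, (hS.evenFam.momentumEq_iff h2).2 h3, (hS.evenFam.positionEq_iff h1).2 h4⟩

theorem IsThickGroup.exists_intermediate (hS : IsThickGroup D S H) {t s : ℝ} (hts : 0 ≤ t * s)
    {x r : Vec N n m} (hw : (t + s, x, r) ∈ pointDomain N D) :
    ∃ y q, Intermediate D S t s x r y q := by
  obtain ⟨⟨⟨y, q⟩, h, -⟩, -⟩ := hS.add t s hts N (toPoint x) (toPoint r) hw
  exact ⟨(y.ev, y.od), (q.ev, q.od), hS.isIntermediate_iff.1 h⟩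

theorem IsThickGroup.intermediate_unique (hS : IsThickGroup D S H) {t s : ℝ} (hts : 0 ≤ t * s)
    {x r y q y' q' : Vec N n m} (hw : (t + s, x, r) ∈ pointDomain N D)
    (h : Intermediate D S t s x r y q) (h' : Intermediate D S t s x r y' q') :
    y = y' ∧ q = q' := by
  have hu := (hS.add t s hts N (toPoint x) (toPoint r) hw).1.unique
    (y₁ := (toPoint y, toPoint q)) (y₂ := (toPoint y', toPoint q'))
    (hS.isIntermediate_iff.2 h) (hS.isIntermediate_iff.2 h')
  have h1 : toPoint y = toPoint y' := congrArg Prod.fst hu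
  have h2 : toPoint q = toPoint q' := congrArg Prod.snd hu
  exact ⟨Prod.ext (congrArg SuperPoint.ev h1) (congrArg SuperPoint.od h1),
    Prod.ext (congrArg SuperPoint.ev h2) (congrArg SuperPoint.od h2)⟩

theorem IsThickGroup.genVal_add (hS : IsThickGroup D S H) {t s : ℝ} (hts : 0 ≤ t * s)
    {x r y q : Vec N n m} (hw : (t + s, x, r) ∈ pointDomain N D)
    (h : Intermediate D S t s x r y q) :
    genVal S (t + s, x, r) = genVal S (t, y, r) + genVal S (s, x, q) - pairing N n m y q :=
  (hS.add t s hts N (toPoint x) (toPoint r) hw).2 _ _ (hS.isIntermediate_iff.2 h)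

/-- The equations for the intermediate points of a composition are nondegenerate. -/
theorem IsThickGroup.nondegenerate (hS : IsThickGroup D S H) {t s : ℝ} (hts : 0 ≤ t * s)
    {x r y q : Vec N n m} (hw : (t + s, x, r) ∈ pointDomain N D)
    (h : Intermediate D S t s x r y q) {a b : Vec N n m}
    (ha : a = fderiv ℝ (posVal S) (s, x, q) (0, 0, b))
    (hb : b = fderiv ℝ (momVal S) (t, y, r) (0, a, 0)) : a = 0 ∧ b = 0 := by
  have hfam := hS.evenFam
  obtain ⟨h1, h2, h3, h4⟩ := h
  -- A solution of the linearised equations displaces the intermediate point by `ε` times itself,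
  -- without changing its endpoints `x` and `r`. Uniqueness over `Λ_{N+2}`, applied to this point
  -- and to the undisplaced one, forces the displacement to vanish.
  have key : ∀ a b : Vec N n m, a = fderiv ℝ (posVal S) (s, x, q) (0, 0, b) →
      b = fderiv ℝ (momVal S) (t, y, r) (0, a, 0) →
      Intermediate D S t s (inclPt₂ N _ _ x + epsPt 0) (inclPt₂ N _ _ r + epsPt 0)
        (inclPt₂ N _ _ y + epsPt a) (inclPt₂ N _ _ q + epsPt b) := by
    intro a b ha hb
    refine ⟨add_epsPt_mem 0 b h1, add_epsPt_mem a 0 h2, ?_, ?_⟩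
    · rw [hfam.momVal_add_epsPt a 0 h2, ← hb, ← h3]
    · rw [hfam.posVal_add_epsPt 0 b h1, ← ha, ← h4]
  have h0 := key 0 0 (by rw [show ((0, 0, 0) : ℝ × Vec N n m × Vec N n m) = 0 from rfl, map_zero])
    (by rw [show ((0, 0, 0) : ℝ × Vec N n m × Vec N n m) = 0 from rfl, map_zero])
  obtain ⟨e1, e2⟩ := hS.intermediate_unique hts (add_epsPt_mem 0 0 hw) (key a b ha hb) h0
  rw [epsPt_zero] at e1 e2
  exact ⟨eq_zero_of_epsPt (add_left_cancel e1), eq_zero_of_epsPt (add_left_cancel e2)⟩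

end Group

/-! ### The path of intermediate points and the Hamilton–Jacobi equations. -/

/-- The implicit function theorem for the equations `y = Y(s, x, q)`, `q = P(t - s, y, r)`. -/
theorem exists_implicit_of_nondegenerate {V : Type*} [NormedAddCommGroup V] [NormedSpace ℝ V]
    [FiniteDimensional ℝ V] {Y P : ℝ × V × V → V} {Y' P' : ℝ × V × V →L[ℝ] V} {t s : ℝ}
    {x r y q : V} (hY : HasStrictFDerivAt Y Y' (s, x, q)) (hP : HasStrictFDerivAt P P' (t - s, y, r))
    (hy : y = Y (s, x, q)) (hq : q = P (t - s, y, r))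
    (hnd : ∀ a b, a = Y' (0, 0, b) → b = P' (0, a, 0) → a = 0 ∧ b = 0) :
    ∃ ψ : ℝ → V × V, ψ s = (y, q) ∧ DifferentiableAt ℝ ψ s ∧
      ∀ᶠ u in 𝓝 s, (ψ u).1 = Y (u, x, (ψ u).2) ∧ (ψ u).2 = P (t - u, (ψ u).1, r) := by
  have : CompleteSpace V := FiniteDimensional.complete ℝ V
  let A : ℝ × V × V →L[ℝ] ℝ × V × V :=
    (ContinuousLinearMap.fst ℝ ℝ (V × V)).prod ((0 : ℝ × V × V →L[ℝ] V).prod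
      ((ContinuousLinearMap.snd ℝ V V).comp (ContinuousLinearMap.snd ℝ ℝ (V × V))))
  let B : ℝ × V × V →L[ℝ] ℝ × V × V :=
    (-ContinuousLinearMap.fst ℝ ℝ (V × V)).prod (((ContinuousLinearMap.fst ℝ V V).comp
      (ContinuousLinearMap.snd ℝ ℝ (V × V))).prod (0 : ℝ × V × V →L[ℝ] V))
  have hA : HasStrictFDerivAt (fun w : ℝ × V × V => (w.1, x, w.2.2)) A (s, y, q) := by
    have := (A.hasStrictFDerivAt (x := (s, y, q))).add_const ((0, x, 0) : ℝ × V × V)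
    refine this.congr_of_eventuallyEq (.of_forall fun w => ?_)
    simp [A]
  have hB : HasStrictFDerivAt (fun w : ℝ × V × V => (t - w.1, w.2.1, r)) B (s, y, q) := by
    have := (B.hasStrictFDerivAt (x := (s, y, q))).add_const ((t, 0, r) : ℝ × V × V)
    refine this.congr_of_eventuallyEq (.of_forall fun w => ?_)
    simp [B, sub_eq_neg_add]
  have hYA := HasStrictFDerivAt.comp (g := Y) (s, y, q) hY hA
  have hPB := HasStrictFDerivAt.comp (g := P) (s, y, q) hP hB
  have hid : HasStrictFDerivAt (fun w : ℝ × V × V => w.2) (ContinuousLinearMap.snd ℝ ℝ (V × V))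
    (s, y, q) := (ContinuousLinearMap.snd ℝ ℝ (V × V)).hasStrictFDerivAt
  have hF := hid.sub (hYA.prodMk hPB)
  set F : ℝ × V × V → V × V := fun w => w.2 - (Y (w.1, x, w.2.2), P (t - w.1, w.2.1, r)) with hFdef
  set F' := ContinuousLinearMap.snd ℝ ℝ (V × V) - (Y'.comp A).prod (P'.comp B)
  have hF : HasStrictFDerivAt F F' (s, y, q) := hF
  -- The kernel of the partial differential in `(y, q)` consists of the solutions of the linearised
  -- equations; in finite dimension injectivity gives invertibility.
  have hinj : Function.Injective (F'.comp (ContinuousLinearMap.inr ℝ ℝ (V × V))) := by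
    rw [injective_iff_map_eq_zero]
    rintro ⟨a, b⟩ h
    have h1 : (a, b) - (Y' (0, 0, b), P' (-0, a, 0)) = 0 := h
    rw [neg_zero, sub_eq_zero, Prod.mk.injEq] at h1
    obtain ⟨ha, hb⟩ := hnd a b h1.1 h1.2
    rw [ha, hb]
    rfl
  have hinv : (F'.comp (ContinuousLinearMap.inr ℝ ℝ (V × V))).IsInvertible :=
    ⟨(LinearEquiv.ofInjectiveEndo _ hinj).toContinuousLinearEquiv, by
      ext v <;> rfl⟩
  have h0 : F (s, y, q) = 0 := by
    simp only [hFdef]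
    rw [← hy, ← hq, sub_self]
  refine ⟨hF.implicitFunctionOfProdDomain hinv, ?_,
    (hF.hasStrictFDerivAt_implicitFunctionOfProdDomain hinv).hasFDerivAt.differentiableAt, ?_⟩
  · exact (hF.eventually_apply_eq_iff_implicitFunctionOfProdDomain hinv).self_of_nhds.1 rfl
  · filter_upwards [hF.eventually_apply_implicitFunctionOfProdDomain hinv] with u hu
    rw [h0] at hu
    have := sub_eq_zero.1 hu
    exact ⟨congrArg Prod.fst this, congrArg Prod.snd this⟩

theorem sub_mul_nonneg_of_mem_uIcc {t s : ℝ} (hs : s ∈ Set.uIcc 0 t) : 0 ≤ (t - s) * s := by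
  rcases Set.mem_uIcc.1 hs with ⟨h1, h2⟩ | ⟨h1, h2⟩
  · exact mul_nonneg (sub_nonneg.2 h2) h1
  · exact mul_nonneg_of_nonpos_of_nonpos (sub_nonpos.2 h1) h2

theorem uniqueDiffWithinAt_uIcc {t s : ℝ} (ht : t ≠ 0) (hs : s ∈ Set.uIcc 0 t) :
    UniqueDiffWithinAt ℝ (Set.uIcc 0 t) s :=
  uniqueDiffOn_Icc (by rcases ht.lt_or_gt with h | h <;> simp [h]) s hs

section Group

variable {N n m : ℕ} {D : Set (ℝ × (Ev n → ℝ))} {S : ℝ → SuperFun (Ev n) (Od m)}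
  {H : SuperFun (Ev n) (Od m)}

/-- The intermediate points of all decompositions of `Φ_t` form a differentiable path. -/
theorem IsThickGroup.exists_intermediate_path (hS : IsThickGroup D S H) {t : ℝ} {x r : Vec N n m}
    (hw : (t, x, r) ∈ pointDomain N D) :
    ∃ y q : ℝ → Vec N n m, ∀ s ∈ Set.uIcc 0 t, Intermediate D S (t - s) s x r (y s) (q s) ∧
      DifferentiableWithinAt ℝ y (Set.uIcc 0 t) s ∧
      DifferentiableWithinAt ℝ q (Set.uIcc 0 t) s := by
  have hfam := hS.evenFam
  have hw' : ∀ s, (t - s + s, x, r) ∈ pointDomain N D := fun s => by rwa [sub_add_cancel]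
  have hex : ∀ s : ℝ, ∃ yq : Vec N n m × Vec N n m, s ∈ Set.uIcc 0 t →
      Intermediate D S (t - s) s x r yq.1 yq.2 := by
    intro s
    by_cases hs : s ∈ Set.uIcc 0 t
    · obtain ⟨y, q, h⟩ := hS.exists_intermediate (sub_mul_nonneg_of_mem_uIcc hs) (hw' s)
      exact ⟨(y, q), fun _ => h⟩
    · exact ⟨0, fun h => absurd h hs⟩
  choose z hz using hex
  have hdiff : ∀ s ∈ Set.uIcc 0 t, DifferentiableWithinAt ℝ z (Set.uIcc 0 t) s := by
    intro s hs
    obtain ⟨h1, h2, h3, h4⟩ := hz s hs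
    obtain ⟨Y', hY'⟩ := hfam.exists_posVal h1
    obtain ⟨P', hP'⟩ := hfam.exists_momVal h2
    obtain ⟨ψ, hψ0, hψd, hψ⟩ := exists_implicit_of_nondegenerate hY' hP' h4 h3 (fun a b ha hb =>
      hS.nondegenerate (sub_mul_nonneg_of_mem_uIcc hs) (hw' s) (hz s hs)
        (by rw [hY'.hasFDerivAt.fderiv]; exact ha) (by rw [hP'.hasFDerivAt.fderiv]; exact hb))
    have hm1 : ∀ᶠ u in 𝓝 s, (u, x, (ψ u).2) ∈ pointDomain N D := by
      have hc : ContinuousAt (fun u => (u, x, (ψ u).2)) s :=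
        continuousAt_id.prodMk (continuousAt_const.prodMk hψd.continuousAt.snd)
      refine hc.eventually ((isOpen_pointDomain hS.isOpen).mem_nhds ?_)
      change (s, x, (ψ s).2) ∈ pointDomain N D
      rw [hψ0]
      exact h1
    have hm2 : ∀ᶠ u in 𝓝 s, (t - u, (ψ u).1, r) ∈ pointDomain N D := by
      have hc : ContinuousAt (fun u => (t - u, (ψ u).1, r)) s :=
        (continuousAt_const.sub continuousAt_id).prodMk
          (hψd.continuousAt.fst.prodMk continuousAt_const)
      refine hc.eventually ((isOpen_pointDomain hS.isOpen).mem_nhds ?_)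
      change (t - s, (ψ s).1, r) ∈ pointDomain N D
      rw [hψ0]
      exact h2
    -- The path `z` is chosen pointwise, with no continuity. It still agrees with the implicit
    -- function near `s`, because intermediate points are unique in the whole domain and not only
    -- locally.
    refine hψd.differentiableWithinAt.congr_of_eventuallyEq_of_mem ?_ hs
    filter_upwards [self_mem_nhdsWithin, nhdsWithin_le_nhds hm1, nhdsWithin_le_nhds hm2,
      nhdsWithin_le_nhds hψ] with u hu hu1 hu2 hu3
    obtain ⟨e1, e2⟩ := hS.intermediate_unique (sub_mul_nonneg_of_mem_uIcc hu) (hw' u) (hz u hu)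
      ⟨hu1, hu2, hu3.2, hu3.1⟩
    exact Prod.ext e1 e2
  exact ⟨fun s => (z s).1, fun s => (z s).2, fun s hs => ⟨hz s hs, (hdiff s hs).fst,
    (hdiff s hs).snd⟩⟩

/-- At the ends of the path of intermediate points the position is initial and the momentum
final. -/
theorem IsThickGroup.intermediate_zero (hS : IsThickGroup D S H) {t : ℝ} {x r y q : Vec N n m}
    (h : Intermediate D S t 0 x r y q) : y = x := by
  obtain ⟨h1, -, -, h4⟩ := h
  rw [h4, hS.posVal_zero h1]

theorem IsThickGroup.intermediate_self (hS : IsThickGroup D S H) {t : ℝ} {x r y q : Vec N n m}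
    (h : Intermediate D S 0 t x r y q) : q = r := by
  obtain ⟨-, h2, h3, -⟩ := h
  rw [h3, hS.momVal_zero h2]

theorem EvenFam.hasDerivWithinAt_genVal {f : ℝ → SuperFun (Ev n) (Od m)} (hf : EvenFam D f)
    {τ y q : ℝ → _} {I : Set ℝ} {s τ' : ℝ} {y' q' : Vec N n m}
    (hτ : HasDerivWithinAt τ τ' I s) (hy : HasDerivWithinAt y y' I s)
    (hq : HasDerivWithinAt q q' I s) (hw : (τ s, y s, q s) ∈ pointDomain N D) :
    HasDerivWithinAt (fun u => genVal f (τ u, y u, q u))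
      (τ' • timeVal f (τ s, y s, q s) + pairing N n m y' (momVal f (τ s, y s, q s)) +
        pairing N n m (posVal f (τ s, y s, q s)) q') I s := by
  obtain ⟨L, hL, hL'⟩ := hf.exists_genVal hw
  have h := hL.hasFDerivAt.comp_hasDerivWithinAt s (hτ.prodMk (hy.prodMk hq))
  rw [hL'] at h
  exact h

theorem hasDerivWithinAt_pairing {y q : ℝ → Vec N n m} {I : Set ℝ} {s : ℝ} {y' q' : Vec N n m}
    (hy : HasDerivWithinAt y y' I s) (hq : HasDerivWithinAt q q' I s) :
    HasDerivWithinAt (fun u => pairing N n m (y u) (q u))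
      (pairing N n m (y s) q' + pairing N n m y' (q s)) I s := by
  have h := (pairing N n m).hasFDerivWithinAt_of_bilinear hy.hasFDerivWithinAt
    hq.hasFDerivWithinAt
  refine h.hasDerivWithinAt.congr_deriv ?_
  simp

/-- Conservation of energy along the intermediate points. -/
theorem IsThickGroup.timeVal_eq (hS : IsThickGroup D S H) {t : ℝ} (ht : t ≠ 0) {x r : Vec N n m}
    (hw : (t, x, r) ∈ pointDomain N D) {y q : ℝ → Vec N n m}
    (h : ∀ s ∈ Set.uIcc 0 t, Intermediate D S (t - s) s x r (y s) (q s) ∧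
      DifferentiableWithinAt ℝ y (Set.uIcc 0 t) s ∧
      DifferentiableWithinAt ℝ q (Set.uIcc 0 t) s) {s : ℝ} (hs : s ∈ Set.uIcc 0 t) :
    timeVal S (t - s, y s, r) = timeVal S (s, x, q s) := by
  have hfam := hS.evenFam
  obtain ⟨⟨h1, h2, h3, h4⟩, hy, hq⟩ := h s hs
  have hy' := hy.hasDerivWithinAt
  have hq' := hq.hasDerivWithinAt
  have hd1 := hfam.hasDerivWithinAt_genVal ((hasDerivWithinAt_id s (Set.uIcc 0 t)).const_sub t) hy'
    (hasDerivWithinAt_const s _ r) h2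
  have hd2 := hfam.hasDerivWithinAt_genVal (hasDerivWithinAt_id s (Set.uIcc 0 t))
    (hasDerivWithinAt_const s _ x) hq' h1
  have hd := (hd1.add hd2).sub (hasDerivWithinAt_pairing hy' hq')
  have hc : HasDerivWithinAt (fun _ : ℝ => genVal S (t, x, r)) (0 : Lam N) (Set.uIcc 0 t) s :=
    hasDerivWithinAt_const _ _ _
  have hcongr := hc.congr_of_mem (fun u hu => ?_) hs (f₁ := fun u => genVal S (t - u, y u, r) +
    genVal S (u, x, q u) - pairing N n m (y u) (q u))
  · have e := (uniqueDiffWithinAt_uIcc ht hs).eq_deriv _ hd hcongr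
    simp only [id] at e
    -- The intermediate equations identify the coefficients of `y'` and `q'` with those in the
    -- derivative of `y^a q_a`, so these terms cancel and only time derivatives remain.
    rw [← h3, ← h4, map_zero, map_zero, zero_apply, add_zero, add_zero, one_smul, neg_smul,
      one_smul] at e
    rw [← sub_eq_zero, ← neg_eq_zero, ← e]
    abel
  · have := hS.genVal_add (sub_mul_nonneg_of_mem_uIcc hu) (x := x) (r := r)
      (by rwa [sub_add_cancel]) (h u hu).1
    rw [sub_add_cancel] at this
    exact this.symm

/-- The Hamilton–Jacobi equation in the momenta: `∂S_t/∂t (x,q) = H(y,q)`,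
`y^a = (-1)^{ã} ∂S_t/∂q_a`. -/
theorem IsThickGroup.hamiltonJacobi_pos (hS : IsThickGroup D S H) {t : ℝ} {x r : Vec N n m}
    (hw : (t, x, r) ∈ pointDomain N D) :
    (0, posVal S (t, x, r), r) ∈ pointDomain N D ∧
      timeVal S (t, x, r) = genVal (fun _ => H) (0, posVal S (t, x, r), r) := by
  rcases eq_or_ne t 0 with rfl | ht
  · rw [hS.posVal_zero hw]
    exact ⟨hw, hS.timeVal_zero 0 hw⟩
  · obtain ⟨y, q, h⟩ := hS.exists_intermediate_path hw
    have ht' : t ∈ Set.uIcc 0 t := Set.right_mem_uIcc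
    -- At `s = t` the outer factor is the identity, whose time derivative is `H`; the inner factor
    -- is `Φ_t`.
    have hI := (h t ht').1
    have he := hS.timeVal_eq ht hw h ht'
    rw [sub_self] at hI he
    have hq := hS.intermediate_self hI
    obtain ⟨h1, h2, h3, h4⟩ := hI
    rw [hq] at h4 he
    rw [← h4]
    exact ⟨h2, by rw [← he, hS.timeVal_zero 0 h2]⟩

/-- The Hamilton–Jacobi equation in the positions: `∂S_t/∂t (x,q) = H(x,p)`,
`p_a = ∂S_t/∂x^a`. -/
theorem IsThickGroup.hamiltonJacobi_mom (hS : IsThickGroup D S H) {t : ℝ} {x r : Vec N n m}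
    (hw : (t, x, r) ∈ pointDomain N D) :
    (0, x, momVal S (t, x, r)) ∈ pointDomain N D ∧
      timeVal S (t, x, r) = genVal (fun _ => H) (0, x, momVal S (t, x, r)) := by
  rcases eq_or_ne t 0 with rfl | ht
  · rw [hS.momVal_zero hw]
    exact ⟨hw, hS.timeVal_zero 0 hw⟩
  · obtain ⟨y, q, h⟩ := hS.exists_intermediate_path hw
    have ht' : (0 : ℝ) ∈ Set.uIcc 0 t := Set.left_mem_uIcc
    -- At `s = 0` the roles are exchanged, and the inner factor is the identity.
    have hI := (h 0 ht').1
    have he := hS.timeVal_eq ht hw h ht'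
    rw [sub_zero] at hI he
    have hy := hS.intermediate_zero hI
    obtain ⟨h1, h2, h3, h4⟩ := hI
    rw [hy] at h3 he
    rw [← h3]
    exact ⟨h1, by rw [he, hS.timeVal_zero 0 h1]⟩

end Group

/-! ### Transport equations and Hamilton's equations for intermediate points. -/

theorem triple_add {V : Type*} [AddCommGroup V] (a b : V) :
    ((0, 0, a + b) : ℝ × V × V) = (0, 0, a) + (0, 0, b) := by simp

theorem triple_sub {V : Type*} [AddCommGroup V] (a b : V) :
    ((0, a - b, 0) : ℝ × V × V) = (0, a, 0) - (0, b, 0) := by simp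

theorem sub_eq_map {F F' : Type*} [NormedAddCommGroup F] [NormedSpace ℝ F]
    [NormedAddCommGroup F'] [NormedSpace ℝ F'] {j : F →L[ℝ] F'} {a a' : F'} {b b' : F}
    (h : a = j b) (h' : a' = j b') : a - a' = j (b - b') := by
  rw [h, h', map_sub]

section Transport

variable {N n m : ℕ} {D : Set (ℝ × (Ev n → ℝ))} {S : ℝ → SuperFun (Ev n) (Od m)}
  {H : SuperFun (Ev n) (Od m)}

/-- The point of phase space `(y, q)`, `y^a = (-1)^{ã} ∂S_t/∂q_a (x,q)`, at which the Hamiltonian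
is evaluated in the Hamilton–Jacobi equation in the momenta. -/
def posPoint (S : ℝ → SuperFun (Ev n) (Od m)) (w : ℝ × Vec N n m × Vec N n m) :
    ℝ × Vec N n m × Vec N n m := (0, posVal S w, w.2.2)

/-- The point of phase space `(x, p)`, `p_a = ∂S_t/∂x^a (x,q)`, at which the Hamiltonian
is evaluated in the Hamilton–Jacobi equation in the positions. -/
def momPoint (S : ℝ → SuperFun (Ev n) (Od m)) (w : ℝ × Vec N n m × Vec N n m) :
    ℝ × Vec N n m × Vec N n m := (0, w.2.1, momVal S w)

theorem IsThickGroup.posPoint_mem (hS : IsThickGroup D S H) {w : ℝ × Vec N n m × Vec N n m}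
    (hw : w ∈ pointDomain N D) : posPoint S w ∈ pointDomain N (hamDomain D) :=
  (hS.hamiltonJacobi_pos hw).1

theorem IsThickGroup.momPoint_mem (hS : IsThickGroup D S H) {w : ℝ × Vec N n m × Vec N n m}
    (hw : w ∈ pointDomain N D) : momPoint S w ∈ pointDomain N (hamDomain D) :=
  (hS.hamiltonJacobi_mom hw).1

/-- The Hamilton–Jacobi equation holds on an open set of points, so it can be differentiated; `dH`
is then expanded by the chain rule. -/
theorem IsThickGroup.fderiv_timeVal_pos (hS : IsThickGroup D S H)
    {w : ℝ × Vec N n m × Vec N n m} (hw : w ∈ pointDomain N D)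
    (v : ℝ × Vec N n m × Vec N n m) :
    fderiv ℝ (timeVal S) w v =
      pairing N n m (fderiv ℝ (posVal S) w v) (momVal (fun _ => H) (posPoint S w)) +
      pairing N n m (posVal (fun _ => H) (posPoint S w)) v.2.2 := by
  obtain ⟨L, hL, hL'⟩ := hS.hamFam.exists_genVal (hS.posPoint_mem hw)
  have h1 : HasFDerivAt (posPoint (N := N) S) ((0 : ℝ × Vec N n m × Vec N n m →L[ℝ] ℝ).prod
      ((fderiv ℝ (posVal S) w).prod ((ContinuousLinearMap.snd ℝ _ _).comp
        (ContinuousLinearMap.snd ℝ _ _)))) w :=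
    (hasFDerivAt_const 0 w).prodMk ((hS.evenFam.hasFDerivAt_posVal hw).prodMk
      (hasFDerivAt_snd (𝕜 := ℝ) (p := w)).snd)
  have h2 := (hL.hasFDerivAt.comp w h1).congr_of_eventuallyEq (f₁ := timeVal S)
    (Filter.eventuallyEq_of_mem ((isOpen_pointDomain hS.isOpen).mem_nhds hw)
      fun w' hw' => (hS.hamiltonJacobi_pos hw').2)
  rw [h2.fderiv, ContinuousLinearMap.comp_apply, hL']
  simp

theorem IsThickGroup.fderiv_timeVal_mom (hS : IsThickGroup D S H)
    {w : ℝ × Vec N n m × Vec N n m} (hw : w ∈ pointDomain N D)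
    (v : ℝ × Vec N n m × Vec N n m) :
    fderiv ℝ (timeVal S) w v =
      pairing N n m v.2.1 (momVal (fun _ => H) (momPoint S w)) +
      pairing N n m (posVal (fun _ => H) (momPoint S w)) (fderiv ℝ (momVal S) w v) := by
  obtain ⟨L, hL, hL'⟩ := hS.hamFam.exists_genVal (hS.momPoint_mem hw)
  have h1 : HasFDerivAt (momPoint (N := N) S) ((0 : ℝ × Vec N n m × Vec N n m →L[ℝ] ℝ).prod
      (((ContinuousLinearMap.fst ℝ _ _).comp (ContinuousLinearMap.snd ℝ _ _)).prod
        (fderiv ℝ (momVal S) w))) w :=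
    (hasFDerivAt_const 0 w).prodMk (((ContinuousLinearMap.fst ℝ _ _).comp
      (ContinuousLinearMap.snd ℝ _ _)).hasFDerivAt.prodMk (hS.evenFam.hasFDerivAt_momVal hw))
  have h2 := (hL.hasFDerivAt.comp w h1).congr_of_eventuallyEq (f₁ := timeVal S)
    (Filter.eventuallyEq_of_mem ((isOpen_pointDomain hS.isOpen).mem_nhds hw)
      fun w' hw' => (hS.hamiltonJacobi_mom hw').2)
  rw [h2.fderiv, ContinuousLinearMap.comp_apply, hL']
  simp

/-- The terms of the derivative of the Hamilton–Jacobi equation in the momenta, contracted with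
arbitrary increments. -/
theorem IsThickGroup.pairing_transport_pos (hS : IsThickGroup D S H)
    {w : ℝ × Vec N n m × Vec N n m} (hw : w ∈ pointDomain N D) (dx dq : Vec N n m) :
    pairing N n m dx (fderiv ℝ (momVal S) w (1, 0, 0) -
        fderiv ℝ (momVal S) w (0, 0, momVal (fun _ => H) (posPoint S w))) +
      pairing N n m (fderiv ℝ (posVal S) w (1, 0, 0) -
        fderiv ℝ (posVal S) w (0, 0, momVal (fun _ => H) (posPoint S w)) -
        posVal (fun _ => H) (posPoint S w)) dq = 0 := by
  have h1 := hS.evenFam.second_symm hw (1, 0, 0) (0, dx, dq)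
  -- The derivative of the Hamilton–Jacobi equation contains the derivative of `posVal S` along the
  -- arbitrary increment. Symmetry in the direction `∂H/∂y` exchanges it for derivatives along that
  -- fixed direction.
  have h2 := hS.evenFam.second_symm hw (0, 0, momVal (fun _ => H) (posPoint S w)) (0, dx, dq)
  have h3 := hS.fderiv_timeVal_pos hw (0, dx, dq)
  simp only [zero_smul, one_smul, zero_add, map_zero, zero_apply, add_zero] at h1 h2 h3
  rw [h3, ← h2] at h1
  simp only [map_sub, sub_apply]
  rw [← sub_eq_zero] at h1
  rw [← h1]
  abel

theorem IsThickGroup.pairing_transport_mom (hS : IsThickGroup D S H)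
    {w : ℝ × Vec N n m × Vec N n m} (hw : w ∈ pointDomain N D) (dx dq : Vec N n m) :
    pairing N n m dx (fderiv ℝ (momVal S) w (1, 0, 0) -
        fderiv ℝ (momVal S) w (0, posVal (fun _ => H) (momPoint S w), 0) -
        momVal (fun _ => H) (momPoint S w)) +
      pairing N n m (fderiv ℝ (posVal S) w (1, 0, 0) -
        fderiv ℝ (posVal S) w (0, posVal (fun _ => H) (momPoint S w), 0)) dq = 0 := by
  have h1 := hS.evenFam.second_symm hw (1, 0, 0) (0, dx, dq)
  have h2 := hS.evenFam.second_symm hw (0, posVal (fun _ => H) (momPoint S w), 0) (0, dx, dq)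
  have h3 := hS.fderiv_timeVal_mom hw (0, dx, dq)
  simp only [zero_smul, one_smul, zero_add, map_zero, zero_apply, add_zero] at h1 h2 h3
  rw [h3, ← h2] at h1
  simp only [map_sub, sub_apply]
  rw [← sub_eq_zero] at h1
  rw [← h1]
  abel

theorem inclTriple_mk (t : ℝ) (x q : Vec N n m) :
    inclTriple N n m (t, x, q) = (t, inclPt N _ _ x, inclPt N _ _ q) := rfl

theorem eq_zero_of_pairing {a b : Vec N n m} (h : ∀ dx dq, pairing (N + 1) n m dx (inclPt N _ _ a) +
    pairing (N + 1) n m (inclPt N _ _ b) dq = 0) : a = 0 ∧ b = 0 := by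
  constructor
  · refine eq_zero_of_pairing_left fun u => ?_
    simpa using h u 0
  · refine eq_zero_of_pairing_right fun u => ?_
    simpa using h 0 u

/-- The derivative of the Hamilton–Jacobi equation in the momenta. -/
theorem IsThickGroup.transport_pos (hS : IsThickGroup D S H)
    {w : ℝ × Vec N n m × Vec N n m} (hw : w ∈ pointDomain N D) :
    fderiv ℝ (momVal S) w (1, 0, 0) =
        fderiv ℝ (momVal S) w (0, 0, momVal (fun _ => H) (posPoint S w)) ∧
      fderiv ℝ (posVal S) w (1, 0, 0) =
        fderiv ℝ (posVal S) w (0, 0, momVal (fun _ => H) (posPoint S w)) +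
        posVal (fun _ => H) (posPoint S w) := by
  have hfam := hS.evenFam
  -- Every term comes from `Λ_N`, so contraction with increments over `Λ_{N+1}` separates its
  -- components.
  have hp : posPoint S (inclTriple N n m w) = inclTriple N n m (posPoint S w) := by
    rw [posPoint, hfam.posVal_incl hw]
    rfl
  have hm : momVal (fun _ => H) (posPoint S (inclTriple N n m w)) =
      inclPt N _ _ (momVal (fun _ => H) (posPoint S w)) := by
    rw [hp, hS.hamFam.momVal_incl (hS.posPoint_mem hw)]
  have hq : posVal (fun _ => H) (posPoint S (inclTriple N n m w)) =
      inclPt N _ _ (posVal (fun _ => H) (posPoint S w)) := by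
    rw [hp, hS.hamFam.posVal_incl (hS.posPoint_mem hw)]
  have e1 : ((1, 0, 0) : ℝ × Vec (N + 1) n m × Vec (N + 1) n m) = inclTriple N n m (1, 0, 0) := by
    rw [inclTriple_mk, map_zero]
  have e2 : ((0, 0, momVal (fun _ => H) (posPoint S (inclTriple N n m w))) :
      ℝ × Vec (N + 1) n m × Vec (N + 1) n m) =
      inclTriple N n m (0, 0, momVal (fun _ => H) (posPoint S w)) := by
    rw [hm, inclTriple_mk, map_zero]
  have hA := sub_eq_map ((congrArg _ e1).trans (hfam.fderiv_momVal_incl hw _))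
    ((congrArg _ e2).trans (hfam.fderiv_momVal_incl hw _))
  have hB := sub_eq_map (sub_eq_map
    ((congrArg _ e1).trans (hfam.fderiv_posVal_incl hw _))
    ((congrArg _ e2).trans (hfam.fderiv_posVal_incl hw _))) hq
  have h := eq_zero_of_pairing fun dx dq => by
    have := hS.pairing_transport_pos (inclTriple_mem hw) dx dq
    rw [hA, hB] at this
    exact this
  exact ⟨sub_eq_zero.1 h.1, eq_add_of_sub_eq' (sub_eq_zero.1 h.2)⟩

/-- The derivative of the Hamilton–Jacobi equation in the positions. -/
theorem IsThickGroup.transport_mom (hS : IsThickGroup D S H)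
    {w : ℝ × Vec N n m × Vec N n m} (hw : w ∈ pointDomain N D) :
    fderiv ℝ (momVal S) w (1, 0, 0) =
        fderiv ℝ (momVal S) w (0, posVal (fun _ => H) (momPoint S w), 0) +
        momVal (fun _ => H) (momPoint S w) := by
  have hfam := hS.evenFam
  have hp : momPoint S (inclTriple N n m w) = inclTriple N n m (momPoint S w) := by
    rw [momPoint, hfam.momVal_incl hw]
    rfl
  have hm : momVal (fun _ => H) (momPoint S (inclTriple N n m w)) =
      inclPt N _ _ (momVal (fun _ => H) (momPoint S w)) := by
    rw [hp, hS.hamFam.momVal_incl (hS.momPoint_mem hw)]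
  have hq : posVal (fun _ => H) (momPoint S (inclTriple N n m w)) =
      inclPt N _ _ (posVal (fun _ => H) (momPoint S w)) := by
    rw [hp, hS.hamFam.posVal_incl (hS.momPoint_mem hw)]
  have e1 : ((1, 0, 0) : ℝ × Vec (N + 1) n m × Vec (N + 1) n m) = inclTriple N n m (1, 0, 0) := by
    rw [inclTriple_mk, map_zero]
  have e2 : ((0, posVal (fun _ => H) (momPoint S (inclTriple N n m w)), 0) :
      ℝ × Vec (N + 1) n m × Vec (N + 1) n m) =
      inclTriple N n m (0, posVal (fun _ => H) (momPoint S w), 0) := by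
    rw [hq, inclTriple_mk, map_zero]
  have hA := sub_eq_map (sub_eq_map
    ((congrArg _ e1).trans (hfam.fderiv_momVal_incl hw _))
    ((congrArg _ e2).trans (hfam.fderiv_momVal_incl hw _))) hm
  have hB := sub_eq_map ((congrArg _ e1).trans (hfam.fderiv_posVal_incl hw _))
    ((congrArg _ e2).trans (hfam.fderiv_posVal_incl hw _))
  have h := eq_zero_of_pairing fun dx dq => by
    have := hS.pairing_transport_mom (inclTriple_mem hw) dx dq
    rw [hA, hB] at this
    exact this
  exact eq_add_of_sub_eq' (sub_eq_zero.1 h.1)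

theorem hasDerivWithinAt_comp_triple {F : Type*} [NormedAddCommGroup F] [NormedSpace ℝ F]
    {g : ℝ × Vec N n m × Vec N n m → F} {τ : ℝ → ℝ} {y q : ℝ → Vec N n m} {I : Set ℝ} {s τ' : ℝ}
    {y' q' : Vec N n m} (hg : HasFDerivAt g (fderiv ℝ g (τ s, y s, q s)) (τ s, y s, q s))
    (hτ : HasDerivWithinAt τ τ' I s) (hy : HasDerivWithinAt y y' I s)
    (hq : HasDerivWithinAt q q' I s) :
    HasDerivWithinAt (fun u => g (τ u, y u, q u)) (τ' • fderiv ℝ g (τ s, y s, q s) (1, 0, 0) +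
      fderiv ℝ g (τ s, y s, q s) (0, y', 0) + fderiv ℝ g (τ s, y s, q s) (0, 0, q')) I s := by
  refine (hg.comp_hasDerivWithinAt s (hτ.prodMk (hy.prodMk hq))).congr_deriv ?_
  rw [← map_smul, ← map_add, ← map_add]
  simp

/-- The path of intermediate points solves Hamilton's equations. -/
theorem IsThickGroup.hasDerivWithinAt_intermediate (hS : IsThickGroup D S H) {t : ℝ} (ht : t ≠ 0)
    {x r : Vec N n m} (hw : (t, x, r) ∈ pointDomain N D) {y q : ℝ → Vec N n m}
    (h : ∀ s ∈ Set.uIcc 0 t, Intermediate D S (t - s) s x r (y s) (q s) ∧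
      DifferentiableWithinAt ℝ y (Set.uIcc 0 t) s ∧
      DifferentiableWithinAt ℝ q (Set.uIcc 0 t) s) {s : ℝ} (hs : s ∈ Set.uIcc 0 t) :
    HasDerivWithinAt y (posVal (fun _ => H) (0, y s, q s)) (Set.uIcc 0 t) s ∧
      HasDerivWithinAt q (-momVal (fun _ => H) (0, y s, q s)) (Set.uIcc 0 t) s := by
  have hfam := hS.evenFam
  obtain ⟨hI, hy, hq⟩ := h s hs
  have hI' := hI
  obtain ⟨h1, h2, h3, h4⟩ := hI'
  have hu := uniqueDiffWithinAt_uIcc ht hs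
  obtain ⟨y', hy'⟩ : ∃ y', HasDerivWithinAt y y' (Set.uIcc 0 t) s := ⟨_, hy.hasDerivWithinAt⟩
  obtain ⟨q', hq'⟩ : ∃ q', HasDerivWithinAt q q' (Set.uIcc 0 t) s := ⟨_, hq.hasDerivWithinAt⟩
  have ep : posPoint S (s, x, q s) = (0, y s, q s) := by rw [posPoint, ← h4]
  have em : momPoint S (t - s, y s, r) = (0, y s, q s) := by rw [momPoint, ← h3]
  have hd1 := hasDerivWithinAt_comp_triple (hfam.hasFDerivAt_posVal h1)
    (hasDerivWithinAt_id s (Set.uIcc 0 t)) (hasDerivWithinAt_const s _ x) hq'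
  have hd2 := hasDerivWithinAt_comp_triple (hfam.hasFDerivAt_momVal h2)
    ((hasDerivWithinAt_id s (Set.uIcc 0 t)).const_sub t) hy' (hasDerivWithinAt_const s _ r)
  have e1 := hu.eq_deriv _ hy' (hd1.congr_of_mem (fun u hu => (h u hu).1.2.2.2) hs)
  have e2 := hu.eq_deriv _ hq' (hd2.congr_of_mem (fun u hu => (h u hu).1.2.2.1) hs)
  have z0 : ((0, 0, 0) : ℝ × Vec N n m × Vec N n m) = 0 := rfl
  simp only [id] at e1 e2
  rw [(hS.transport_pos h1).2, ep, z0, map_zero, add_zero, one_smul] at e1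
  rw [hS.transport_mom h2, em, z0, map_zero, add_zero, neg_smul, one_smul] at e2
  -- Substituting the transport equations into `e1` and `e2` shows that the defects in Hamilton's
  -- equations satisfy the homogeneous linearised system.
  have key := hS.nondegenerate (sub_mul_nonneg_of_mem_uIcc hs) (by rwa [sub_add_cancel]) hI
    (a := y' - posVal (fun _ => H) (0, y s, q s)) (b := q' + momVal (fun _ => H) (0, y s, q s))
    (by
      conv_lhs => rw [e1]
      have : ((0, 0, q' + momVal (fun _ => H) (0, y s, q s)) : ℝ × Vec N n m × Vec N n m) =
          (0, 0, momVal (fun _ => H) (0, y s, q s)) + (0, 0, q') := by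
        rw [add_comm q', triple_add]
      rw [this, map_add]
      abel)
    (by
      conv_lhs => rw [e2]
      have : ((0, y' - posVal (fun _ => H) (0, y s, q s), 0) : ℝ × Vec N n m × Vec N n m) =
          (0, y', 0) - (0, posVal (fun _ => H) (0, y s, q s), 0) := triple_sub _ _
      rw [this, map_sub]
      abel)
  rw [← sub_eq_zero.1 key.1, ← eq_neg_of_add_eq_zero_left key.2]
  exact ⟨hy', hq'⟩

end Transport

/-! ### Existence of trajectories with given initial position and final momentum. -/

section Trajectories

variable {N n m : ℕ} {D : Set (ℝ × (Ev n → ℝ))} {S : ℝ → SuperFun (Ev n) (Od m)}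
  {H : SuperFun (Ev n) (Od m)}

theorem hasDerivWithinAt_vec_iff {y : ℝ → Vec N n m} {y' : Vec N n m} {I : Set ℝ} {s : ℝ} :
    HasDerivWithinAt y y' I s ↔
      (∀ i, HasDerivWithinAt (fun u => ((y u).1 i : Lam N)) (y'.1 i) I s) ∧
      ∀ α, HasDerivWithinAt (fun u => ((y u).2 α : Lam N)) (y'.2 α) I s := by
  constructor
  · intro h
    exact ⟨fun i => (evCoord N m i).hasFDerivAt.comp_hasDerivWithinAt s h,
      fun α => (odCoord N n α).hasFDerivAt.comp_hasDerivWithinAt s h⟩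
  · rintro ⟨h1, h2⟩
    have e1 : HasDerivWithinAt (fun u => (y u).1) y'.1 I s := by
      rw [hasDerivWithinAt_pi]
      intro i
      have h := (evenProj N).hasFDerivAt.comp_hasDerivWithinAt s (h1 i)
      have e : ∀ v : Vec N n m, evenProj N (v.1 i) = v.1 i := fun v =>
        Subtype.ext (evenProj_apply (v.1 i).2)
      rw [e] at h
      exact h.congr_of_eventuallyEq (.of_forall fun u => (e (y u)).symm) (e (y s)).symm
    have e2 : HasDerivWithinAt (fun u => (y u).2) y'.2 I s := by
      rw [hasDerivWithinAt_pi]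
      intro α
      have h := (oddProj N).hasFDerivAt.comp_hasDerivWithinAt s (h2 α)
      have e : ∀ v : Vec N n m, oddProj N (v.2 α) = v.2 α := fun v =>
        Subtype.ext (oddProj_apply (v.2 α).2)
      rw [e] at h
      exact h.congr_of_eventuallyEq (.of_forall fun u => (e (y u)).symm) (e (y s)).symm
    exact e1.prodMk e2

/-- Hamilton's equations for paths in the vector space of points. -/
theorem IsThickGroup.isTrajectory_iff (hS : IsThickGroup D S H) {t : ℝ} {y q : ℝ → Vec N n m} :
    IsTrajectory H (slice D 0) t (fun u => toPoint (y u)) (fun u => toPoint (q u)) ↔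
      ∀ τ ∈ Set.uIcc 0 t, (0, y τ, q τ) ∈ pointDomain N (hamDomain D) ∧
        HasDerivWithinAt y (posVal (fun _ => H) (0, y τ, q τ)) (Set.uIcc 0 t) τ ∧
        HasDerivWithinAt q (-momVal (fun _ => H) (0, y τ, q τ)) (Set.uIcc 0 t) τ := by
  have hH := hS.hamFam
  constructor
  · intro h τ hτ
    have hm : (0, y τ, q τ) ∈ pointDomain N (hamDomain D) := h.mem τ hτ
    refine ⟨hm, hasDerivWithinAt_vec_iff.2 ⟨fun i => ?_, fun α => ?_⟩,
      hasDerivWithinAt_vec_iff.2 ⟨fun i => ?_, fun α => ?_⟩⟩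
    · exact (h.pos_even τ hτ i).congr_deriv (hH.posVal_fst hm i).symm
    · exact (h.pos_odd τ hτ α).congr_deriv (hH.posVal_snd hm α).symm
    · exact (h.mom_even τ hτ i).congr_deriv (congrArg Neg.neg (hH.momVal_fst hm i).symm)
    · exact (h.mom_odd τ hτ α).congr_deriv (congrArg Neg.neg (hH.momVal_snd hm α).symm)
  · intro h
    refine ⟨fun τ hτ => (h τ hτ).1, fun τ hτ i => ?_, fun τ hτ α => ?_, fun τ hτ i => ?_,
      fun τ hτ α => ?_⟩
    all_goals obtain ⟨hm, hy, hq⟩ := h τ hτ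
    · exact ((hasDerivWithinAt_vec_iff.1 hy).1 i).congr_deriv (hH.posVal_fst hm i)
    · exact ((hasDerivWithinAt_vec_iff.1 hy).2 α).congr_deriv (hH.posVal_snd hm α)
    · exact ((hasDerivWithinAt_vec_iff.1 hq).1 i).congr_deriv
        (congrArg Neg.neg (hH.momVal_fst hm i))
    · exact ((hasDerivWithinAt_vec_iff.1 hq).2 α).congr_deriv
        (congrArg Neg.neg (hH.momVal_snd hm α))

/-- The boundary value problem `y(0) = x`, `q(t) = r` has a solution. -/
theorem IsThickGroup.exists_trajectory (hS : IsThickGroup D S H) {t : ℝ} {x r : Vec N n m}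
    (hw : (t, x, r) ∈ pointDomain N D) :
    ∃ y q : ℝ → Vec N n m, IsTrajectoryFrom D H t (toPoint x) (fun u => toPoint (y u))
      (fun u => toPoint (q u)) ∧ q t = r := by
  rcases eq_or_ne t 0 with rfl | ht
  -- Within the one-point interval every vector is a derivative, so constant paths are trajectories.
  · refine ⟨fun _ => x, fun _ => r, ⟨hS.isTrajectory_iff.2 fun τ _ => ⟨hw, ?_, ?_⟩, rfl, ?_⟩, rfl⟩
    · rw [Set.uIcc_self]
      exact hasDerivWithinAt_iff_hasFDerivWithinAt.2 (.of_subsingleton Set.subsingleton_singleton)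
    · rw [Set.uIcc_self]
      exact hasDerivWithinAt_iff_hasFDerivWithinAt.2 (.of_subsingleton Set.subsingleton_singleton)
    · intro τ hτ
      rw [Set.uIcc_self] at hτ
      rw [Set.mem_singleton_iff.1 hτ]
      exact hw
  · obtain ⟨y, q, h⟩ := hS.exists_intermediate_path hw
    have h0 := (h 0 Set.left_mem_uIcc).1
    have ht' := (h t Set.right_mem_uIcc).1
    rw [sub_zero] at h0
    rw [sub_self] at ht'
    refine ⟨y, q, ⟨hS.isTrajectory_iff.2 fun τ hτ => ⟨?_, ?_⟩, congrArg toPoint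
      (hS.intermediate_zero h0), fun τ hτ => (h τ hτ).1.1⟩, hS.intermediate_self ht'⟩
    · obtain ⟨h1, -, -, h4⟩ := (h τ hτ).1
      have := (hS.hamiltonJacobi_pos h1).1
      rw [← h4] at this
      exact this
    · exact hS.hasDerivWithinAt_intermediate ht hw h hτ

end Trajectories

/-! ### A Grönwall argument and Lipschitz estimates. -/

section Uniqueness

variable {E : Type*} [NormedAddCommGroup E] [NormedSpace ℝ E]

/-- The zero set is closed, and Grönwall's inequality with zero initial value extends it to the
right of each of its points. Hence the bound is needed only near zeros of `u`. In the application
local Lipschitz estimates are available only there, since two paths are then close to a common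
point. -/
theorem eq_zero_of_norm_deriv_le_unit {u u' : ℝ → E}
    (hu : ∀ s ∈ Set.Icc (0 : ℝ) 1, HasDerivWithinAt u (u' s) (Set.Icc 0 1) s) (h0 : u 0 = 0)
    (hb : ∀ s ∈ Set.Icc (0 : ℝ) 1, u s = 0 →
      ∃ K, ∀ᶠ r in 𝓝[Set.Icc 0 1] s, ‖u' r‖ ≤ K * ‖u r‖) :
    ∀ s ∈ Set.Icc (0 : ℝ) 1, u s = 0 := by
  have hc : ContinuousOn u (Set.Icc 0 1) := fun s hs => (hu s hs).continuousWithinAt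
  have hclosed : IsClosed ({s | u s = 0} ∩ Set.Icc (0 : ℝ) 1) := by
    have := hc.preimage_isClosed_of_isClosed isClosed_Icc (isClosed_singleton (x := (0 : E)))
    rwa [Set.inter_comm] at this
  refine hclosed.Icc_subset_of_forall_mem_nhdsWithin h0 ?_
  rintro s ⟨hs0, hs⟩
  obtain ⟨K, hK⟩ := hb s (Set.Ico_subset_Icc_self hs) hs0
  have hK' : ∀ᶠ r in 𝓝[≥] s, ‖u' r‖ ≤ K * ‖u r‖ :=
    hK.filter_mono (nhdsWithin_le_of_mem (Icc_mem_nhdsGE_of_mem hs))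
  have hlt : ∀ᶠ r in 𝓝[≥] s, r < 1 := nhdsWithin_le_nhds (Iio_mem_nhds hs.2)
  obtain ⟨b, hb, hsub⟩ := mem_nhdsGE_iff_exists_Ico_subset.1 (hK'.and hlt)
  have hbs : s < b := hb
  filter_upwards [Ioo_mem_nhdsGT hbs] with r hr
  have hIcc : Set.Icc s r ⊆ Set.Icc 0 1 := fun x hx =>
    ⟨hs.1.trans hx.1, (hsub ⟨hx.1, hx.2.trans_lt hr.2⟩).2.le⟩
  have key := norm_le_gronwallBound_of_norm_deriv_right_le (f := u) (f' := u') (δ := 0) (K := K)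
    (ε := 0) (a := s) (b := r) (hc.mono hIcc) (fun x hx => (hu x (hIcc
      (Set.Ico_subset_Icc_self hx))).mono_of_mem_nhdsWithin (Icc_mem_nhdsGE_of_mem
        ⟨hs.1.trans hx.1, (hsub ⟨hx.1, hx.2.trans hr.2⟩).2⟩)) (by
      rw [show u s = 0 from hs0, norm_zero]) (fun x hx => by
      rw [add_zero]
      exact (hsub ⟨hx.1, hx.2.trans hr.2⟩).1) r ⟨hr.1.le, le_rfl⟩
  rw [gronwallBound_ε0_δ0] at key
  exact norm_le_zero_iff.1 key

/-- A path whose velocity is locally bounded by its distance from zero, near its zeros, and that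
starts at zero, vanishes. -/
theorem eq_zero_of_norm_deriv_le {t : ℝ} {u u' : ℝ → E}
    (hu : ∀ s ∈ Set.uIcc 0 t, HasDerivWithinAt u (u' s) (Set.uIcc 0 t) s) (h0 : u 0 = 0)
    (hb : ∀ s ∈ Set.uIcc 0 t, u s = 0 →
      ∃ K, ∀ᶠ r in 𝓝[Set.uIcc 0 t] s, ‖u' r‖ ≤ K * ‖u r‖) :
    ∀ s ∈ Set.uIcc 0 t, u s = 0 := by
  -- Rescaling time by `t` treats both signs of `t` at once.
  have hmaps : Set.MapsTo (fun s : ℝ => s * t) (Set.Icc 0 1) (Set.uIcc 0 t) := by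
    intro s hs
    rcases le_total 0 t with h | h
    · rw [Set.uIcc_of_le h]
      exact ⟨mul_nonneg hs.1 h, mul_le_of_le_one_left h hs.2⟩
    · rw [Set.uIcc_of_ge h]
      exact ⟨by nlinarith [hs.2], mul_nonpos_of_nonneg_of_nonpos hs.1 h⟩
  have key := eq_zero_of_norm_deriv_le_unit (u := fun s => u (s * t))
    (u' := fun s => t • u' (s * t))
    (fun s hs => (hu _ (hmaps hs)).scomp s (by
      simpa using (hasDerivWithinAt_id s (Set.Icc (0 : ℝ) 1)).mul_const t) hmaps)
    (by simpa using h0) (fun s hs hs0 => by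
      obtain ⟨K, hK⟩ := hb _ (hmaps hs) hs0
      refine ⟨|t| * K, ?_⟩
      have hc : Filter.Tendsto (fun s : ℝ => s * t) (𝓝[Set.Icc 0 1] s)
          (𝓝[Set.uIcc 0 t] (s * t)) :=
        (continuous_mul_const t).continuousWithinAt.tendsto_nhdsWithin hmaps
      filter_upwards [hc.eventually hK] with r hr
      rw [norm_smul, Real.norm_eq_abs, mul_assoc]
      exact mul_le_mul_of_nonneg_left hr (abs_nonneg t))
  intro s hs
  rcases eq_or_ne t 0 with rfl | ht
  · rw [Set.uIcc_self] at hs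
    rw [Set.mem_singleton_iff.1 hs, h0]
  · have hst : s / t ∈ Set.Icc (0 : ℝ) 1 := by
      rcases Set.mem_uIcc.1 hs with ⟨h1, h2⟩ | ⟨h1, h2⟩
      · exact ⟨div_nonneg h1 (h1.trans h2), div_le_one_of_le₀ h2 (h1.trans h2)⟩
      · exact ⟨div_nonneg_of_nonpos h2 (h1.trans h2), (div_le_one_of_neg
          ((h1.trans h2).lt_of_ne ht)).2 h1⟩
    have := key _ hst
    rwa [div_mul_cancel₀ _ ht] at this

end Uniqueness

section Comparison

variable {V G : Type*} [NormedAddCommGroup V] [NormedSpace ℝ V] [NormedAddCommGroup G]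
  [NormedSpace ℝ G]

theorem exists_eventually_norm_sub_le {f : V → G} {f' : V →L[ℝ] G} {z : V}
    (hf : HasStrictFDerivAt f f' z) {α : Type*} {l : Filter α} {a b : α → V}
    (ha : Filter.Tendsto a l (𝓝 z)) (hb : Filter.Tendsto b l (𝓝 z)) :
    ∃ K : NNReal, ∀ᶠ r in l, ‖f (a r) - f (b r)‖ ≤ K * ‖a r - b r‖ := by
  obtain ⟨K, s, hs, hK⟩ := hf.exists_lipschitzOnWith
  exact ⟨K, by filter_upwards [ha hs, hb hs] with r h1 h2 using hK.norm_sub_le h1 h2⟩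

theorem exists_eventually_norm_fderiv_le {f : V → G} {f' : V →L[ℝ] G} {z : V}
    (hf : HasStrictFDerivAt f f' z) {α : Type*} {l : Filter α} {a : α → V}
    (ha : Filter.Tendsto a l (𝓝 z)) : ∃ C : NNReal, ∀ᶠ r in l, ‖fderiv ℝ f (a r)‖ ≤ C := by
  obtain ⟨C, s, hs, hC⟩ := hf.exists_lipschitzOnWith
  exact ⟨C, by filter_upwards [ha (eventually_mem_nhds_iff.2 hs)] with r h1 using
    norm_fderiv_le_of_lipschitzOn ℝ h1 hC⟩

end Comparison

/-! ### Trajectories satisfy the canonical relation of `S_τ`. -/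

section Trajectories

variable {N n m : ℕ} {D : Set (ℝ × (Ev n → ℝ))} {S : ℝ → SuperFun (Ev n) (Od m)}
  {H : SuperFun (Ev n) (Od m)}

theorem norm_triple_snd {V : Type*} [NormedAddCommGroup V] (a : V) :
    ‖((0, a, 0) : ℝ × V × V)‖ = ‖a‖ := by simp [Prod.norm_def]

theorem norm_triple_thd {V : Type*} [NormedAddCommGroup V] (a : V) :
    ‖((0, 0, a) : ℝ × V × V)‖ = ‖a‖ := by simp [Prod.norm_def]

/-- The canonical relation of `S_τ` relates the momentum and the position of a trajectory from `x`
at every time `τ`. -/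
theorem IsThickGroup.trajectory_pos (hS : IsThickGroup D S H) {t : ℝ} {x : Vec N n m}
    {y q : ℝ → Vec N n m} (hT : IsTrajectoryFrom D H t (toPoint x) (fun u => toPoint (y u))
      (fun u => toPoint (q u))) {τ : ℝ} (hτ : τ ∈ Set.uIcc 0 t) :
    y τ = posVal S (τ, x, q τ) := by
  have hfam := hS.evenFam
  have hH := hS.hamFam
  have hT' := hS.isTrajectory_iff.1 hT.traj
  have hmem : ∀ s ∈ Set.uIcc 0 t, (s, x, q s) ∈ pointDomain N D := hT.mem_domain
  have hy0 : y 0 = x := congrArg (fun p : Pt N n m => ((p.ev, p.od) : Vec N n m)) hT.start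
  -- This is the velocity of `y s - posVal S (s, x, q s)` after the transport equation is used. Each
  -- difference compares a derivative of `H` at two points that differ only in position, by exactly
  -- that quantity.
  let u' : ℝ → Vec N n m := fun s =>
    (posVal (fun _ => H) (0, y s, q s) - posVal (fun _ => H) (posPoint S (s, x, q s))) +
      fderiv ℝ (posVal S) (s, x, q s) (0, 0, momVal (fun _ => H) (0, y s, q s) -
        momVal (fun _ => H) (posPoint S (s, x, q s)))
  have hd : ∀ s ∈ Set.uIcc 0 t, HasDerivWithinAt (fun s => posVal S (s, x, q s))
      (posVal (fun _ => H) (0, y s, q s) - u' s) (Set.uIcc 0 t) s := by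
    intro s hs
    obtain ⟨hm, hy, hq⟩ := hT' s hs
    have h := hasDerivWithinAt_comp_triple (hfam.hasFDerivAt_posVal (hmem s hs))
      (hasDerivWithinAt_id s (Set.uIcc 0 t)) (hasDerivWithinAt_const s _ x) hq
    refine h.congr_deriv ?_
    have z0 : ((0, 0, 0) : ℝ × Vec N n m × Vec N n m) = 0 := rfl
    have e1 : ((0, 0, -momVal (fun _ => H) (0, y s, q s)) : ℝ × Vec N n m × Vec N n m) =
        -(0, 0, momVal (fun _ => H) (0, y s, q s)) := by simp
    have e2 : ((0, 0, momVal (fun _ => H) (0, y s, q s) -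
        momVal (fun _ => H) (posPoint S (s, x, q s))) : ℝ × Vec N n m × Vec N n m) =
        (0, 0, momVal (fun _ => H) (0, y s, q s)) -
          (0, 0, momVal (fun _ => H) (posPoint S (s, x, q s))) := by simp
    simp only [id, u']
    rw [(hS.transport_pos (hmem s hs)).2, z0, map_zero, add_zero, one_smul, e1, map_neg, e2,
      map_sub]
    abel
  have key := eq_zero_of_norm_deriv_le (u := fun s => y s - posVal S (s, x, q s)) (u' := u')
    (fun s hs => ((hT' s hs).2.1.sub (hd s hs)).congr_deriv (sub_sub_cancel _ _))
    (by
      rw [hS.posVal_zero (hmem 0 Set.left_mem_uIcc), hy0, sub_self])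
    (fun s hs hs0 => by
      have hs0 : y s = posVal S (s, x, q s) := sub_eq_zero.1 hs0
      obtain ⟨hm, hy, hq⟩ := hT' s hs
      have hcy := hy.continuousWithinAt.tendsto
      have hcq := hq.continuousWithinAt.tendsto
      have hcp := (hd s hs).continuousWithinAt.tendsto
      rw [← hs0] at hcp
      have c0 : Filter.Tendsto (fun _ : ℝ => (0 : ℝ)) (𝓝[Set.uIcc 0 t] s) (𝓝 0) :=
        tendsto_const_nhds
      have cx : Filter.Tendsto (fun _ : ℝ => x) (𝓝[Set.uIcc 0 t] s) (𝓝 x) := tendsto_const_nhds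
      have cs : Filter.Tendsto (fun r : ℝ => r) (𝓝[Set.uIcc 0 t] s) (𝓝 s) := nhdsWithin_le_nhds
      have c1 := c0.prodMk_nhds (hcy.prodMk_nhds hcq)
      have c2 := c0.prodMk_nhds (hcp.prodMk_nhds hcq)
      have c3 := cs.prodMk_nhds (cx.prodMk_nhds hcq)
      obtain ⟨L1, hL1⟩ := hH.exists_posVal hm
      obtain ⟨L2, hL2⟩ := hH.exists_momVal hm
      obtain ⟨L3, hL3⟩ := hfam.exists_posVal (hmem s hs)
      obtain ⟨K1, hK1⟩ := exists_eventually_norm_sub_le hL1 c1 c2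
      obtain ⟨K2, hK2⟩ := exists_eventually_norm_sub_le hL2 c1 c2
      obtain ⟨C, hC⟩ := exists_eventually_norm_fderiv_le hL3 c3
      -- `K1` and `K2` are Lipschitz constants for the derivatives of `H`, and `C` bounds the
      -- derivative of `posVal S` along the path.
      refine ⟨K1 + C * K2, ?_⟩
      filter_upwards [hK1, hK2, hC] with r h1 h2 h3
      have e : ‖((0, y r, q r) : ℝ × Vec N n m × Vec N n m) - (0, posVal S (r, x, q r), q r)‖ =
          ‖y r - posVal S (r, x, q r)‖ := by
        rw [← norm_triple_snd (y r - posVal S (r, x, q r))]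
        simp
      rw [e] at h1 h2
      rw [add_mul, mul_assoc]
      refine (norm_add_le _ _).trans (add_le_add h1 ?_)
      refine (ContinuousLinearMap.le_opNorm _ _).trans ?_
      rw [norm_triple_thd]
      exact mul_le_mul h3 h2 (norm_nonneg _) C.2)
  exact sub_eq_zero.1 (key τ hτ)

/-- Once `trajectory_pos` is known, the transport equation for `∂S/∂x` is evaluated at the actual
position. Its right side cancels the effect of `dq/dτ`, so the initial momentum computed from `S_τ`
is conserved. -/
theorem IsThickGroup.trajectory_mom (hS : IsThickGroup D S H) {t : ℝ} {x : Vec N n m}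
    {y q : ℝ → Vec N n m} (hT : IsTrajectoryFrom D H t (toPoint x) (fun u => toPoint (y u))
      (fun u => toPoint (q u))) {τ : ℝ} (hτ : τ ∈ Set.uIcc 0 t) :
    q 0 = momVal S (τ, x, q τ) := by
  have hfam := hS.evenFam
  have hT' := hS.isTrajectory_iff.1 hT.traj
  have hmem : ∀ s ∈ Set.uIcc 0 t, (s, x, q s) ∈ pointDomain N D := hT.mem_domain
  have key := eq_zero_of_norm_deriv_le (u := fun s => q 0 - momVal S (s, x, q s))
    (u' := fun _ => (0 : Vec N n m)) (t := t)
    (fun s hs => by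
      obtain ⟨hm, hy, hq⟩ := hT' s hs
      have h := hasDerivWithinAt_comp_triple (hfam.hasFDerivAt_momVal (hmem s hs))
        (hasDerivWithinAt_id s (Set.uIcc 0 t)) (hasDerivWithinAt_const s _ x) hq
      refine (h.const_sub (q 0)).congr_deriv ?_
      have z0 : ((0, 0, 0) : ℝ × Vec N n m × Vec N n m) = 0 := rfl
      have e1 : ((0, 0, -momVal (fun _ => H) (0, y s, q s)) : ℝ × Vec N n m × Vec N n m) =
          -(0, 0, momVal (fun _ => H) (0, y s, q s)) := by simp
      have e2 : posPoint S (s, x, q s) = (0, y s, q s) := by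
        rw [posPoint, ← hS.trajectory_pos hT hs]
      simp only [id]
      rw [(hS.transport_pos (hmem s hs)).1, z0, map_zero, add_zero, one_smul, e1, map_neg, e2,
        add_neg_cancel, neg_zero])
    (by rw [hS.momVal_zero (hmem 0 Set.left_mem_uIcc), sub_self])
    (fun s _ _ => ⟨0, .of_forall fun r => by simp⟩)
  exact sub_eq_zero.1 (key τ hτ)

end Trajectories

/-! ### The generating function as an action integral. -/

theorem integral_eq_sub_of_hasDerivWithinAt_uIcc {E : Type*} [NormedAddCommGroup E]
    [NormedSpace ℝ E] [CompleteSpace E] {t : ℝ} {F F' : ℝ → E}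
    (hF : ∀ s ∈ Set.uIcc 0 t, HasDerivWithinAt F (F' s) (Set.uIcc 0 t) s)
    (hc : ContinuousOn F' (Set.uIcc 0 t)) : ∫ s in (0 : ℝ)..t, F' s = F t - F 0 := by
  refine intervalIntegral.integral_eq_sub_of_hasDeriv_right
    (fun s hs => (hF s hs).continuousWithinAt) (fun s hs => ?_) hc.intervalIntegrable
  exact ((hF s (Set.Ioo_subset_Icc_self hs)).hasDerivAt (Icc_mem_nhds hs.1 hs.2)).hasDerivWithinAt

section Action

variable {N n m : ℕ} {D : Set (ℝ × (Ev n → ℝ))} {S : ℝ → SuperFun (Ev n) (Od m)}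
  {H : SuperFun (Ev n) (Od m)}

/-- For `t ≠ 0` derivatives within the interval are unique, so `derivWithin` returns the coordinates
of `y'`. For `t = 0` it need not, but both integrals vanish. -/
theorem action_eq_integral_pairing {t : ℝ} {y q y' : ℝ → Vec N n m}
    (hy : ∀ s ∈ Set.uIcc 0 t, HasDerivWithinAt y (y' s) (Set.uIcc 0 t) s) :
    action H t (fun u => toPoint (y u)) (fun u => toPoint (q u)) =
      ∫ s in (0 : ℝ)..t, (pairing N n m (y' s) (q s) - genVal (fun _ => H) (0, y s, q s)) := by
  rcases eq_or_ne t 0 with rfl | ht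
  · rw [action, intervalIntegral.integral_same, intervalIntegral.integral_same]
  · refine intervalIntegral.integral_congr fun s hs => ?_
    have hu := uniqueDiffWithinAt_uIcc ht hs
    have h := hasDerivWithinAt_vec_iff.1 (hy s hs)
    refine congrArg₂ (fun a b => a + b - eval H ((toPoint (y s)).pair (toPoint (q s))))
      (Finset.sum_congr rfl fun i _ => ?_) (Finset.sum_congr rfl fun α _ => ?_)
    · exact congrArg (· * ((q s).1 i : Lam N)) ((h.1 i).derivWithin hu)
    · exact congrArg (· * ((q s).2 α : Lam N)) ((h.2 α).derivWithin hu)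

theorem dualAction_eq_integral_pairing {t : ℝ} {y q q' : ℝ → Vec N n m}
    (hq : ∀ s ∈ Set.uIcc 0 t, HasDerivWithinAt q (q' s) (Set.uIcc 0 t) s) :
    dualAction H t (fun u => toPoint (y u)) (fun u => toPoint (q u)) =
      ∫ s in (0 : ℝ)..t, (pairing N n m (y s) (q' s) + genVal (fun _ => H) (0, y s, q s)) := by
  rcases eq_or_ne t 0 with rfl | ht
  · rw [dualAction, intervalIntegral.integral_same, intervalIntegral.integral_same]
  · refine intervalIntegral.integral_congr fun s hs => ?_
    have hu := uniqueDiffWithinAt_uIcc ht hs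
    have h := hasDerivWithinAt_vec_iff.1 (hq s hs)
    refine congrArg₂ (fun a b => a + b + eval H ((toPoint (y s)).pair (toPoint (q s))))
      (Finset.sum_congr rfl fun i _ => ?_) (Finset.sum_congr rfl fun α _ => ?_)
    · exact congrArg (((y s).1 i : Lam N) * ·) ((h.1 i).derivWithin hu)
    · exact congrArg (((y s).2 α : Lam N) * ·) ((h.2 α).derivWithin hu)

/-- The values of the generating function in terms of the classical action of a trajectory. -/
theorem IsThickGroup.genVal_trajectory (hS : IsThickGroup D S H) {t : ℝ} {x : Vec N n m}
    {y q : ℝ → Vec N n m} (hT : IsTrajectoryFrom D H t (toPoint x) (fun u => toPoint (y u))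
      (fun u => toPoint (q u))) :
    genVal S (t, x, q t) = pairing N n m (y t) (q t) -
        action H t (fun u => toPoint (y u)) (fun u => toPoint (q u)) ∧
      genVal S (t, x, q t) = pairing N n m x (q 0) +
        dualAction H t (fun u => toPoint (y u)) (fun u => toPoint (q u)) := by
  have : CompleteSpace (Lam N) := FiniteDimensional.complete ℝ _
  have hfam := hS.evenFam
  have hH := hS.hamFam
  have hT' := hS.isTrajectory_iff.1 hT.traj
  have hmem : ∀ s ∈ Set.uIcc 0 t, (s, x, q s) ∈ pointDomain N D := hT.mem_domain
  have hy0 : y 0 = x := congrArg (fun p : Pt N n m => ((p.ev, p.od) : Vec N n m)) hT.start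
  have hcy : ContinuousOn y (Set.uIcc 0 t) := fun s hs => (hT' s hs).2.1.continuousWithinAt
  have hcq : ContinuousOn q (Set.uIcc 0 t) := fun s hs => (hT' s hs).2.2.continuousWithinAt
  have hcz : ContinuousOn (fun s => ((0, y s, q s) : ℝ × Vec N n m × Vec N n m))
    (Set.uIcc 0 t) := continuousOn_const.prodMk (hcy.prodMk hcq)
  have hcg : ContinuousOn (fun s => genVal (fun _ => H) (0, y s, q s)) (Set.uIcc 0 t) := by
    intro s hs
    obtain ⟨L, hL, -⟩ := hH.exists_genVal (hT' s hs).1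
    exact ContinuousAt.comp_continuousWithinAt (g := genVal fun _ => H)
      (f := fun s => ((0, y s, q s) : ℝ × Vec N n m × Vec N n m)) hL.continuousAt (hcz s hs)
  have hcp : ContinuousOn (fun s => posVal (fun _ => H) (0, y s, q s)) (Set.uIcc 0 t) := by
    intro s hs
    obtain ⟨L, hL⟩ := hH.exists_posVal (hT' s hs).1
    exact ContinuousAt.comp_continuousWithinAt (g := posVal fun _ => H)
      (f := fun s => ((0, y s, q s) : ℝ × Vec N n m × Vec N n m)) hL.continuousAt (hcz s hs)
  have hcm : ContinuousOn (fun s => momVal (fun _ => H) (0, y s, q s)) (Set.uIcc 0 t) := by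
    intro s hs
    obtain ⟨L, hL⟩ := hH.exists_momVal (hT' s hs).1
    exact ContinuousAt.comp_continuousWithinAt (g := momVal fun _ => H)
      (f := fun s => ((0, y s, q s) : ℝ × Vec N n m × Vec N n m)) hL.continuousAt (hcz s hs)
  -- The time derivative of `S` is the energy by Hamilton–Jacobi, and its derivative in the momenta
  -- is the position of the trajectory.
  have hdS : ∀ s ∈ Set.uIcc 0 t, HasDerivWithinAt (fun s => genVal S (s, x, q s))
      (pairing N n m (y s) (-momVal (fun _ => H) (0, y s, q s)) +
        genVal (fun _ => H) (0, y s, q s)) (Set.uIcc 0 t) s := by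
    intro s hs
    refine (hfam.hasDerivWithinAt_genVal (hasDerivWithinAt_id s (Set.uIcc 0 t))
      (hasDerivWithinAt_const s _ x) (hT' s hs).2.2 (hmem s hs)).congr_deriv ?_
    have e := (hS.hamiltonJacobi_pos (hmem s hs)).2
    rw [← hS.trajectory_pos hT hs] at e
    simp only [id]
    rw [e, ← hS.trajectory_pos hT hs, map_zero, zero_apply, add_zero, one_smul, add_comm]
  -- The product rule for `y^a q_a` removes the term with `dq`, leaving the Lagrangian.
  have hdA : ∀ s ∈ Set.uIcc 0 t, HasDerivWithinAt
      (fun s => pairing N n m (y s) (q s) - genVal S (s, x, q s))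
      (pairing N n m (posVal (fun _ => H) (0, y s, q s)) (q s) -
        genVal (fun _ => H) (0, y s, q s)) (Set.uIcc 0 t) s := by
    intro s hs
    refine ((hasDerivWithinAt_pairing (hT' s hs).2.1 (hT' s hs).2.2).sub (hdS s hs)).congr_deriv ?_
    abel
  have h0 : genVal S (0, x, q 0) = pairing N n m x (q 0) := hS.genVal_zero (hmem 0 Set.left_mem_uIcc)
  have pc : Continuous fun p : Vec N n m × Vec N n m => pairing N n m p.1 p.2 :=
    (pairing N n m).isBoundedBilinearMap.continuous
  constructor
  · rw [action_eq_integral_pairing (fun s hs => (hT' s hs).2.1),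
      integral_eq_sub_of_hasDerivWithinAt_uIcc hdA ((pc.comp_continuousOn (hcp.prodMk hcq)).sub hcg),
      h0, hy0]
    abel
  · rw [dualAction_eq_integral_pairing (fun s hs => (hT' s hs).2.2),
      integral_eq_sub_of_hasDerivWithinAt_uIcc hdS
        ((pc.comp_continuousOn (hcy.prodMk hcm.neg)).add hcg), h0]
    abel

end Action

/-! ### The action function and the Legendre transform. -/

/-- In `g = p(y, Q) - s(x, Q)` the derivative of `Q` does not contribute to the differential along
`y`, if `y` is the derivative of `s` in the last argument. -/
theorem map_eq_of_legendre {V G : Type*} [NormedAddCommGroup V] [NormedSpace ℝ V]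
    [NormedAddCommGroup G] [NormedSpace ℝ G] {p : V →L[ℝ] V →L[ℝ] G} {g s : ℝ × V × V → G}
    {Q : ℝ × V × V → V} {L M : ℝ × V × V →L[ℝ] G} {Q' : ℝ × V × V →L[ℝ] V} {w : ℝ × V × V}
    {t : ℝ} (hL : HasFDerivAt g L w) (hQ : HasFDerivAt Q Q' w)
    (hM : HasFDerivAt s M (t, w.2.1, Q w)) (hM' : ∀ b, M (0, 0, b) = p w.2.2 b)
    (hg : ∀ᶠ w' in 𝓝 w, g w' = p w'.2.2 (Q w') - s (t, w'.2.1, Q w')) (u : V) :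
    L (0, 0, u) = p u (Q w) := by
  let x' : ℝ × V × V →L[ℝ] V :=
    (ContinuousLinearMap.fst ℝ V V).comp (ContinuousLinearMap.snd ℝ ℝ (V × V))
  let y' : ℝ × V × V →L[ℝ] V :=
    (ContinuousLinearMap.snd ℝ V V).comp (ContinuousLinearMap.snd ℝ ℝ (V × V))
  have h1 := p.hasFDerivAt_of_bilinear (y'.hasFDerivAt (x := w)) hQ
  have h2 : HasFDerivAt (fun w : ℝ × V × V => s (t, w.2.1, Q w)) _ w :=
    HasFDerivAt.comp (g := s) w hM ((hasFDerivAt_const t w).prodMk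
      ((x'.hasFDerivAt (x := w)).prodMk hQ))
  have h := DFunLike.congr_fun (hL.unique ((h1.sub h2).congr_of_eventuallyEq hg)) (0, 0, u)
  have h3 : L (0, 0, u) = p w.2.2 (Q' (0, 0, u)) + p u (Q w) - M (0, 0, Q' (0, 0, u)) := h
  rw [h3, hM']
  abel

section Legendre

variable {N n m : ℕ} {D : Set (ℝ × (Ev n → ℝ))} {S : ℝ → SuperFun (Ev n) (Od m)}
  {H W : SuperFun (Ev n) (Od m)} {t : ℝ} {O : Set (Ev n → ℝ)}
  {Qev : Fin n → SuperFun (Ev n) (Od m)} {Qod : Fin m → SuperFun (Ev n) (Od m)}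

theorem smoothFam_const {ι κ : Type} [Fintype ι] [Fintype κ] {g : SuperFun ι κ} {O : Set (ι → ℝ)}
    (hg : ContDiffOn ℝ ∞ g O) : SmoothFam (Set.univ ×ˢ O) (fun _ => g) :=
  hg.comp contDiffOn_snd fun _ hw => hw.2

theorem IsActionFunction.evenFam (hW : IsActionFunction D H t O W) :
    EvenFam (Set.univ ×ˢ O) (fun _ => W) :=
  ⟨isOpen_univ.prod hW.isOpen, smoothFam_const hW.smooth, fun w hw => hW.even w.2 hw.2⟩

/-- The vector whose coordinates are the values of given functions of positions. -/
def coordVal (Qev : Fin n → SuperFun (Ev n) (Od m)) (Qod : Fin m → SuperFun (Ev n) (Od m))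
    (w : ℝ × Vec N n m × Vec N n m) : Vec N n m :=
  (fun i => evenProj N (genVal (fun _ => Qev i) w), fun α => oddProj N (genVal (fun _ => Qod α) w))

theorem hasFDerivAt_coordVal (hO : IsOpen O) (hev : ∀ i, ContDiffOn ℝ ∞ (Qev i) O)
    (hod : ∀ α, ContDiffOn ℝ ∞ (Qod α) O) {w : ℝ × Vec N n m × Vec N n m}
    (hw : w ∈ pointDomain N (Set.univ ×ˢ O)) :
    HasFDerivAt (coordVal Qev Qod) (fderiv ℝ (coordVal Qev Qod) w) w := by
  choose L hL _ using fun i : Fin n =>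
    exists_hasStrictFDerivAt_pair (isOpen_univ.prod hO) (smoothFam_const (hev i)) hw
  choose M hM _ using fun α : Fin m =>
    exists_hasStrictFDerivAt_pair (isOpen_univ.prod hO) (smoothFam_const (hod α)) hw
  have h : HasStrictFDerivAt (coordVal Qev Qod) _ w := (hasStrictFDerivAt_pi.2 fun i =>
    (evenProj N).hasStrictFDerivAt.comp w (hL i)).prodMk (hasStrictFDerivAt_pi.2 fun α =>
    (oddProj N).hasStrictFDerivAt.comp w (hM α))
  exact h.hasFDerivAt.differentiableAt.hasFDerivAt

/-- The condition on the final momenta in the definition of the action function. -/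
def IsMomentumFamily (D : Set (ℝ × (Ev n → ℝ))) (H : SuperFun (Ev n) (Od m)) (t : ℝ)
    (O : Set (Ev n → ℝ)) (W : SuperFun (Ev n) (Od m)) (Qev : Fin n → SuperFun (Ev n) (Od m))
    (Qod : Fin m → SuperFun (Ev n) (Od m)) : Prop :=
  ∀ (N : ℕ) (x y : Pt N n m), (x.pair y).body ∈ O → ∃ Y Q : ℝ → Pt N n m,
    IsTrajectoryFrom D H t x Y Q ∧ Y t = y ∧
    (∀ i, ((Q t).ev i : Lam N) = eval (Qev i) (x.pair y)) ∧
    (∀ α, ((Q t).od α : Lam N) = eval (Qod α) (x.pair y)) ∧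
    eval W (x.pair y) = action H t Y Q

/-- No parity is assumed for `Qev` and `Qod`. Their values have the right parity because they are
coordinates of an actual final momentum, so the projections in `coordVal` change nothing. -/
theorem IsMomentumFamily.coordVal_mem (hQ : IsMomentumFamily D H t O W Qev Qod)
    {w : ℝ × Vec N n m × Vec N n m} (hw : w ∈ pointDomain N (Set.univ ×ˢ O)) :
    (∀ i, ((coordVal Qev Qod w).1 i : Lam N) = genVal (fun _ => Qev i) w) ∧
      ∀ α, ((coordVal Qev Qod w).2 α : Lam N) = genVal (fun _ => Qod α) w := by
  obtain ⟨Y, Q, -, -, h1, h2, -⟩ := hQ N (toPoint w.2.1) (toPoint w.2.2) hw.2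
  refine ⟨fun i => evenProj_apply ?_, fun α => oddProj_apply ?_⟩
  · exact (congrArg (· ∈ evenPart (Fin N)) (h1 i)).mp ((Q t).ev i).2
  · exact (congrArg (· ∈ oddPart (Fin N)) (h2 α)).mp ((Q t).od α).2

theorem IsMomentumFamily.coordVal_incl (hQ : IsMomentumFamily D H t O W Qev Qod)
    {w : ℝ × Vec N n m × Vec N n m} (hw : w ∈ pointDomain N (Set.univ ×ˢ O)) :
    coordVal Qev Qod (inclTriple N n m w) = inclPt N _ _ (coordVal Qev Qod w) := by
  refine vec_ext (fun i => ?_) (fun α => ?_)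
  · rw [(hQ.coordVal_mem (inclTriple_mem hw)).1, inclPt_fst, (hQ.coordVal_mem hw).1]
    exact eval_pair_inclTriple _ _
  · rw [(hQ.coordVal_mem (inclTriple_mem hw)).2, inclPt_snd, (hQ.coordVal_mem hw).2]
    exact eval_pair_inclTriple _ _

/-- The final momenta of the trajectories between given positions satisfy the equations of the
canonical relation, and the action is obtained from the generating function. -/
theorem IsMomentumFamily.genVal_eq (hS : IsThickGroup D S H)
    (hQ : IsMomentumFamily D H t O W Qev Qod) {w : ℝ × Vec N n m × Vec N n m}
    (hw : w ∈ pointDomain N (Set.univ ×ˢ O)) :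
    (t, w.2.1, coordVal Qev Qod w) ∈ pointDomain N D ∧
      w.2.2 = posVal S (t, w.2.1, coordVal Qev Qod w) ∧
      genVal (fun _ => W) w = pairing N n m w.2.2 (coordVal Qev Qod w) -
        genVal S (t, w.2.1, coordVal Qev Qod w) := by
  obtain ⟨Y, Q, hT, hY, h1, h2, h3⟩ := hQ N (toPoint w.2.1) (toPoint w.2.2) hw.2
  let y : ℝ → Vec N n m := fun u => ((Y u).ev, (Y u).od)
  let q : ℝ → Vec N n m := fun u => ((Q u).ev, (Q u).od)
  have hT' : IsTrajectoryFrom D H t (toPoint w.2.1) (fun u => toPoint (y u))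
    (fun u => toPoint (q u)) := hT
  have hq : coordVal Qev Qod w = q t := vec_ext
    (fun i => ((hQ.coordVal_mem hw).1 i).trans (h1 i).symm)
    (fun α => ((hQ.coordVal_mem hw).2 α).trans (h2 α).symm)
  have hy : w.2.2 = y t :=
    congrArg (fun p : Pt N n m => ((p.ev, p.od) : Vec N n m)) hY.symm
  rw [hq]
  refine ⟨hT.mem_domain t Set.right_mem_uIcc, ?_, ?_⟩
  · rw [hy]
    exact hS.trajectory_pos hT' Set.right_mem_uIcc
  · rw [(hS.genVal_trajectory hT').1, ← hy, sub_sub_cancel]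
    exact h3

theorem pairing_eq_conj (x q : Vec N n m) :
    pairing N n m x q = pairing N n m (q.1, -q.2) x := by
  simp only [pairing_apply, contract, toPoint]
  refine congrArg₂ (· + ·) (Finset.sum_congr rfl fun i _ => even_mul_comm (x.1 i).2 _)
    (Finset.sum_congr rfl fun α _ => ?_)
  rw [odd_mul_odd _ _ (x.2 α).2 (q.2 α).2, Pi.neg_apply, Submodule.coe_neg, neg_mul]

/-- The relation `y = posVal S (t, x, Q)` makes `y^a Q_a - S_t(x,Q)` stationary in `Q`. The
derivative of `W` in `y` is therefore taken with `Q` held fixed. -/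
theorem IsActionFunction.pairing_posVal (hS : IsThickGroup D S H)
    (hW : IsActionFunction D H t O W) (hev : ∀ i, ContDiffOn ℝ ∞ (Qev i) O)
    (hod : ∀ α, ContDiffOn ℝ ∞ (Qod α) O) (hQ : IsMomentumFamily D H t O W Qev Qod)
    {w : ℝ × Vec N n m × Vec N n m} (hw : w ∈ pointDomain N (Set.univ ×ˢ O)) (u : Vec N n m) :
    pairing N n m (posVal (fun _ => W) w) u = pairing N n m u (coordVal Qev Qod w) := by
  obtain ⟨h1, h2, -⟩ := hQ.genVal_eq hS hw
  have hopen := isOpen_pointDomain (N := N) (m := m) (isOpen_univ.prod hW.isOpen)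
  obtain ⟨L, hL, hL'⟩ := hW.evenFam.exists_genVal hw
  obtain ⟨M, hM, hM'⟩ := hS.evenFam.exists_genVal h1
  have key := map_eq_of_legendre hL.hasFDerivAt (hasFDerivAt_coordVal hW.isOpen hev hod hw)
    hM.hasFDerivAt (fun b => ?_) (Filter.eventually_of_mem (hopen.mem_nhds hw)
      fun w' hw' => (hQ.genVal_eq hS hw').2.2) u
  · rw [← key, hL', zero_smul, map_zero, zero_apply, zero_add, zero_add]
  · rw [hM', ← h2, zero_smul, map_zero, zero_apply, zero_add, zero_add]

/-- The derivative of the action in the final position is the final momentum. -/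
theorem IsActionFunction.legendreMomentum_iff (hS : IsThickGroup D S H)
    (hW : IsActionFunction D H t O W) (hev : ∀ i, ContDiffOn ℝ ∞ (Qev i) O)
    (hod : ∀ α, ContDiffOn ℝ ∞ (Qod α) O) (hQ : IsMomentumFamily D H t O W Qev Qod)
    {x y q : Vec N n m} (hw : (0, x, y) ∈ pointDomain N (Set.univ ×ˢ O)) :
    LegendreMomentum W (toPoint x) (toPoint y) (toPoint q) ↔ q = coordVal Qev Qod (0, x, y) := by
  have hf := hW.evenFam
  -- The increment is stripped after passing to `Λ_{N+1}`. The minus sign on the odd part comes from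
  -- exchanging the arguments of the pairing, and it is the sign built into `posVal`.
  have hp : posVal (fun _ => W) (0, x, y) =
      ((coordVal Qev Qod (0, x, y)).1, -(coordVal Qev Qod (0, x, y)).2) := by
    refine sub_eq_zero.1 (eq_zero_of_pairing_right fun u => ?_)
    have h := hW.pairing_posVal hS hev hod hQ (inclTriple_mem hw) u
    rw [hf.posVal_incl hw, hQ.coordVal_incl hw, pairing_eq_conj u] at h
    have e : inclPt N (Fin n) (Fin m)
        ((coordVal Qev Qod (0, x, y)).1, -(coordVal Qev Qod (0, x, y)).2) =
        ((inclPt N _ _ (coordVal Qev Qod (0, x, y))).1,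
          -(inclPt N _ _ (coordVal Qev Qod (0, x, y))).2) := by
      refine vec_ext (fun i => rfl) (fun α => ?_)
      exact map_neg (lamIncl N) _
    rw [map_sub, e, map_sub, sub_apply, h, sub_self]
  have he : ∀ i, ((coordVal Qev Qod (0, x, y)).1 i : Lam N) =
      eval (dEven W (Sum.inr i)) ((toPoint x).pair (toPoint y)) := fun i => by
    have := hf.posVal_fst hw i
    rw [hp] at this
    exact this
  have ho : ∀ α, ((coordVal Qev Qod (0, x, y)).2 α : Lam N) =
      eval (dOdd W (Sum.inr α)) ((toPoint x).pair (toPoint y)) := fun α => by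
    have := hf.posVal_snd hw α
    rw [hp] at this
    exact neg_injective this
  constructor
  · rintro ⟨h1, h2⟩
    exact vec_ext (fun i => (h1 i).trans (he i).symm) (fun α => (h2 α).trans (ho α).symm)
  · rintro rfl
    exact ⟨he, ho⟩

/-- A point as a vector of coordinates. -/
def ofPoint (p : Pt N n m) : Vec N n m := (p.ev, p.od)

theorem toPoint_ofPoint (p : Pt N n m) : toPoint (ofPoint p) = p := rfl

theorem IsActionFunction.isLegendreTransform (hS : IsThickGroup D S H)
    (hW : IsActionFunction D H t O W) : IsLegendreTransform O W (slice D t) (S t) := by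
  obtain ⟨Qev, Qod, hev, hod, hQ⟩ := hW.family
  have hQ : IsMomentumFamily D H t O W Qev Qod := hQ
  have hmem : ∀ {N : ℕ} (x y : Pt N n m), (x.pair y).body ∈ O →
      (0, ofPoint x, ofPoint y) ∈ pointDomain N (Set.univ ×ˢ O) := fun x y h => ⟨trivial, h⟩
  have hiff : ∀ {N : ℕ} (x y q : Pt N n m), (x.pair y).body ∈ O → (LegendreMomentum W x y q ↔
      ofPoint q = coordVal Qev Qod (0, ofPoint x, ofPoint y)) :=
    fun x y q h => by
      have := hW.legendreMomentum_iff hS hev hod hQ (hmem x y h) (q := ofPoint q)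
      rwa [toPoint_ofPoint, toPoint_ofPoint, toPoint_ofPoint] at this
  refine ⟨fun N x y h => ?_, fun N x y q h hq => ?_, fun N x y y' q h h' hq hq' => ?_⟩
  · exact ⟨toPoint (coordVal Qev Qod (0, ofPoint x, ofPoint y)), (hiff x y _ h).2 rfl⟩
  · obtain ⟨h1, -, h3⟩ := hQ.genVal_eq hS (hmem x y h)
    rw [← (hiff x y q h).1 hq] at h1 h3
    have h4 : genVal S (t, ofPoint x, ofPoint q) = pairing N n m (ofPoint y) (ofPoint q) -
        genVal (fun _ => W) (0, ofPoint x, ofPoint y) := by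
      rw [h3, sub_sub_cancel]
    exact ⟨h1, h4⟩
  -- The inverse of the Legendre map is explicit: `y` is the position that `S_t` assigns to `(x,
  -- q)`.
  · have e := (hQ.genVal_eq hS (hmem x y h)).2.1
    have e' := (hQ.genVal_eq hS (hmem x y' h')).2.1
    rw [← (hiff x y q h).1 hq] at e
    rw [← (hiff x y' q h').1 hq'] at e'
    exact congrArg toPoint (e.trans e'.symm)

end Legendre

/-! ### Assembly for arbitrary trajectories. -/

section Main

variable {N n m : ℕ} {D : Set (ℝ × (Ev n → ℝ))} {S : ℝ → SuperFun (Ev n) (Od m)}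
  {H : SuperFun (Ev n) (Od m)} {t : ℝ}

theorem IsThickGroup.eval_eq_of_trajectory (hS : IsThickGroup D S H) {x : Pt N n m}
    {y q : ℝ → Pt N n m} (hT : IsTrajectoryFrom D H t x y q) :
    PositionEq (S t) x (q t) (y t) ∧ MomentumEq (S t) x (q t) (q 0) ∧
      eval (S t) (x.pair (q t)) = contract (y t) (q t) - action H t y q ∧
      eval (S t) (x.pair (q t)) = contract x (q 0) + dualAction H t y q := by
  have hT' : IsTrajectoryFrom D H t (toPoint (ofPoint x)) (fun u => toPoint (ofPoint (y u)))
    (fun u => toPoint (ofPoint (q u))) := hT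
  have hm : (t, ofPoint x, ofPoint (q t)) ∈ pointDomain N D := hT.mem_domain t Set.right_mem_uIcc
  have h1 := (hS.evenFam.positionEq_iff hm).2 (hS.trajectory_pos hT' Set.right_mem_uIcc)
  have h2 := (hS.evenFam.momentumEq_iff hm).2 (hS.trajectory_mom hT' Set.right_mem_uIcc)
  obtain ⟨h3, h4⟩ := hS.genVal_trajectory hT'
  rw [toPoint_ofPoint, toPoint_ofPoint, toPoint_ofPoint] at h1 h2
  exact ⟨h1, h2, h3, h4⟩

end Main

end ThickMorphism

end

theorem mainTheorem7 (n m : ℕ) (D : Set (ℝ × (ThickMorphism.Ev n → ℝ)))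
    (S : ℝ → ThickMorphism.SuperFun (ThickMorphism.Ev n) (ThickMorphism.Od m))
    (H : ThickMorphism.SuperFun (ThickMorphism.Ev n) (ThickMorphism.Od m))
    (hS : ThickMorphism.IsThickGroup D S H) (t : ℝ) :
    (∀ (N : ℕ) (x q₁ : ThickMorphism.Pt N n m),
      (x.pair q₁).body ∈ ThickMorphism.slice D t →
      (∃ y q : ℝ → ThickMorphism.Pt N n m,
        ThickMorphism.IsTrajectoryFrom D H t x y q ∧ q t = q₁) ∧
      ∀ y q : ℝ → ThickMorphism.Pt N n m,
        ThickMorphism.IsTrajectoryFrom D H t x y q → q t = q₁ →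
        ThickMorphism.PositionEq (S t) x q₁ (y t) ∧
        ThickMorphism.MomentumEq (S t) x q₁ (q 0) ∧
        ThickMorphism.eval (S t) (x.pair q₁) =
          ThickMorphism.contract (y t) q₁ - ThickMorphism.action H t y q ∧
        ThickMorphism.eval (S t) (x.pair q₁) =
          ThickMorphism.contract x (q 0) + ThickMorphism.dualAction H t y q) ∧
    (∀ (O : Set (ThickMorphism.Ev n → ℝ))
      (W : ThickMorphism.SuperFun (ThickMorphism.Ev n) (ThickMorphism.Od m)),
      ThickMorphism.IsActionFunction D H t O W →
      ThickMorphism.IsLegendreTransform O W (ThickMorphism.slice D t) (S t)) := by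
  refine ⟨fun N x q₁ hx => ⟨?_, fun y q hT hq => ?_⟩, fun O W hW => hW.isLegendreTransform hS⟩
  · obtain ⟨y, q, hT, hq⟩ := hS.exists_trajectory (x := ThickMorphism.ofPoint x)
      (r := ThickMorphism.ofPoint q₁) hx
    exact ⟨fun u => ThickMorphism.toPoint (y u), fun u => ThickMorphism.toPoint (q u), hT,
      congrArg ThickMorphism.toPoint hq⟩
  · subst hq
    exact hS.eval_eq_of_trajectory hT
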